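/- Let $k$ be an algebraically closed field (of any characteristic), $N\cong\mathbb Z^n$ a lattice with dual $M=\mathrm{Hom}(N,\mathbb Z)$, and $\Delta$ a fan in $N$, that is, a set of strongly convex rational polyhedral cones in $N\otimes\mathbb R$ which contains every face of each of its cones and in which any two cones intersect in a common face of both. Let $X=X(\Delta)$ be the associated toric variety over $k$, glued from the affine varieties $\mathrm{Spec}\,k[\sigma^\vee\cap M]$ for $\sigma\in\Delta$, with its action of the torus $T=N\otimes k^*$. Suppose that $X$ is smooth and projective over $k$. Let $i\colon Y\hookrightarrow X$ be the inclusion of a $T$-invariant prime divisor, i.e. of an integral closed subscheme of codimension $1$ that is stable under $T$. Write $T_X=\mathcal{D}er_k(\mathcal O_X,\mathcal O_X)$ and $T_Y=\mathcal{D}er_k(\mathcal O_Y,\mathcal O_Y)$ for the tangent sheaves, $T_X|_Y=i^*T_X$, and $N_{Y/X}=\mathcal{H}om_{\mathcal O_Y}(I/I^2,\mathcal O_Y)$ for the normal sheaf, where $I$ is the ideal sheaf of $Y$ in $X$. Then the canonical map $T_X|_Y\to \mathcal{D}er_k(i^{-1}\mathcal O_X,\mathcal O_Y)$ is an isomorphism,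 and, with the natural maps which it induces (restriction of derivations of $\mathcal O_Y$ along $i^{-1}\mathcal O_X\to\mathcal O_Y$, and restriction of derivations to $I$), the normal sequence $$0\to T_Y\to T_X|_Y\to N_{Y/X}\to 0$$ is exact and splits as a sequence of $\mathcal O_Y$-modules: there is an $\mathcal O_Y$-linear map $N_{Y/X}\to T_X|_Y$ whose composite with $T_X|_Y\to N_{Y/X}$ is the identity. -/

import Mathlib

open CategoryTheory Limits AlgebraicGeometry TensorProduct

universe u

namespace Toric

/-- A finite family of vectors of a rational vector space without nontrivial nonnegative linear
relation is contained in an open half space. -/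
theorem exists_pos_functional {ι : Type u} [DecidableEq ι] (s : Finset ι) :
    ∀ {V : Type u} [AddCommGroup V] [Module ℚ V] (w : ι → V),
      (∀ c : ι → ℚ, (∀ i ∈ s, 0 ≤ c i) → ∑ i ∈ s, c i • w i = 0 → ∀ i ∈ s, c i = 0) →
      ∃ f : V →ₗ[ℚ] ℚ, ∀ i ∈ s, 0 < f (w i) := by
  induction s using Finset.induction_on with
  | empty => intro V _ _ w _; exact ⟨0, by simp⟩
  | insert a s ha ih =>
    intro V _ _ w h
    have hs : ∀ c : ι → ℚ, (∀ i ∈ s, 0 ≤ c i) → ∀ l : ℚ, 0 ≤ l →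
        l • w a + ∑ i ∈ s, c i • w i = 0 → l = 0 ∧ ∀ i ∈ s, c i = 0 := by
      intro c hc l hl hsum
      have hne : ∀ i ∈ s, i ≠ a := fun i hi e => ha (e ▸ hi)
      have := h (fun i => if i = a then l else c i) (by
        intro i hi
        by_cases e : i = a
        · simp [e, hl]
        · simpa [e] using hc i (Finset.mem_of_mem_insert_of_ne hi e)) (by
        rw [Finset.sum_insert ha, if_pos rfl, ← hsum]
        congr 1
        exact Finset.sum_congr rfl fun i hi => by rw [if_neg (hne i hi)])
      refine ⟨by simpa using this a (Finset.mem_insert_self _ _), fun i hi => ?_⟩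
      simpa [hne i hi] using this i (Finset.mem_insert_of_mem hi)
    have hwa : w a ≠ 0 := by
      intro e
      have := (hs 0 (by simp) 1 zero_le_one (by simp [e])).1
      exact one_ne_zero this
    by_cases hq : ∀ c : ι → ℚ, (∀ i ∈ s, 0 ≤ c i) →
        ∑ i ∈ s, c i • (Submodule.span ℚ {w a}).mkQ (w i) = 0 → ∀ i ∈ s, c i = 0
    · obtain ⟨f, hf⟩ := ih (fun i => (Submodule.span ℚ {w a}).mkQ (w i)) hq
      obtain ⟨g, hg⟩ := Module.Projective.exists_dual_ne_zero ℚ hwa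
      obtain ⟨g, hg⟩ : ∃ g : V →ₗ[ℚ] ℚ, g (w a) = 1 := ⟨(g (w a))⁻¹ • g, by simp [hg]⟩
      have hfa : f ((Submodule.span ℚ {w a}).mkQ (w a)) = 0 := by
        rw [Submodule.mkQ_apply,
          (Submodule.Quotient.mk_eq_zero _).2 (Submodule.mem_span_singleton_self _), map_zero]
      obtain ⟨L, hL⟩ : ∃ L : ℚ, ∀ i ∈ s,
          0 < L * f ((Submodule.span ℚ {w a}).mkQ (w i)) + g (w i) := by
        refine ⟨∑ i ∈ s, (|g (w i)| + 1) / f ((Submodule.span ℚ {w a}).mkQ (w i)),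
          fun i hi => ?_⟩
        have h1 : (|g (w i)| + 1) / f ((Submodule.span ℚ {w a}).mkQ (w i)) ≤
            ∑ i ∈ s, (|g (w i)| + 1) / f ((Submodule.span ℚ {w a}).mkQ (w i)) :=
          Finset.single_le_sum (f := fun i =>
            (|g (w i)| + 1) / f ((Submodule.span ℚ {w a}).mkQ (w i)))
            (fun j hj => div_nonneg (by positivity) (hf j hj).le) hi
        have h2 := (div_le_iff₀ (hf i hi)).1 h1
        have := neg_abs_le (g (w i))
        linarith
      refine ⟨L • f ∘ₗ (Submodule.span ℚ {w a}).mkQ + g, fun i hi => ?_⟩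
      rcases Finset.mem_insert.1 hi with rfl | hi
      · change 0 < L • f ((Submodule.span ℚ {w i}).mkQ (w i)) + g (w i)
        rw [hfa, hg]
        simp
      · simpa using hL i hi
    · push Not at hq
      obtain ⟨c, hc, hsum, j, hj, hcj⟩ := hq
      have hmem : ∑ i ∈ s, c i • w i ∈ Submodule.span ℚ {w a} := by
        rw [← Submodule.Quotient.mk_eq_zero, ← Submodule.mkQ_apply]
        simpa using hsum
      obtain ⟨l, hl⟩ := Submodule.mem_span_singleton.1 hmem
      have hlpos : 0 < l := by
        by_contra hneg
        exact hcj ((hs c hc (-l) (by linarith) (by rw [← hl]; simp)).2 j hj)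
      obtain ⟨f, hf⟩ := ih w (fun d hd hsum' =>
        (hs d hd 0 le_rfl (by simpa using hsum')).2)
      refine ⟨f, fun i hi => ?_⟩
      rcases Finset.mem_insert.1 hi with rfl | hi
      · have h1 : l * f (w i) = ∑ j ∈ s, c j * f (w j) := by
          simpa using congrArg f hl
        have h2 : 0 < ∑ j ∈ s, c j * f (w j) :=
          Finset.sum_pos' (fun k hk => mul_nonneg (hc k hk) (hf k hk).le)
            ⟨j, hj, mul_pos (lt_of_le_of_ne (hc j hj) (Ne.symm hcj)) (hf j hj)⟩
        rw [← h1] at h2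
        exact (mul_pos_iff_of_pos_left hlpos).1 h2
      · exact hf i hi

section Cones

variable {N : Type u} [AddCommGroup N]

/-- The pairing `⟨m, ·⟩ : N_ℝ → ℝ` of `m ∈ M = Hom(N, ℤ)` with `N_ℝ = ℝ ⊗ N`. -/
noncomputable def pairing (m : Module.Dual ℤ N) : ℝ ⊗[ℤ] N →ₗ[ℝ] ℝ :=
  m.baseChange ℝ

@[simp] theorem pairing_tmul (m : Module.Dual ℤ N) (r : ℝ) (v : N) :
    pairing m (r ⊗ₜ[ℤ] v) = m v * r := by
  simp [pairing]

theorem pairing_zero : pairing (0 : Module.Dual ℤ N) = 0 := by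
  ext v; simp

theorem pairing_add (m m' : Module.Dual ℤ N) : pairing (m + m') = pairing m + pairing m' := by
  ext v; simp

/-- The convex cone `⟨S⟩` in `N_ℝ` generated by a set `S` of lattice vectors. -/
noncomputable def latticeCone (S : Set N) : PointedCone ℝ (ℝ ⊗[ℤ] N) :=
  PointedCone.hull ℝ ((fun v : N => (1 : ℝ) ⊗ₜ[ℤ] v) '' S)

/-- Strongly convex rational polyhedral cones: generated by finitely many lattice vectors, and
containing no nontrivial linear subspace of `N_ℝ`. -/
structure IsStronglyConvexRational (σ : PointedCone ℝ (ℝ ⊗[ℤ] N)) : Prop where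
  rational : ∃ S : Finset N, σ = latticeCone (S : Set N)
  stronglyConvex : ∀ L : Submodule ℝ (ℝ ⊗[ℤ] N), (L : Set (ℝ ⊗[ℤ] N)) ⊆ σ → L = ⊥

/-- The semigroup `σ^∨ ∩ M`. -/
noncomputable def dualMonoid (σ : PointedCone ℝ (ℝ ⊗[ℤ] N)) : AddSubmonoid (Module.Dual ℤ N) where
  carrier := {m | ∀ x ∈ σ, 0 ≤ pairing m x}
  zero_mem' := by simp [pairing_zero]
  add_mem' := by
    intro a b ha hb x hx
    rw [pairing_add]
    exact add_nonneg (ha x hx) (hb x hx)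

theorem mem_dualMonoid {σ : PointedCone ℝ (ℝ ⊗[ℤ] N)} {m : Module.Dual ℤ N} :
    m ∈ dualMonoid σ ↔ ∀ x ∈ σ, 0 ≤ pairing m x := Iff.rfl

theorem dualMonoid_anti {σ τ : PointedCone ℝ (ℝ ⊗[ℤ] N)} (h : τ ≤ σ) :
    dualMonoid σ ≤ dualMonoid τ := fun _ hm x hx => hm x (h hx)

theorem mem_latticeCone_iff {S : Finset N} {x : ℝ ⊗[ℤ] N} :
    x ∈ latticeCone (S : Set N) ↔
      ∃ c : N → ℝ, (∀ v, 0 ≤ c v) ∧ ∑ v ∈ S, c v • ((1 : ℝ) ⊗ₜ[ℤ] v) = x := by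
  classical
  constructor
  · intro hx
    unfold latticeCone at hx
    induction hx using Submodule.span_induction with
    | mem x hx =>
      obtain ⟨v, hv, rfl⟩ := hx
      refine ⟨fun w => if w = v then 1 else 0, fun w => by positivity, ?_⟩
      simp only [ite_smul, one_smul, zero_smul]
      rw [Finset.sum_ite_eq' S v, if_pos (by simpa using hv)]
    | zero => exact ⟨0, by simp, by simp⟩
    | add x y _ _ hx hy =>
      obtain ⟨c, hc, rfl⟩ := hx
      obtain ⟨d, hd, rfl⟩ := hy
      refine ⟨c + d, fun v => add_nonneg (hc v) (hd v), ?_⟩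
      simp [add_smul, Finset.sum_add_distrib]
    | smul r x _ hx =>
      obtain ⟨c, hc, rfl⟩ := hx
      refine ⟨fun v => r * c v, fun v => mul_nonneg r.2 (hc v), ?_⟩
      change _ = (r : ℝ) • ∑ v ∈ S, c v • ((1 : ℝ) ⊗ₜ[ℤ] v)
      rw [Finset.smul_sum]
      exact Finset.sum_congr rfl fun v _ => mul_smul _ _ _
  · rintro ⟨c, hc, rfl⟩
    exact sum_mem fun v hv => PointedCone.smul_mem _ (hc v)
      (Submodule.subset_span ⟨v, hv, rfl⟩)

/-- `m ∈ σ^∨ ∩ M` and `τ = σ ∩ m^⊥` (for a subcone `τ` of `σ`). -/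
def Exposes (m : Module.Dual ℤ N) (τ σ : PointedCone ℝ (ℝ ⊗[ℤ] N)) : Prop :=
  m ∈ dualMonoid σ ∧ ∀ x ∈ σ, x ∈ τ ↔ pairing m x = 0

theorem Exposes.inf {m m' : Module.Dual ℤ N} {τ τ' σ : PointedCone ℝ (ℝ ⊗[ℤ] N)}
    (h : Exposes m τ σ) (h' : Exposes m' τ' σ) : Exposes (m + m') (τ ⊓ τ') σ := by
  refine ⟨add_mem h.1 h'.1, fun x hx => ?_⟩
  rw [Submodule.mem_inf, h.2 x hx, h'.2 x hx, pairing_add, LinearMap.add_apply]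
  have h1 := h.1 x hx
  have h2 := h'.1 x hx
  constructor
  · rintro ⟨a, b⟩; rw [a, b, add_zero]
  · intro e; constructor <;> linarith

theorem exists_integral_multiple [Module.Free ℤ N] [Module.Finite ℤ N] (g : N →ₗ[ℤ] ℚ) :
    ∃ (d : ℤ) (m : Module.Dual ℤ N), 0 < d ∧ ∀ v, (m v : ℚ) = d * g v := by
  let b := Module.Free.chooseBasis ℤ N
  obtain ⟨d, hd⟩ := IsLocalization.exist_integer_multiples_of_finset (nonZeroDivisors ℤ)
    (Finset.univ.image fun i => g (b i))
  have hd' : ∀ i, ∃ z : ℤ, (z : ℚ) = (d : ℤ) * g (b i) := by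
    intro i
    obtain ⟨z, hz⟩ := hd (g (b i)) (by simp)
    exact ⟨z, by simpa using hz⟩
  choose z hz using hd'
  have hd0 : (d : ℤ) ≠ 0 := nonZeroDivisors.coe_ne_zero d
  refine ⟨(d : ℤ) * d, (d : ℤ) • b.constr ℤ z, mul_self_pos.2 hd0, fun v => ?_⟩
  have key : (Int.castAddHom ℚ).toIntLinearMap ∘ₗ b.constr ℤ z = (d : ℤ) • g := by
    refine b.ext fun i => ?_
    simp [hz i]
  have := LinearMap.congr_fun key v
  simp at this
  simp [this, mul_assoc]

/-- Every face of a rational polyhedral cone is cut out by a supporting hyperplane that is given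
by an element of `M`. -/
theorem exists_exposes [Module.Free ℤ N] [Module.Finite ℤ N]
    {τ σ : PointedCone ℝ (ℝ ⊗[ℤ] N)} (hσ : ∃ S : Finset N, σ = latticeCone (S : Set N))
    (h : τ.IsFaceOf σ) : ∃ m : Module.Dual ℤ N, Exposes m τ σ := by
  classical
  obtain ⟨S, rfl⟩ := hσ
  let e : N → ℝ ⊗[ℤ] N := fun v => (1 : ℝ) ⊗ₜ[ℤ] v
  have heS : ∀ v ∈ S, e v ∈ latticeCone (S : Set N) := fun v hv =>
    Submodule.subset_span ⟨v, hv, rfl⟩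
  let A := S.filter fun v => e v ∈ τ
  let B := S.filter fun v => e v ∉ τ
  let q : N → ℚ ⊗[ℤ] N := fun v => (1 : ℚ) ⊗ₜ[ℤ] v
  let W : Submodule ℚ (ℚ ⊗[ℤ] N) := Submodule.span ℚ (q '' (A : Set N))
  let toR : ℚ ⊗[ℤ] N →ₗ[ℤ] ℝ ⊗[ℤ] N :=
    LinearMap.rTensor N (algebraMap ℚ ℝ).toAddMonoidHom.toIntLinearMap
  have htoR : ∀ (c : ℚ) (v : N), toR (c • q v) = (c : ℝ) • e v := by
    intro c v
    simp only [toR, q, e, TensorProduct.smul_tmul', smul_eq_mul, mul_one]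
    exact LinearMap.rTensor_tmul _ _ _ _
  obtain ⟨f, hf⟩ := exists_pos_functional B (fun v => W.mkQ (q v)) (by
    intro c hc hsum b hb
    by_contra hcb
    have hcb : 0 < c b := lt_of_le_of_ne (hc b hb) (Ne.symm hcb)
    have hmem : ∑ v ∈ B, c v • q v ∈ W := by
      rw [← Submodule.Quotient.mk_eq_zero, ← Submodule.mkQ_apply]
      simpa using hsum
    obtain ⟨a, ha⟩ : ∃ a : N → ℚ, ∑ v ∈ A, a v • q v = ∑ v ∈ B, c v • q v := by
      obtain ⟨a, ha⟩ := (Submodule.mem_span_image_finset_iff_exists_fun ℚ).1 hmem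
      refine ⟨fun v => if hv : v ∈ A then a ⟨v, hv⟩ else 0, ?_⟩
      rw [← ha, ← Finset.sum_coe_sort A]
      exact Finset.sum_congr rfl fun v _ => by simp [v.2]
    have hR : ∑ v ∈ A, (a v : ℝ) • e v = ∑ v ∈ B, (c v : ℝ) • e v := by
      have := congrArg toR ha
      rw [map_sum, map_sum] at this
      simpa only [htoR] using this
    have hA : ∀ v ∈ A, e v ∈ τ := fun v hv => (Finset.mem_filter.1 hv).2
    have hB : ∀ v ∈ B, e v ∈ latticeCone (S : Set N) := fun v hv =>
      heS v (Finset.mem_filter.1 hv).1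
    have h1 : ∑ v ∈ A, |(a v : ℝ)| • e v + ∑ v ∈ B, (c v : ℝ) • e v ∈ τ := by
      rw [← hR, ← Finset.sum_add_distrib]
      refine sum_mem fun v hv => ?_
      rw [← add_smul]
      exact τ.smul_mem (by linarith [neg_abs_le (a v : ℝ)]) (hA v hv)
    have h2 : ∑ v ∈ A, |(a v : ℝ)| • e v ∈ latticeCone (S : Set N) :=
      sum_mem fun v hv => PointedCone.smul_mem _ (abs_nonneg _) (h.le (hA v hv))
    have h3 : ∀ v ∈ B, (c v : ℝ) • e v ∈ latticeCone (S : Set N) := fun v hv =>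
      PointedCone.smul_mem _ (by exact_mod_cast hc v hv) (hB v hv)
    have h4 := h.mem_of_add_mem_right h2 (sum_mem h3) h1
    rw [← Finset.add_sum_erase _ _ hb] at h4
    have h5 := h.mem_of_smul_add_mem (hB b hb)
      (sum_mem fun v hv => h3 v (Finset.mem_of_mem_erase hv)) (by exact_mod_cast hcb) h4
    exact (Finset.mem_filter.1 hb).2 h5)
  let g : N →ₗ[ℤ] ℚ := (f.restrictScalars ℤ ∘ₗ W.mkQ.restrictScalars ℤ) ∘ₗ
    (TensorProduct.mk ℤ ℚ N 1)
  have hgB : ∀ v ∈ B, 0 < g v := hf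
  have hgA : ∀ v ∈ A, g v = 0 := by
    intro v hv
    have : W.mkQ (q v) = 0 := by
      rw [Submodule.mkQ_apply]
      exact (Submodule.Quotient.mk_eq_zero _).2 (Submodule.subset_span ⟨v, hv, rfl⟩)
    change f (W.mkQ (q v)) = 0
    rw [this, map_zero]
  obtain ⟨d, m, hd, hm⟩ := exists_integral_multiple g
  have hdq : (0 : ℚ) < d := by exact_mod_cast hd
  have hmA : ∀ v ∈ S, e v ∈ τ → m v = 0 := by
    intro v hv hvt
    have := hm v
    rw [hgA v (Finset.mem_filter.2 ⟨hv, hvt⟩), mul_zero] at this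
    exact_mod_cast this
  have hmB : ∀ v ∈ S, e v ∉ τ → 0 < m v := by
    intro v hv hvt
    have h1 := mul_pos hdq (hgB v (Finset.mem_filter.2 ⟨hv, hvt⟩))
    rw [← hm v] at h1
    exact_mod_cast h1
  have hm0 : ∀ v ∈ S, 0 ≤ m v := fun v hv => by
    by_cases hvt : e v ∈ τ
    · exact (hmA v hv hvt).ge
    · exact (hmB v hv hvt).le
  have hpair : ∀ c : N → ℝ, pairing m (∑ v ∈ S, c v • e v) = ∑ v ∈ S, c v * m v := by
    intro c
    simp [e]
  refine ⟨m, ?_, ?_⟩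
  · intro x hx
    obtain ⟨c, hc, rfl⟩ := mem_latticeCone_iff.1 hx
    rw [hpair]
    exact Finset.sum_nonneg fun v hv => mul_nonneg (hc v) (by exact_mod_cast hm0 v hv)
  · intro x hx
    obtain ⟨c, hc, rfl⟩ := mem_latticeCone_iff.1 hx
    rw [hpair]
    have h3 : ∀ v ∈ S, c v • e v ∈ latticeCone (S : Set N) := fun v hv =>
      PointedCone.smul_mem _ (hc v) (heS v hv)
    constructor
    · intro hxt
      refine Finset.sum_eq_zero fun v hv => ?_
      rcases (hc v).eq_or_lt with h0 | h0
      · rw [← h0, zero_mul]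
      · rw [← Finset.add_sum_erase _ _ hv] at hxt
        have h5 := h.mem_of_smul_add_mem (heS v hv)
          (sum_mem fun v hv => h3 v (Finset.mem_of_mem_erase hv)) h0 hxt
        rw [hmA v hv h5]; simp
    · intro h0
      rw [Finset.sum_eq_zero_iff_of_nonneg fun v hv =>
        mul_nonneg (hc v) (by exact_mod_cast hm0 v hv)] at h0
      refine sum_mem fun v hv => ?_
      by_cases hvt : e v ∈ τ
      · exact τ.smul_mem (hc v) hvt
      · have h1 : c v = 0 := by
          rcases mul_eq_zero.1 (h0 v hv) with h1 | h1
          · exact h1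
          · exact absurd (hmB v hv hvt) (by simp [show m v = 0 by exact_mod_cast h1])
        change c v • e v ∈ τ
        rw [h1, zero_smul]; exact zero_mem _

/-- If `τ = σ ∩ m^⊥` is a face of `σ`, then `τ^∨ ∩ M = (σ^∨ ∩ M) + ℕ (-m)`. -/
theorem Exposes.localization {m : Module.Dual ℤ N} {τ σ : PointedCone ℝ (ℝ ⊗[ℤ] N)}
    (hσ : ∃ S : Finset N, σ = latticeCone (S : Set N)) (hle : τ ≤ σ)
    (h : Exposes m τ σ) : -m ∈ dualMonoid τ ∧
      ∀ m' ∈ dualMonoid τ, ∃ n : ℕ, m' + n • m ∈ dualMonoid σ := by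
  obtain ⟨S, rfl⟩ := hσ
  have heS : ∀ v ∈ S, (1 : ℝ) ⊗ₜ[ℤ] v ∈ latticeCone (S : Set N) := fun v hv =>
    Submodule.subset_span ⟨v, hv, rfl⟩
  constructor
  · intro x hx
    have h0 := (h.2 x (hle hx)).1 hx
    have h1 : pairing (-m) x = - pairing m x := by
      have := LinearMap.congr_fun (pairing_add (-m) m) x
      rw [neg_add_cancel, pairing_zero] at this
      simp at this
      linarith
    rw [h1, h0, neg_zero]
  · intro m' hm'
    refine ⟨∑ v ∈ S, (m' v).natAbs, fun x hx => ?_⟩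
    obtain ⟨c, hc, rfl⟩ := mem_latticeCone_iff.1 hx
    rw [map_sum]
    refine Finset.sum_nonneg fun v hv => ?_
    rw [map_smul, smul_eq_mul, pairing_tmul, mul_one]
    refine mul_nonneg (hc v) ?_
    have hmv : 0 ≤ m v := by
      have := h.1 _ (heS v hv)
      rw [pairing_tmul, mul_one] at this
      exact_mod_cast this
    have hle' : (m' v).natAbs ≤ ∑ v ∈ S, (m' v).natAbs :=
      Finset.single_le_sum (f := fun v => (m' v).natAbs) (fun _ _ => Nat.zero_le _) hv
    have : 0 ≤ (m' + (∑ v ∈ S, (m' v).natAbs) • m) v := by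
      rw [LinearMap.add_apply, LinearMap.smul_apply, nsmul_eq_mul]
      rcases hmv.eq_or_lt with h0 | h0
      · have hvt : (1 : ℝ) ⊗ₜ[ℤ] v ∈ τ := by
          rw [h.2 _ (heS v hv), pairing_tmul, ← h0]; simp
        have := hm' _ hvt
        rw [pairing_tmul, mul_one] at this
        rw [← h0]
        simpa using this
      · have h1 : ((m' v).natAbs : ℤ) ≤ ((∑ v ∈ S, (m' v).natAbs : ℕ) : ℤ) := by
          exact_mod_cast hle'
        have h2 : -(m' v) ≤ ((m' v).natAbs : ℤ) := by omega
        nlinarith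
    exact_mod_cast this

end Cones

section Fans

variable {N : Type u} [AddCommGroup N]

variable (N) in
/-- A fan in the lattice `N`: a set of strongly convex rational polyhedral cones that contains the
faces of its members, and such that any two members meet in a common face. -/
structure Fan where
  cones : Set (PointedCone ℝ (ℝ ⊗[ℤ] N))
  isStronglyConvexRational : ∀ σ ∈ cones, IsStronglyConvexRational σ
  face_mem : ∀ σ ∈ cones, ∀ τ : PointedCone ℝ (ℝ ⊗[ℤ] N), τ.IsFaceOf σ → τ ∈ cones
  inter_isFaceOf : ∀ σ ∈ cones, ∀ σ' ∈ cones, (σ ⊓ σ').IsFaceOf σ ∧ (σ ⊓ σ').IsFaceOf σ'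

/-- The cones of a fan, ordered by inclusion. -/
abbrev Fan.Cone (Δ : Fan N) : Type u := {σ : PointedCone ℝ (ℝ ⊗[ℤ] N) // σ ∈ Δ.cones}

theorem Fan.isFaceOf_of_le (Δ : Fan N) {τ σ : Δ.Cone} (h : τ ≤ σ) : τ.1.IsFaceOf σ.1 := by
  have := (Δ.inter_isFaceOf τ.1 τ.2 σ.1 σ.2).2
  rwa [inf_eq_left.2 (show τ.1 ≤ σ.1 from h)] at this

variable (k : Type u) [Field k]

/-- The semigroup algebra `k[σ^∨ ∩ M]`. -/
abbrev coordRing (σ : PointedCone ℝ (ℝ ⊗[ℤ] N)) : Type u := AddMonoidAlgebra k (dualMonoid σ)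

/-- The inclusion `k[σ^∨ ∩ M] → k[τ^∨ ∩ M]` for `τ ⊆ σ`. -/
noncomputable def coordRingMap {τ σ : PointedCone ℝ (ℝ ⊗[ℤ] N)} (h : τ ≤ σ) :
    coordRing k σ →+* coordRing k τ :=
  AddMonoidAlgebra.mapDomainRingHom k (AddSubmonoid.inclusion (dualMonoid_anti h))

theorem coordRingMap_single {τ σ : PointedCone ℝ (ℝ ⊗[ℤ] N)} (h : τ ≤ σ) (m : dualMonoid σ)
    (c : k) : coordRingMap k h (.single m c) =
      .single (AddSubmonoid.inclusion (dualMonoid_anti h) m) c := by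
  simp [coordRingMap]

theorem coordRingMap_refl (σ : PointedCone ℝ (ℝ ⊗[ℤ] N)) (h : σ ≤ σ) :
    coordRingMap k h = RingHom.id _ :=
  AddMonoidAlgebra.mapDomainRingHom_id

theorem coordRingMap_comp {ρ τ σ : PointedCone ℝ (ℝ ⊗[ℤ] N)} (h : ρ ≤ τ) (h' : τ ≤ σ) :
    (coordRingMap k h).comp (coordRingMap k h') = coordRingMap k (h.trans h') :=
  (AddMonoidAlgebra.mapDomainRingHom_comp _ _).symm

theorem coordRingMap_comp_algebraMap {τ σ : PointedCone ℝ (ℝ ⊗[ℤ] N)} (h : τ ≤ σ) :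
    (coordRingMap k h).comp (algebraMap k (coordRing k σ)) = algebraMap k (coordRing k τ) :=
  AddMonoidAlgebra.mapDomainRingHom_comp_algebraMap _

theorem coordRingMap_injective {τ σ : PointedCone ℝ (ℝ ⊗[ℤ] N)} (h : τ ≤ σ) :
    Function.Injective (coordRingMap k h) :=
  AddMonoidAlgebra.mapDomain_injective (AddSubmonoid.inclusion_injective _)

/-- For a face `τ = σ ∩ m^⊥`, `k[τ^∨ ∩ M]` is the localization of `k[σ^∨ ∩ M]` at `χ^m`. -/
theorem isLocalization_coordRing {τ σ : PointedCone ℝ (ℝ ⊗[ℤ] N)}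
    (hσ : ∃ S : Finset N, σ = latticeCone (S : Set N)) (hle : τ ≤ σ)
    {m : Module.Dual ℤ N} (h : Exposes m τ σ) :
    letI := (coordRingMap k hle).toAlgebra
    IsLocalization.Away (AddMonoidAlgebra.single ⟨m, h.1⟩ 1 : coordRing k σ) (coordRing k τ) := by
  let := (coordRingMap k hle).toAlgebra
  have halg : ∀ x, algebraMap (coordRing k σ) (coordRing k τ) x = coordRingMap k hle x :=
    fun _ => rfl
  obtain ⟨hneg, hsurj⟩ := h.localization hσ hle
  refine IsLocalization.Away.mk _ ?_ ?_ ?_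
  · rw [halg, coordRingMap_single]
    refine IsUnit.of_mul_eq_one (.single ⟨-m, hneg⟩ 1) ?_
    rw [AddMonoidAlgebra.single_mul_single, AddMonoidAlgebra.one_def]
    congr 1
    · ext1; simp
    · simp
  · intro s
    induction s using AddMonoidAlgebra.induction_linear with
    | zero => exact ⟨0, 0, by simp⟩
    | add x y hx hy =>
      obtain ⟨n, a, ha⟩ := hx
      obtain ⟨n', b, hb⟩ := hy
      refine ⟨n + n', a * (.single ⟨m, h.1⟩ 1) ^ n' + b * (.single ⟨m, h.1⟩ 1) ^ n, ?_⟩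
      rw [map_add, map_mul, map_mul, ← ha, ← hb, map_pow, map_pow]
      ring
    | single m' c =>
      obtain ⟨n, hn⟩ := hsurj m'.1 m'.2
      refine ⟨n, .single ⟨m'.1 + n • m, hn⟩ c, ?_⟩
      rw [halg, halg, coordRingMap_single, coordRingMap_single, AddMonoidAlgebra.single_pow,
        AddMonoidAlgebra.single_mul_single]
      congr 1
      simp
  · intro a b hab
    exact ⟨0, by rw [coordRingMap_injective k hle hab]⟩

/-- The affine toric variety `U_σ = Spec k[σ^∨ ∩ M]`. -/
noncomputable abbrev affineToric (σ : PointedCone ℝ (ℝ ⊗[ℤ] N)) : Scheme.{u} :=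
  Spec (.of (coordRing k σ))

/-- The map `U_τ → U_σ` for `τ ⊆ σ`. -/
noncomputable def affineToricMap {τ σ : PointedCone ℝ (ℝ ⊗[ℤ] N)} (h : τ ≤ σ) :
    affineToric k τ ⟶ affineToric k σ :=
  Spec.map (CommRingCat.ofHom (coordRingMap k h))

theorem isOpenImmersion_affineToricMap {τ σ : PointedCone ℝ (ℝ ⊗[ℤ] N)}
    (hσ : ∃ S : Finset N, σ = latticeCone (S : Set N)) (hle : τ ≤ σ)
    {m : Module.Dual ℤ N} (h : Exposes m τ σ) : IsOpenImmersion (affineToricMap k hle) := by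
  let := (coordRingMap k hle).toAlgebra
  have := isLocalization_coordRing k hσ hle h
  exact IsOpenImmersion.of_isLocalization (S := coordRing k τ)
    (AddMonoidAlgebra.single ⟨m, h.1⟩ 1 : coordRing k σ)

theorem range_affineToricMap {τ σ : PointedCone ℝ (ℝ ⊗[ℤ] N)}
    (hσ : ∃ S : Finset N, σ = latticeCone (S : Set N)) (hle : τ ≤ σ)
    {m : Module.Dual ℤ N} (h : Exposes m τ σ) :
    Set.range (affineToricMap k hle) =
      {x | x ∈ PrimeSpectrum.basicOpen (AddMonoidAlgebra.single ⟨m, h.1⟩ 1 : coordRing k σ)} := by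
  let := (coordRingMap k hle).toAlgebra
  have := isLocalization_coordRing k hσ hle h
  exact PrimeSpectrum.localization_away_comap_range (coordRing k τ)
    (AddMonoidAlgebra.single ⟨m, h.1⟩ 1 : coordRing k σ)

namespace Fan

variable (Δ : Fan N)

/-- The diagram of the affine toric varieties `U_σ`, `σ ∈ Δ`. -/
noncomputable def chartFunctor : Δ.Cone ⥤ Scheme.{u} where
  obj σ := affineToric k σ.1
  map f := affineToricMap k f.le
  map_id σ := by
    rw [affineToricMap, coordRingMap_refl]
    exact Spec.map_id _
  map_comp f g := by
    rw [affineToricMap, affineToricMap, affineToricMap, ← Spec.map_comp, ← CommRingCat.ofHom_comp,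
      coordRingMap_comp]

variable [Module.Free ℤ N] [Module.Finite ℤ N]

instance {σ τ : Δ.Cone} (f : σ ⟶ τ) : IsOpenImmersion ((Δ.chartFunctor k).map f) := by
  obtain ⟨m, hm⟩ := exists_exposes (Δ.isStronglyConvexRational _ τ.2).rational
    (Δ.isFaceOf_of_le f.le)
  exact isOpenImmersion_affineToricMap k (Δ.isStronglyConvexRational _ τ.2).rational f.le hm

instance : (Δ.chartFunctor k ⋙ Scheme.forget).IsLocallyDirected where
  cond := by
    intro σ τ ρ f g x y hxy
    have hρ := (Δ.isStronglyConvexRational _ ρ.2).rational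
    obtain ⟨m, hm⟩ := exists_exposes hρ (Δ.isFaceOf_of_le f.le)
    obtain ⟨m', hm'⟩ := exists_exposes hρ (Δ.isFaceOf_of_le g.le)
    let lam : Δ.Cone := ⟨σ.1 ⊓ τ.1, Δ.face_mem _ σ.2 _ (Δ.inter_isFaceOf _ σ.2 _ τ.2).1⟩
    let a : lam ⟶ σ := homOfLE (show lam.1 ≤ σ.1 from inf_le_left)
    let b : lam ⟶ τ := homOfLE (show lam.1 ≤ τ.1 from inf_le_right)
    have hl : Exposes (m + m') lam.1 ρ.1 := hm.inf hm'
    change (Δ.chartFunctor k).map f x = (Δ.chartFunctor k).map g y at hxy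
    have h1 : (Δ.chartFunctor k).map f x ∈ Set.range (affineToricMap k (a ≫ f).le) := by
      rw [range_affineToricMap k hρ _ hl]
      have hx : (Δ.chartFunctor k).map f x ∈ Set.range (affineToricMap k f.le) := ⟨x, rfl⟩
      have hy : (Δ.chartFunctor k).map f x ∈ Set.range (affineToricMap k g.le) :=
        ⟨y, hxy.symm⟩
      rw [range_affineToricMap k hρ _ hm] at hx
      rw [range_affineToricMap k hρ _ hm'] at hy
      have e : (AddMonoidAlgebra.single ⟨m + m', hl.1⟩ 1 : coordRing k ρ.1) =
          .single ⟨m, hm.1⟩ 1 * .single ⟨m', hm'.1⟩ 1 := by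
        rw [AddMonoidAlgebra.single_mul_single, mul_one]; rfl
      rw [e, PrimeSpectrum.basicOpen_mul]
      exact ⟨hx, hy⟩
    obtain ⟨z, hz⟩ := h1
    refine ⟨lam, a, b, z, ?_, ?_⟩
    · apply ((Δ.chartFunctor k).map f).isOpenEmbedding.injective
      refine Eq.trans ?_ hz
      exact (congr($((Δ.chartFunctor k).map_comp a f) z)).symm
    · apply ((Δ.chartFunctor k).map g).isOpenEmbedding.injective
      refine Eq.trans ?_ (hz.trans hxy)
      exact (congr($((Δ.chartFunctor k).map_comp b g) z)).symm

/-- The toric variety `X(Δ)`: the schemes `U_σ`, `σ ∈ Δ`, glued along the open subschemes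
`U_{σ ∩ σ'}` of `U_σ` and `U_σ'`. The diagram consists of open immersions and is locally directed
(the two instances above), so that its colimit is this gluing, with the open cover
`Scheme.IsLocallyDirected.openCover`. -/
noncomputable def toricVariety : Scheme.{u} := colimit (Δ.chartFunctor k)

/-- The open chart `U_σ → X(Δ)`. -/
noncomputable def chart (σ : Δ.Cone) : affineToric k σ.1 ⟶ Δ.toricVariety k :=
  colimit.ι (Δ.chartFunctor k) σ

/-- The structure morphism `X(Δ) → Spec k`. -/
noncomputable def structureMap : Δ.toricVariety k ⟶ Spec (.of k) :=
  colimit.desc (Δ.chartFunctor k)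
    { pt := Spec (.of k)
      ι :=
        { app := fun σ => Spec.map (CommRingCat.ofHom (algebraMap k (coordRing k σ.1)))
          naturality := by
            intro σ τ f
            change Spec.map _ ≫ _ = _ ≫ 𝟙 _
            rw [← Spec.map_comp, Category.comp_id, ← CommRingCat.ofHom_comp,
              coordRingMap_comp_algebraMap] } }

end Fan

variable (N) in
/-- The `k`-points `N ⊗ kˣ` of the dense torus `T`. -/
abbrev Torus : Type u := N ⊗[ℤ] Additive kˣ

variable {k}

/-- The values `χ^m(t)`, for `m ∈ M`, at a point `t` of the torus. -/
noncomputable def character (t : Torus N k) : Multiplicative (Module.Dual ℤ N) →* kˣ where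
  toFun m := (TensorProduct.lid ℤ (Additive kˣ) (m.toAdd.rTensor (Additive kˣ) t)).toMul
  map_one' := by simp
  map_mul' m m' := by simp [LinearMap.rTensor_add]

theorem character_tmul (v : N) (c : kˣ) (m : Module.Dual ℤ N) :
    character (v ⊗ₜ[ℤ] Additive.ofMul c) (.ofAdd m) = c ^ (m v) := by
  simp [character]

/-- The automorphism `χ^m ↦ χ^m(t) χ^m` of `k[σ^∨ ∩ M]`. -/
noncomputable def torusCoordHom (t : Torus N k) (σ : PointedCone ℝ (ℝ ⊗[ℤ] N)) :
    coordRing k σ →+* coordRing k σ :=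
  (AddMonoidAlgebra.lift k (coordRing k σ) (dualMonoid σ)
    { toFun := fun m => .single m.toAdd (character t (.ofAdd m.toAdd.1) : k)
      map_one' := by
        change AddMonoidAlgebra.single 0 (character t 1 : k) = 1
        simp [AddMonoidAlgebra.one_def]
      map_mul' := fun m m' => by
        rw [AddMonoidAlgebra.single_mul_single, ← Units.val_mul, ← map_mul]; rfl }).toRingHom

theorem torusCoordHom_single (t : Torus N k) (σ : PointedCone ℝ (ℝ ⊗[ℤ] N)) (m : dualMonoid σ)
    (c : k) : torusCoordHom t σ (.single m c) = .single m (c * character t (.ofAdd m.1)) := by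
  simp [torusCoordHom]

namespace Fan

variable (Δ : Fan N) [Module.Free ℤ N] [Module.Finite ℤ N]

/-- The action of a point `t` of the torus on `X(Δ)`, given on each `U_σ` by `χ^m ↦ χ^m(t) χ^m`. -/
noncomputable def torusAction (t : Torus N k) : Δ.toricVariety k ⟶ Δ.toricVariety k :=
  colimMap
    { app := fun σ => Spec.map (CommRingCat.ofHom (torusCoordHom t σ.1))
      naturality := by
        intro σ τ f
        change Spec.map _ ≫ Spec.map _ = Spec.map _ ≫ Spec.map _
        rw [← Spec.map_comp, ← Spec.map_comp, ← CommRingCat.ofHom_comp, ← CommRingCat.ofHom_comp]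
        congr 2
        refine AddMonoidAlgebra.ringHom_ext (fun c => ?_) (fun m => ?_) <;>
        simp [coordRingMap_single, torusCoordHom_single] }

end Fan

end Fans

section Sheaves

open TopologicalSpace Opposite

/-- Restriction of sections. -/
noncomputable def rs {Y : Scheme.{u}} {U V : Y.Opens} (h : V ≤ U) : Γ(Y, U) →+* Γ(Y, V) :=
  (Y.presheaf.map (homOfLE h).op).hom

section

variable {Y : Scheme.{u}}

theorem rs_refl {U : Y.Opens} (h : U ≤ U) (x : Γ(Y, U)) : rs h x = x := by
  change (Y.presheaf.map (𝟙 (op U))) x = x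
  rw [Y.presheaf.map_id]; rfl

theorem rs_rs {U V W : Y.Opens} (h : V ≤ U) (h' : W ≤ V) (x : Γ(Y, U)) :
    rs h' (rs h x) = rs (h'.trans h) x := by
  change (Y.presheaf.map (homOfLE h).op ≫ Y.presheaf.map (homOfLE h').op) x = _
  rw [← Y.presheaf.map_comp]; rfl

theorem app_rs {X : Scheme.{u}} (f : Y ⟶ X) {U V : X.Opens} (h : V ≤ U) (x : Γ(X, U)) :
    f.app V (rs h x) = rs (f.preimage_mono h) (f.app U x) :=
  congr($(f.naturality (homOfLE h).op) x)

theorem eq_of_local {V W : Y.Opens} {a b : Γ(Y, V ⊓ W)}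
    (H : ∀ y ∈ V, ∃ (V' : Y.Opens) (h : V' ≤ V), y ∈ V' ∧
      rs (inf_le_inf_right W h) a = rs (inf_le_inf_right W h) b) : a = b := by
  choose! V' h hy hab using H
  refine Y.sheaf.eq_of_locally_eq' (fun y : V => V' y.1 ⊓ W) (V ⊓ W)
    (fun y => homOfLE (inf_le_inf_right W (h y.1 y.2))) ?_ a b fun y => hab y.1 y.2
  intro y hyV
  exact Opens.mem_iSup.2 ⟨⟨y, hyV.1⟩, hy y hyV.1, hyV.2⟩

variable {A : Type u} (W : A → Y.Opens)

/-- Families of sections of `𝒪_Y`, indexed by `a : A`, over the open sets `V ∩ W a`. As `V` varies,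
this is a sheaf of `𝒪_Y`-modules (a product of sheaves of the form `j_* (𝒪_Y|_{W a})`), which serves
as the ambient sheaf for the sheaves of derivations and of homomorphisms below. -/
def Fam (V : Y.Opens) : Type u := ∀ a : A, Γ(Y, V ⊓ W a)

noncomputable instance (V : Y.Opens) : AddCommGroup (Fam W V) :=
  inferInstanceAs (AddCommGroup (∀ a : A, Γ(Y, V ⊓ W a)))

noncomputable instance (V : Y.Opens) : Module Γ(Y, V) (Fam W V) where
  smul r s := fun a => rs inf_le_left r * s a
  one_smul s := funext fun a => by
    change rs _ 1 * s a = s a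
    rw [map_one, one_mul]
  mul_smul r r' s := funext fun a => by
    change rs _ (r * r') * s a = rs _ r * (rs _ r' * s a)
    rw [map_mul, mul_assoc]
  smul_zero r := funext fun a => mul_zero _
  smul_add r s t := funext fun a => mul_add _ _ _
  add_smul r r' s := funext fun a => by
    change rs _ (r + r') * s a = rs _ r * s a + rs _ r' * s a
    rw [map_add, add_mul]
  zero_smul s := funext fun a => by
    change rs _ 0 * s a = 0
    rw [map_zero, zero_mul]

variable {W}

theorem Fam.smul_apply {V : Y.Opens} (r : Γ(Y, V)) (s : Fam W V) (a : A) :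
    (r • s) a = rs inf_le_left r * s a := rfl

theorem Fam.add_apply {V : Y.Opens} (s t : Fam W V) (a : A) : (s + t) a = s a + t a := rfl

theorem Fam.zero_apply {V : Y.Opens} (a : A) : (0 : Fam W V) a = 0 := rfl

/-- Restriction of a family to a smaller open set. -/
noncomputable def Fam.res {V V' : Y.Opens} (h : V' ≤ V) : Fam W V →+ Fam W V' where
  toFun s := fun a => rs (inf_le_inf_right (W a) h) (s a)
  map_zero' := funext fun _ => map_zero _
  map_add' _ _ := funext fun _ => map_add _ _ _

theorem Fam.res_apply {V V' : Y.Opens} (h : V' ≤ V) (s : Fam W V) (a : A) :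
    Fam.res h s a = rs (inf_le_inf_right (W a) h) (s a) := rfl

theorem Fam.res_smul {V V' : Y.Opens} (h : V' ≤ V) (r : Γ(Y, V)) (s : Fam W V) :
    Fam.res h (r • s) = rs h r • Fam.res h s := funext fun a => by
  rw [Fam.res_apply, Fam.smul_apply, Fam.smul_apply, Fam.res_apply, map_mul, rs_rs, rs_rs]

theorem Fam.res_refl {V : Y.Opens} (h : V ≤ V) (s : Fam W V) : Fam.res h s = s :=
  funext fun _ => rs_refl _ _

theorem Fam.res_res {V V' V'' : Y.Opens} (h : V' ≤ V) (h' : V'' ≤ V') (s : Fam W V) :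
    Fam.res h' (Fam.res h s) = Fam.res (h'.trans h) s := funext fun _ => rs_rs _ _ _

variable (W) in
/-- A subsheaf of modules of the sheaf of families. -/
structure LocalSubmodule where
  sections : ∀ V : Y.Opens, Submodule Γ(Y, V) (Fam W V)
  res_mem : ∀ {V V' : Y.Opens} (h : V' ≤ V) (s : Fam W V), s ∈ sections V →
    Fam.res h s ∈ sections V'
  mem_of_local : ∀ {V : Y.Opens} (s : Fam W V), (∀ y ∈ V, ∃ (V' : Y.Opens) (h : V' ≤ V), y ∈ V' ∧
    Fam.res h s ∈ sections V') → s ∈ sections V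

namespace LocalSubmodule

variable (Q : LocalSubmodule W)

/-- The underlying presheaf of abelian groups of a subsheaf of the sheaf of families. -/
noncomputable def presheafAb : (Opens Y)ᵒᵖ ⥤ Ab.{u} where
  obj V := AddCommGrpCat.of (Q.sections V.unop)
  map i := AddCommGrpCat.ofHom
    { toFun := fun s => ⟨Fam.res i.unop.le s.1, Q.res_mem _ _ s.2⟩
      map_zero' := Subtype.ext (map_zero _)
      map_add' := fun _ _ => Subtype.ext (map_add _ _ _) }
  map_id _ := AddCommGrpCat.hom_ext (AddMonoidHom.ext fun s => Subtype.ext (Fam.res_refl _ s.1))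
  map_comp _ _ := AddCommGrpCat.hom_ext (AddMonoidHom.ext fun s =>
    Subtype.ext (Fam.res_res _ _ s.1).symm)

noncomputable instance (V : (Opens Y)ᵒᵖ) : Module (Y.ringCatSheaf.obj.obj V) (Q.presheafAb.obj V) :=
  inferInstanceAs (Module Γ(Y, V.unop) (Q.sections V.unop))

/-- The underlying presheaf of modules of a subsheaf of the sheaf of families. -/
noncomputable def presheafOfModules : PresheafOfModules.{u} Y.ringCatSheaf.obj :=
  PresheafOfModules.ofPresheaf Q.presheafAb
    (fun _ _ i r s => Subtype.ext (Fam.res_smul i.unop.le r s.1))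

theorem isSheaf_presheafAb : TopCat.Presheaf.IsSheaf (X := Y.toTopCat) Q.presheafAb := by
  rw [TopCat.Presheaf.isSheaf_iff_isSheafUniqueGluing]
  intro ι U sf hsf
  have hsf' : ∀ (i j : ι) (a : A),
      rs (inf_le_inf_right (W a) (inf_le_left : U i ⊓ U j ≤ U i)) ((sf i).1 a) =
      rs (inf_le_inf_right (W a) (inf_le_right : U i ⊓ U j ≤ U j)) ((sf j).1 a) := by
    intro i j a
    exact congr_fun (congrArg Subtype.val (hsf i j)) a
  have key : ∀ a : A, ∃! t : Γ(Y, iSup U ⊓ W a), ∀ i,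
      rs (inf_le_inf_right (W a) (le_iSup U i)) t = (sf i).1 a := by
    intro a
    refine Y.sheaf.existsUnique_gluing' (fun i => U i ⊓ W a) (iSup U ⊓ W a)
      (fun i => homOfLE (inf_le_inf_right (W a) (le_iSup U i))) ?_ (fun i => (sf i).1 a) ?_
    · intro y hy
      obtain ⟨i, hi⟩ := Opens.mem_iSup.1 hy.1
      exact Opens.mem_iSup.2 ⟨i, hi, hy.2⟩
    · intro i j
      have h3 : (U i ⊓ W a) ⊓ (U j ⊓ W a) ≤ (U i ⊓ U j) ⊓ W a :=
        le_inf (inf_le_inf inf_le_left inf_le_left) (inf_le_left.trans inf_le_right)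
      have := congrArg (rs h3) (hsf' i j a)
      rw [rs_rs, rs_rs] at this
      exact this
  choose t ht htu using key
  refine ⟨⟨t, Q.mem_of_local t fun y hy => ?_⟩, ?_, ?_⟩
  · obtain ⟨i, hi⟩ := Opens.mem_iSup.1 hy
    refine ⟨U i, le_iSup U i, hi, ?_⟩
    have : Fam.res (le_iSup U i) t = (sf i).1 := funext fun a => ht a i
    rw [this]
    exact (sf i).2
  · intro i
    exact Subtype.ext (funext fun a => ht a i)
  · intro s hs
    refine Subtype.ext (funext fun a => htu a _ fun i => ?_)
    exact congr_fun (congrArg Subtype.val (hs i)) a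

/-- A subsheaf of the sheaf of families, as a sheaf of `𝒪_Y`-modules. -/
noncomputable def toModules : Y.Modules where
  val := Q.presheafOfModules
  isSheaf := Q.isSheaf_presheafAb

end LocalSubmodule

/-- A morphism of sheaves of modules from compatible linear maps on sections. -/
noncomputable def modulesHomMk {M M' : Y.Modules}
    (φ : ∀ V : Y.Opens, M.presheaf.obj (op V) →+ M'.presheaf.obj (op V))
    (hres : ∀ {V V' : Y.Opens} (i : V' ⟶ V) (s : M.presheaf.obj (op V)),
      φ V' (M.presheaf.map i.op s) = M'.presheaf.map i.op (φ V s))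
    (hsmul : ∀ (V : Y.Opens) (r : Γ(Y, V)) (s : M.presheaf.obj (op V)),
      φ V (r • s) = r • φ V s) : M ⟶ M' :=
  SheafOfModules.Hom.mk (PresheafOfModules.homMk
    { app := fun V => AddCommGrpCat.ofHom (φ V.unop)
      naturality := fun _ _ i => AddCommGrpCat.hom_ext (AddMonoidHom.ext fun s => hres i.unop s) }
    (fun V r s => hsmul V.unop r s))

end

section Derivations

variable {S X Y : Scheme.{u}} (f : Y ⟶ X) (p : X ⟶ S)

/-- The restriction to `V ∩ f⁻¹(U)` of the pullback `f^♯ x` of a function `x` on `U`. -/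
noncomputable def pullSection (V : Y.Opens) {U : X.Opens} (x : Γ(X, U)) : Γ(Y, V ⊓ f ⁻¹ᵁ U) :=
  rs inf_le_right (f.app U x)

theorem rs_pullSection {V V' : Y.Opens} (h : V' ≤ V) {U : X.Opens} (x : Γ(X, U)) :
    rs (inf_le_inf_right (f ⁻¹ᵁ U) h) (pullSection f V x) = pullSection f V' x :=
  rs_rs _ _ _

theorem app_pullSection_id (V : X.Opens) {U : X.Opens} (x : Γ(X, U)) :
    f.app (V ⊓ (𝟙 X) ⁻¹ᵁ U) (pullSection (𝟙 X) V x) = pullSection f (f ⁻¹ᵁ V) x :=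
  app_rs f _ _

/-- For `V ⊆ Y` open, a family of maps `D_U : 𝒪_X(U) → 𝒪_Y(V ∩ f⁻¹(U))`, `U ⊆ X` open, is an
`𝒪_S`-derivation from `𝒪_X` to `f_*(𝒪_Y|_V)` (equivalently, from `f⁻¹𝒪_X|_V` to `𝒪_V`): it is
compatible with restriction, additive, satisfies the Leibniz rule and vanishes on functions that come
from `S`. -/
structure IsDerivationAlong (V : Y.Opens) (D : ∀ U : X.Opens, Γ(X, U) → Γ(Y, V ⊓ f ⁻¹ᵁ U)) :
    Prop where
  map_res : ∀ (U U' : X.Opens) (h : U' ≤ U) (x : Γ(X, U)),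
    D U' (rs h x) = rs (inf_le_inf_left V (f.preimage_mono h)) (D U x)
  map_add : ∀ (U : X.Opens) (x y : Γ(X, U)), D U (x + y) = D U x + D U y
  leibniz : ∀ (U : X.Opens) (x y : Γ(X, U)),
    D U (x * y) = pullSection f V x * D U y + pullSection f V y * D U x
  map_const : ∀ (O : S.Opens) (c : Γ(S, O)), D (p ⁻¹ᵁ O) (p.app O c) = 0

namespace IsDerivationAlong

variable {f p}

theorem zero (V : Y.Opens) : IsDerivationAlong f p V fun _ _ => 0 where
  map_res _ _ _ _ := (map_zero _).symm
  map_add _ _ _ := (add_zero _).symm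
  leibniz _ _ _ := by rw [mul_zero, mul_zero, add_zero]
  map_const _ _ := rfl

variable {V : Y.Opens} {D D' : ∀ U : X.Opens, Γ(X, U) → Γ(Y, V ⊓ f ⁻¹ᵁ U)}

theorem add (hD : IsDerivationAlong f p V D) (hD' : IsDerivationAlong f p V D') :
    IsDerivationAlong f p V fun U x => D U x + D' U x where
  map_res U U' h x := by rw [_root_.map_add, hD.map_res U U' h x, hD'.map_res U U' h x]
  map_add U x y := by rw [hD.map_add U x y, hD'.map_add U x y]; abel
  leibniz U x y := by rw [hD.leibniz U x y, hD'.leibniz U x y]; ring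
  map_const O c := by rw [hD.map_const O c, hD'.map_const O c, add_zero]

theorem smul (r : Γ(Y, V)) (hD : IsDerivationAlong f p V D) :
    IsDerivationAlong f p V fun U x => rs inf_le_left r * D U x where
  map_res U U' h x := by rw [map_mul, hD.map_res U U' h x, rs_rs]
  map_add U x y := by rw [hD.map_add U x y, mul_add]
  leibniz U x y := by rw [hD.leibniz U x y]; ring
  map_const O c := by rw [hD.map_const O c, mul_zero]

theorem res {V' : Y.Opens} (h : V' ≤ V) (hD : IsDerivationAlong f p V D) :
    IsDerivationAlong f p V' fun U x => rs (inf_le_inf_right (f ⁻¹ᵁ U) h) (D U x) where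
  map_res U U' hU x := by rw [hD.map_res U U' hU x, rs_rs, rs_rs]
  map_add U x y := by rw [hD.map_add U x y, _root_.map_add]
  leibniz U x y := by
    rw [hD.leibniz U x y, _root_.map_add, map_mul, map_mul, rs_pullSection f h, rs_pullSection f h]
  map_const O c := by rw [hD.map_const O c, map_zero]

theorem of_local (H : ∀ y ∈ V, ∃ (V' : Y.Opens) (h : V' ≤ V), y ∈ V' ∧
    IsDerivationAlong f p V' fun U x => rs (inf_le_inf_right (f ⁻¹ᵁ U) h) (D U x)) :
    IsDerivationAlong f p V D where
  map_res U U' hU x := eq_of_local fun y hy => by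
    obtain ⟨V', h, hyV', hD⟩ := H y hy
    refine ⟨V', h, hyV', ?_⟩
    rw [hD.map_res U U' hU x, rs_rs, rs_rs]
  map_add U x y := eq_of_local fun z hz => by
    obtain ⟨V', h, hzV', hD⟩ := H z hz
    refine ⟨V', h, hzV', ?_⟩
    rw [hD.map_add U x y, _root_.map_add]
  leibniz U x y := eq_of_local fun z hz => by
    obtain ⟨V', h, hzV', hD⟩ := H z hz
    refine ⟨V', h, hzV', ?_⟩
    rw [hD.leibniz U x y, _root_.map_add, map_mul, map_mul, rs_pullSection f h, rs_pullSection f h]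
  map_const O c := eq_of_local fun z hz => by
    obtain ⟨V', h, hzV', hD⟩ := H z hz
    refine ⟨V', h, hzV', ?_⟩
    rw [hD.map_const O c, map_zero]

variable (f) in
theorem precomp {D : ∀ U : Y.Opens, Γ(Y, U) → Γ(Y, V ⊓ (𝟙 Y) ⁻¹ᵁ U)}
    (hD : IsDerivationAlong (𝟙 Y) (f ≫ p) V D) :
    IsDerivationAlong f p V fun U x => D (f ⁻¹ᵁ U) (f.app U x) where
  map_res U U' h x := by
    rw [app_rs]
    exact hD.map_res _ _ (f.preimage_mono h) _
  map_add U x y := by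
    rw [_root_.map_add]
    exact hD.map_add _ _ _
  leibniz U x y := by
    rw [map_mul]
    exact hD.leibniz _ _ _
  map_const O c := hD.map_const O c

variable (f) in
theorem postcomp {V : X.Opens} {D : ∀ U : X.Opens, Γ(X, U) → Γ(X, V ⊓ (𝟙 X) ⁻¹ᵁ U)}
    (hD : IsDerivationAlong (𝟙 X) p V D) :
    IsDerivationAlong f p (f ⁻¹ᵁ V) fun U x => f.app (V ⊓ (𝟙 X) ⁻¹ᵁ U) (D U x) where
  map_res U U' h x := by
    rw [hD.map_res U U' h x, app_rs]; rfl
  map_add U x y := by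
    rw [hD.map_add U x y, _root_.map_add]; rfl
  leibniz U x y := by
    rw [hD.leibniz U x y, _root_.map_add, map_mul, map_mul, app_pullSection_id,
      app_pullSection_id]
    rfl
  map_const O c := by
    rw [hD.map_const O c, map_zero]; rfl

end IsDerivationAlong

/-- The derivations along `f` over the open subsets of `Y`. -/
noncomputable def derivations :
    LocalSubmodule (fun a : (U : X.Opens) × Γ(X, U) => f ⁻¹ᵁ a.1) where
  sections V :=
    { carrier := {s | IsDerivationAlong f p V fun U x => s ⟨U, x⟩}
      zero_mem' := IsDerivationAlong.zero V
      add_mem' := IsDerivationAlong.add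
      smul_mem' := fun r _ hs => IsDerivationAlong.smul r hs }
  res_mem h _ hs := IsDerivationAlong.res h hs
  mem_of_local _ H := IsDerivationAlong.of_local H

/-- The sheaf `𝒟er_S(f⁻¹𝒪_X, 𝒪_Y) = ℋom(f^*Ω_{X/S}, 𝒪_Y)` on `Y`. -/
noncomputable def derivationSheaf : Y.Modules := (derivations f p).toModules

/-- The tangent sheaf `T_X = 𝒟er_S(𝒪_X, 𝒪_X) = ℋom(Ω_{X/S}, 𝒪_X)`. A section over `V` is a
compatible family of derivations `𝒪_X(U) → 𝒪_X(V ∩ U)`, that is, a derivation of the sheaf `𝒪_V`. -/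
noncomputable def tangentSheaf : X.Modules := derivationSheaf (𝟙 X) p

/-- The sections over `U` of the ideal sheaf `ℐ = ker(𝒪_X → f_*𝒪_Y)`. -/
def idealSections (U : X.Opens) : Ideal Γ(X, U) := RingHom.ker (f.app U).hom

variable {f} in
theorem mem_idealSections {U : X.Opens} {x : Γ(X, U)} : x ∈ idealSections f U ↔ f.app U x = 0 :=
  Iff.rfl

variable {f} in
theorem rs_mem_idealSections {U U' : X.Opens} (h : U' ≤ U) {x : Γ(X, U)}
    (hx : x ∈ idealSections f U) : rs h x ∈ idealSections f U' := by
  rw [mem_idealSections, app_rs, mem_idealSections.1 hx, map_zero]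

/-- For `V ⊆ Y` open, a family of maps `φ_U : ℐ(U) → 𝒪_Y(V ∩ f⁻¹(U))`, `U ⊆ X` open, is an
`𝒪_X`-linear map from `ℐ` to `f_*(𝒪_Y|_V)`. -/
structure IsNormalHom (V : Y.Opens) (φ : ∀ U : X.Opens, idealSections f U → Γ(Y, V ⊓ f ⁻¹ᵁ U)) :
    Prop where
  map_res : ∀ (U U' : X.Opens) (h : U' ≤ U) (x : idealSections f U),
    φ U' ⟨rs h x.1, rs_mem_idealSections h x.2⟩ =
      rs (inf_le_inf_left V (f.preimage_mono h)) (φ U x)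
  map_add : ∀ (U : X.Opens) (x y : idealSections f U), φ U (x + y) = φ U x + φ U y
  map_smul : ∀ (U : X.Opens) (a : Γ(X, U)) (x : idealSections f U),
    φ U (a • x) = pullSection f V a * φ U x

namespace IsNormalHom

variable {f}

theorem zero (V : Y.Opens) : IsNormalHom f V fun _ _ => 0 where
  map_res _ _ _ _ := (map_zero _).symm
  map_add _ _ _ := (add_zero _).symm
  map_smul _ _ _ := (mul_zero _).symm

variable {V : Y.Opens} {φ ψ : ∀ U : X.Opens, idealSections f U → Γ(Y, V ⊓ f ⁻¹ᵁ U)}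

theorem add (hφ : IsNormalHom f V φ) (hψ : IsNormalHom f V ψ) :
    IsNormalHom f V fun U x => φ U x + ψ U x where
  map_res U U' h x := by rw [_root_.map_add, hφ.map_res U U' h x, hψ.map_res U U' h x]
  map_add U x y := by rw [hφ.map_add U x y, hψ.map_add U x y]; abel
  map_smul U a x := by rw [hφ.map_smul U a x, hψ.map_smul U a x, mul_add]

theorem smul (r : Γ(Y, V)) (hφ : IsNormalHom f V φ) :
    IsNormalHom f V fun U x => rs inf_le_left r * φ U x where
  map_res U U' h x := by rw [map_mul, hφ.map_res U U' h x, rs_rs]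
  map_add U x y := by rw [hφ.map_add U x y, mul_add]
  map_smul U a x := by rw [hφ.map_smul U a x]; ring

theorem res {V' : Y.Opens} (h : V' ≤ V) (hφ : IsNormalHom f V φ) :
    IsNormalHom f V' fun U x => rs (inf_le_inf_right (f ⁻¹ᵁ U) h) (φ U x) where
  map_res U U' hU x := by rw [hφ.map_res U U' hU x, rs_rs, rs_rs]
  map_add U x y := by rw [hφ.map_add U x y, _root_.map_add]
  map_smul U a x := by rw [hφ.map_smul U a x, map_mul, rs_pullSection f h]

theorem of_local (H : ∀ y ∈ V, ∃ (V' : Y.Opens) (h : V' ≤ V), y ∈ V' ∧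
    IsNormalHom f V' fun U x => rs (inf_le_inf_right (f ⁻¹ᵁ U) h) (φ U x)) :
    IsNormalHom f V φ where
  map_res U U' hU x := eq_of_local fun y hy => by
    obtain ⟨V', h, hyV', hφ⟩ := H y hy
    refine ⟨V', h, hyV', ?_⟩
    rw [hφ.map_res U U' hU x, rs_rs, rs_rs]
  map_add U x y := eq_of_local fun z hz => by
    obtain ⟨V', h, hzV', hφ⟩ := H z hz
    refine ⟨V', h, hzV', ?_⟩
    rw [hφ.map_add U x y, _root_.map_add]
  map_smul U a x := eq_of_local fun z hz => by
    obtain ⟨V', h, hzV', hφ⟩ := H z hz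
    refine ⟨V', h, hzV', ?_⟩
    rw [hφ.map_smul U a x, map_mul, rs_pullSection f h]

end IsNormalHom

/-- The homomorphisms from `ℐ` to `𝒪_Y` over the open subsets of `Y`. -/
noncomputable def normalHoms :
    LocalSubmodule (fun a : (U : X.Opens) × idealSections f U => f ⁻¹ᵁ a.1) where
  sections V :=
    { carrier := {s | IsNormalHom f V fun U x => s ⟨U, x⟩}
      zero_mem' := IsNormalHom.zero V
      add_mem' := IsNormalHom.add
      smul_mem' := fun r _ hs => IsNormalHom.smul r hs }
  res_mem h _ hs := IsNormalHom.res h hs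
  mem_of_local _ H := IsNormalHom.of_local H

/-- The normal sheaf `N_{Y/X}` of a closed immersion `f : Y → X` with ideal sheaf `ℐ`: the sheaf
`ℋom_{𝒪_Y}(ℐ/ℐ², 𝒪_Y)`, whose sections over `V` are the `𝒪_X`-linear maps from `ℐ` to `f_*(𝒪_Y|_V)`
(such a map kills `ℐ²`). -/
noncomputable def normalSheaf : Y.Modules := (normalHoms f).toModules

/-- The map `T_Y → 𝒟er_S(f⁻¹𝒪_X, 𝒪_Y)`, `D ↦ D ∘ f^♯`. -/
noncomputable def tangentToDerivations : tangentSheaf (f ≫ p) ⟶ derivationSheaf f p :=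
  modulesHomMk
    (fun V =>
      { toFun := fun (s : (derivations (𝟙 Y) (f ≫ p)).sections V) =>
          (⟨fun a => s.1 ⟨f ⁻¹ᵁ a.1, f.app a.1 a.2⟩, IsDerivationAlong.precomp f s.2⟩ :
            (derivations f p).sections V)
        map_zero' := rfl
        map_add' := fun _ _ => rfl })
    (fun _ _ => rfl) (fun _ _ _ => rfl)

/-- The map `T_X → f_* 𝒟er_S(f⁻¹𝒪_X, 𝒪_Y)`, `D ↦ f^♯ ∘ D`. -/
noncomputable def tangentToPushforward :
    tangentSheaf p ⟶ (Scheme.Modules.pushforward f).obj (derivationSheaf f p) :=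
  modulesHomMk
    (fun V =>
      { toFun := fun (s : (derivations (𝟙 X) p).sections V) =>
          (⟨fun a => f.app (V ⊓ a.1) (s.1 a), IsDerivationAlong.postcomp f s.2⟩ :
            (derivations f p).sections (f ⁻¹ᵁ V))
        map_zero' := Subtype.ext (funext fun a => map_zero _)
        map_add' := fun _ _ => Subtype.ext (funext fun a => map_add _ _ _) })
    (fun i s => Subtype.ext (funext fun a => app_rs f _ _))
    (fun V r s => Subtype.ext (funext fun a => by
      refine (map_mul (f.app (V ⊓ a.1)).hom _ _).trans ?_
      congr 1
      exact app_rs f _ _))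

/-- The canonical map `f^*T_X → 𝒟er_S(f⁻¹𝒪_X, 𝒪_Y) = ℋom(f^*Ω_{X/S}, 𝒪_Y)`, adjoint to
`D ↦ f^♯ ∘ D`. It is an isomorphism when `X` is smooth over `S`. -/
noncomputable def restrictedTangentToDerivations :
    (Scheme.Modules.pullback f).obj (tangentSheaf p) ⟶ derivationSheaf f p :=
  ((Scheme.Modules.pullbackPushforwardAdjunction f).homEquiv _ _).symm (tangentToPushforward f p)

/-- The map `𝒟er_S(f⁻¹𝒪_X, 𝒪_Y) → N_{Y/X}` that restricts a derivation to the ideal sheaf. -/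
noncomputable def derivationsToNormal : derivationSheaf f p ⟶ normalSheaf f :=
  modulesHomMk
    (fun V =>
      { toFun := fun (s : (derivations f p).sections V) =>
          (⟨fun a => s.1 ⟨a.1, a.2.1⟩,
            { map_res := fun U U' h x => s.2.map_res U U' h x.1
              map_add := fun U x y => s.2.map_add U x.1 y.1
              map_smul := fun U a x => by
                refine (s.2.leibniz U a x.1).trans ?_
                have : pullSection f V x.1 = 0 := by
                  rw [pullSection, mem_idealSections.1 x.2, map_zero]
                rw [this, zero_mul, add_zero] }⟩ :
            (normalHoms f).sections V)
        map_zero' := rfl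
        map_add' := fun _ _ => rfl })
    (fun _ _ => rfl) (fun _ _ _ => rfl)

theorem tangentToDerivations_comp : tangentToDerivations f p ≫ derivationsToNormal f p = 0 := by
  refine Scheme.Modules.hom_ext _ _ fun V => ?_
  refine AddCommGrpCat.hom_ext (AddMonoidHom.ext fun s => ?_)
  refine Subtype.ext (funext fun a => ?_)
  change s.1 ⟨f ⁻¹ᵁ a.1, f.app a.1 a.2.1⟩ = 0
  rw [mem_idealSections.1 a.2.2]
  have := s.2.map_add (f ⁻¹ᵁ a.1) 0 0
  rw [add_zero] at this
  exact left_eq_add.1 this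

/-- The normal sequence `T_Y → T_X|_Y → N_{Y/X}` with `T_X|_Y = f^*T_X`. Its maps are the natural
ones: under the canonical identification of `f^*T_X` with the sheaf of derivations from `𝒪_X` to
`𝒪_Y`, the first is `D ↦ D ∘ f^♯` and the second is restriction to the ideal sheaf. -/
noncomputable def normalSequence [IsIso (restrictedTangentToDerivations f p)] :
    ShortComplex Y.Modules where
  X₁ := tangentSheaf (f ≫ p)
  X₂ := (Scheme.Modules.pullback f).obj (tangentSheaf p)
  X₃ := normalSheaf f
  f := tangentToDerivations f p ≫ inv (restrictedTangentToDerivations f p)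
  g := restrictedTangentToDerivations f p ≫ derivationsToNormal f p
  zero := by
    rw [Category.assoc, IsIso.inv_hom_id_assoc, tangentToDerivations_comp]

end Derivations
end Sheaves

section Hypotheses

attribute [local instance] MvPolynomial.gradedAlgebra in
/-- `X` is projective over the field `k`: it has a closed immersion over `k` into some projective
space `ℙⁿ = Proj k[x_0, …, x_n]`. -/
def IsProjectiveOver {k : Type u} [Field k] {X : Scheme.{u}} (p : X ⟶ Spec (.of k)) : Prop :=
  ∃ (n : ℕ) (j : X ⟶ Proj (MvPolynomial.homogeneousSubmodule (Fin (n + 1)) k)),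
    IsClosedImmersion j ∧
      j ≫ Proj.toSpecZero _ ≫ Spec.map (CommRingCat.ofHom (algebraMap k
        (MvPolynomial.homogeneousSubmodule (Fin (n + 1)) k 0))) = p

/-- `i : Y → X` is the inclusion of a prime divisor: an integral closed subscheme of codimension
one. -/
structure IsPrimeDivisor {X Y : Scheme.{u}} (i : Y ⟶ X) : Prop where
  isClosedImmersion : IsClosedImmersion i
  isIntegral : IsIntegral Y
  codim_one : ringKrullDim (X.presheaf.stalk (i (genericPoint Y))) = 1

/-- A subset of `X(Δ)` is `T`-invariant if it is stable under the action of every point of `T`. -/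
def IsTorusInvariant {N : Type u} [AddCommGroup N] [Module.Free ℤ N] [Module.Finite ℤ N]
    {k : Type u} [Field k] (Δ : Fan N) (Z : Set (Δ.toricVariety k)) : Prop :=
  ∀ t : Torus N k, Δ.torusAction t '' Z = Z

end Hypotheses

end Toric

/-!
The normal sequence of a `T`-invariant prime divisor `Y` in a smooth toric variety `X` splits because
there is a global vector field on `X` that vanishes along `Y` and acts as the identity on the conormal
sheaf `ℐ/ℐ²`: the Euler field of `Y`.

To find it, write `v ∈ N` for the primitive vector on the ray of `Y`, considered as a homomorphism
`w : M → ℤ`. The derivations `χ^m ↦ w(m) χ^m` of the coordinate rings `k[σ^∨ ∩ M]` glue to a vector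
field `δ` on `X` (`exists_fieldMap_eq`; it is the infinitesimal action of the one-parameter subgroup
`v`). On a chart that meets `Y`, the ideal of `Y` is generated by a character `x` with `w = 1`, and all
characters outside this ideal have `w = 0`. Hence `δ` takes values in `ℐ` and `δ x = x`, so that
`φ ↦ φ ∘ δ` is an `𝒪_Y`-linear section of the restriction of derivations to `ℐ`
(`isEulerField_fieldMap`, `IsEulerField.exists_section`). A derivation from `𝒪_X` to `𝒪_Y` that kills
`ℐ` descends to `𝒪_Y` because functions on `Y` lift locally to `X`; together with the section this
splits the sequence (`IsDerivationAlong.exists_descent`, `nonempty_splitting`).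

Smoothness enters through the structure of the cones: if `k[S]` is formally smooth over `k`, where
`S = σ^∨ ∩ M`, then `S` is given by the nonnegativity of some coordinates of a basis of `M`
(`exists_basis_of_formallySmooth`). For this, the irreducible elements of `S` have to be linearly
independent modulo units. The homomorphism from `k[S]` to `k[t][x]/(x²)` that sends units to `1`,
irreducible elements of class `q` to `t_q x` and all other characters to `0` lifts to `k[t][x]/(xⁿ)`
for all `n`, and a relation between irreducible elements would give a relation between the leading
coefficients `t_q`.

With such coordinates, a torus-invariant prime ideal of height one contains a character, hence a
coordinate, and is generated by it (`exists_eq_span_coordinate`); this gives the weight `w`, which is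
independent of the chart (`IsDivisorWeight.eq_of_le`). Moreover the partial derivatives with respect
to the coordinates generate `T_X` locally and map to a local basis of the sheaf of derivations from
`𝒪_X` to `𝒪_Y`. By the Yoneda lemma, this identifies the latter sheaf with `i^* T_X`
(`isIso_of_localBasis`, `isIso_restrictedTangentToDerivations`).
-/

namespace Toric

/-! ### Pullback of modules with local bases -/

section LocalBasis

open TopologicalSpace Opposite

/-- Restriction of the sections of a sheaf of modules. -/
noncomputable def mrs {X : Scheme.{u}} (M : X.Modules) {U V : X.Opens} (h : V ≤ U) :
    Γ(M, U) →+ Γ(M, V) :=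
  (M.presheaf.map (homOfLE h).op).hom

section

variable {X : Scheme.{u}} (M : X.Modules)

theorem mrs_mrs {U V W : X.Opens} (h : V ≤ U) (h' : W ≤ V) (m : Γ(M, U)) :
    mrs M h' (mrs M h m) = mrs M (h'.trans h) m := by
  change (M.presheaf.map (homOfLE h).op ≫ M.presheaf.map (homOfLE h').op) m = _
  rw [← M.presheaf.map_comp]; rfl

theorem mrs_smul {U V : X.Opens} (h : V ≤ U) (r : Γ(X, U)) (m : Γ(M, U)) :
    mrs M h (r • m) = rs h r • mrs M h m :=
  Scheme.Modules.map_smul M (homOfLE h) r m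

variable {M} in
theorem app_mrs {M' : X.Modules} (φ : M ⟶ M') {U V : X.Opens} (h : V ≤ U) (m : Γ(M, U)) :
    φ.app V (mrs M h m) = mrs M' h (φ.app U m) :=
  congr($(φ.mapPresheaf.naturality (homOfLE h).op) m)

theorem mrs_ext {ι : Type*} {V : X.Opens} (U : ι → X.Opens) (hU : ∀ i, U i ≤ V)
    (hV : V ≤ iSup U) {s t : Γ(M, V)} (h : ∀ i, mrs M (hU i) s = mrs M (hU i) t) : s = t :=
  TopCat.Sheaf.eq_of_locally_eq' (C := Ab.{u}) (X := X.toTopCat) ⟨M.presheaf, M.isSheaf⟩ U V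
    (fun i => homOfLE (hU i)) hV s t h

theorem mrs_glue {ι : Type*} {V : X.Opens} (U : ι → X.Opens) (hU : ∀ i, U i ≤ V)
    (hV : V ≤ iSup U) (s : ∀ i, Γ(M, U i))
    (h : ∀ i j, mrs M (inf_le_left : U i ⊓ U j ≤ U i) (s i) =
      mrs M (inf_le_right : U i ⊓ U j ≤ U j) (s j)) :
    ∃ t : Γ(M, V), ∀ i, mrs M (hU i) t = s i :=
  (TopCat.Sheaf.existsUnique_gluing' (C := Ab.{u}) (X := X.toTopCat) ⟨M.presheaf, M.isSheaf⟩ U V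
    (fun i => homOfLE (hU i)) hV s h).exists

end

variable {X Y : Scheme.{u}} {f : Y ⟶ X} {M : X.Modules} {Q K : Y.Modules}

/-- The action on sections of a morphism to a direct image. -/
noncomputable def pushApp (α : M ⟶ (Scheme.Modules.pushforward f).obj Q) (U : X.Opens) :
    Γ(M, U) →+ Γ(Q, f ⁻¹ᵁ U) :=
  (α.app U).hom

theorem pushApp_mrs (α : M ⟶ (Scheme.Modules.pushforward f).obj Q) {U V : X.Opens} (h : V ≤ U)
    (m : Γ(M, U)) : pushApp α V (mrs M h m) = mrs Q (f.preimage_mono h) (pushApp α U m) :=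
  app_mrs α h m

theorem pushApp_smul (α : M ⟶ (Scheme.Modules.pushforward f).obj Q) {U : X.Opens} (r : Γ(X, U))
    (m : Γ(M, U)) : pushApp α U (r • m) = f.app U r • pushApp α U m :=
  α.app_smul r m

theorem pushApp_comp (α : M ⟶ (Scheme.Modules.pushforward f).obj Q) (γ : Q ⟶ K) (U : X.Opens)
    (m : Γ(M, U)) :
    pushApp (α ≫ (Scheme.Modules.pushforward f).map γ) U m = γ.app (f ⁻¹ᵁ U) (pushApp α U m) :=
  rfl

/-- For `α : M → f_* Q`, finitely many sections of `M` over an open set `U` which generate `M|_U` and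
whose images under `α` form a basis of `Q` over `f⁻¹(U)`. -/
structure LocalBasis (α : M ⟶ (Scheme.Modules.pushforward f).obj Q) where
  U : X.Opens
  ι : Type u
  fintype : Fintype ι
  e : ι → Γ(M, U)
  span : ∀ {V : X.Opens} (h : V ≤ U) (m : Γ(M, V)),
    ∃ c : ι → Γ(X, V), m = ∑ j, c j • mrs M h (e j)
  basis : ∀ {V : Y.Opens} (h : V ≤ f ⁻¹ᵁ U) (s : Γ(Q, V)),
    ∃! c : ι → Γ(Y, V), s = ∑ j, c j • mrs Q h (pushApp α U (e j))

attribute [instance] LocalBasis.fintype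

namespace LocalBasis

variable {α : M ⟶ (Scheme.Modules.pushforward f).obj Q} (B : LocalBasis α)
  (β : M ⟶ (Scheme.Modules.pushforward f).obj K)

/-- The coordinates of a section of `Q` in a local basis. -/
noncomputable def coord {V : Y.Opens} (h : V ≤ f ⁻¹ᵁ B.U) (s : Γ(Q, V)) : B.ι → Γ(Y, V) :=
  (B.basis h s).choose

theorem eq_sum_coord {V : Y.Opens} (h : V ≤ f ⁻¹ᵁ B.U) (s : Γ(Q, V)) :
    s = ∑ j, B.coord h s j • mrs Q h (pushApp α B.U (B.e j)) :=
  (B.basis h s).choose_spec.1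

theorem coord_eq {V : Y.Opens} (h : V ≤ f ⁻¹ᵁ B.U) {s : Γ(Q, V)} {c : B.ι → Γ(Y, V)}
    (hc : s = ∑ j, c j • mrs Q h (pushApp α B.U (B.e j))) : B.coord h s = c :=
  ((B.basis h s).choose_spec.2 c hc).symm

/-- The map `Q → K` over `f⁻¹(U)` that sends `α (e j)` to `β (e j)`. -/
noncomputable def transfer {V : Y.Opens} (h : V ≤ f ⁻¹ᵁ B.U) (s : Γ(Q, V)) : Γ(K, V) :=
  ∑ j, B.coord h s j • mrs K h (pushApp β B.U (B.e j))

theorem transfer_eq {V : Y.Opens} (h : V ≤ f ⁻¹ᵁ B.U) {s : Γ(Q, V)} {c : B.ι → Γ(Y, V)}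
    (hc : s = ∑ j, c j • mrs Q h (pushApp α B.U (B.e j))) :
    B.transfer β h s = ∑ j, c j • mrs K h (pushApp β B.U (B.e j)) := by
  rw [transfer, B.coord_eq h hc]

theorem transfer_add {V : Y.Opens} (h : V ≤ f ⁻¹ᵁ B.U) (s t : Γ(Q, V)) :
    B.transfer β h (s + t) = B.transfer β h s + B.transfer β h t := by
  rw [B.transfer_eq β h (s := s + t) (c := fun j => B.coord h s j + B.coord h t j)]
  · simp only [add_smul, Finset.sum_add_distrib, transfer]
  · simp only [add_smul, Finset.sum_add_distrib, ← eq_sum_coord]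

theorem transfer_smul {V : Y.Opens} (h : V ≤ f ⁻¹ᵁ B.U) (r : Γ(Y, V)) (s : Γ(Q, V)) :
    B.transfer β h (r • s) = r • B.transfer β h s := by
  rw [B.transfer_eq β h (s := r • s) (c := fun j => r * B.coord h s j)]
  · simp only [mul_smul, ← Finset.smul_sum, transfer]
  · simp only [mul_smul, ← Finset.smul_sum, ← eq_sum_coord]

theorem transfer_sum {V : Y.Opens} (h : V ≤ f ⁻¹ᵁ B.U) {ι : Type*} (T : Finset ι)
    (s : ι → Γ(Q, V)) : B.transfer β h (∑ j ∈ T, s j) = ∑ j ∈ T, B.transfer β h (s j) :=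
  map_sum (AddMonoidHom.mk' (B.transfer β h) (B.transfer_add β h)) s T

theorem mrs_transfer {V V' : Y.Opens} (h : V ≤ f ⁻¹ᵁ B.U) (h' : V' ≤ V) (s : Γ(Q, V)) :
    mrs K h' (B.transfer β h s) = B.transfer β (h'.trans h) (mrs Q h' s) := by
  rw [B.transfer_eq β (h'.trans h) (s := mrs Q h' s) (c := fun j => rs h' (B.coord h s j))]
  · simp only [transfer, map_sum, mrs_smul, mrs_mrs]
  · conv_lhs => rw [B.eq_sum_coord h s]
    simp only [map_sum, mrs_smul, mrs_mrs]

theorem transfer_pushApp {W : X.Opens} (hW : W ≤ B.U) (m : Γ(M, W)) :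
    B.transfer β (f.preimage_mono hW) (pushApp α W m) = pushApp β W m := by
  obtain ⟨c, hc⟩ := B.span hW m
  rw [B.transfer_eq β (f.preimage_mono hW) (c := fun j => f.app W (c j))]
  · conv_rhs => rw [hc]
    simp only [map_sum, pushApp_smul, pushApp_mrs]
  · conv_lhs => rw [hc]
    simp only [map_sum, pushApp_smul, pushApp_mrs]

/-- The map `α (e j) ↦ β (e j)` does not depend on the choice of the local generators. -/
theorem transfer_eq_transfer (B' : LocalBasis α) {V : Y.Opens} (h : V ≤ f ⁻¹ᵁ B.U)
    (h' : V ≤ f ⁻¹ᵁ B'.U) (s : Γ(Q, V)) : B.transfer β h s = B'.transfer β h' s := by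
  have key : ∀ j, B'.transfer β h' (mrs Q h (pushApp α B.U (B.e j))) =
      mrs K h (pushApp β B.U (B.e j)) := by
    intro j
    have hV : V ≤ f ⁻¹ᵁ (B.U ⊓ B'.U) := le_inf h h'
    have h1 := B'.transfer_pushApp β (W := B.U ⊓ B'.U) inf_le_right
      (mrs M inf_le_left (B.e j))
    have h2 := congrArg (mrs K hV) h1
    rw [mrs_transfer, pushApp_mrs, pushApp_mrs, mrs_mrs, mrs_mrs] at h2
    exact h2
  conv_rhs => rw [B.eq_sum_coord h s]
  rw [transfer_sum]
  simp only [transfer_smul, key]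
  rfl

end LocalBasis

variable {α : M ⟶ (Scheme.Modules.pushforward f).obj Q}

/-- The local maps `α (e j) ↦ β (e j)` glue. -/
theorem exists_unique_extension (H : ∀ y : Y, ∃ B : LocalBasis α, f y ∈ B.U)
    (β : M ⟶ (Scheme.Modules.pushforward f).obj K) (V : Y.Opens) (s : Γ(Q, V)) :
    ∃! t : Γ(K, V), ∀ (B : LocalBasis α) (V' : Y.Opens) (h : V' ≤ V) (h' : V' ≤ f ⁻¹ᵁ B.U),
      mrs K h t = B.transfer β h' (mrs Q h s) := by
  choose B hB using H
  have hcov : V ≤ ⨆ y, V ⊓ f ⁻¹ᵁ (B y).U := fun y hy => Opens.mem_iSup.2 ⟨y, hy, hB y⟩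
  obtain ⟨t, ht⟩ := mrs_glue K (fun y => V ⊓ f ⁻¹ᵁ (B y).U) (fun _ => inf_le_left) hcov
    (fun y => (B y).transfer β inf_le_right (mrs Q inf_le_left s)) (fun y y' => by
      rw [LocalBasis.mrs_transfer, LocalBasis.mrs_transfer, mrs_mrs, mrs_mrs]
      exact LocalBasis.transfer_eq_transfer _ _ _ _ _ _)
  refine ⟨t, fun B' V' h h' => ?_, fun t' ht' => ?_⟩
  · refine mrs_ext K (fun y => V' ⊓ f ⁻¹ᵁ (B y).U) (fun _ => inf_le_left)
      (fun y hy => Opens.mem_iSup.2 ⟨y, hy, hB y⟩) fun y => ?_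
    have := congrArg (mrs K (inf_le_inf_right _ h : V' ⊓ f ⁻¹ᵁ (B y).U ≤ V ⊓ f ⁻¹ᵁ (B y).U)) (ht y)
    rw [mrs_mrs, LocalBasis.mrs_transfer, mrs_mrs] at this
    rw [mrs_mrs, LocalBasis.mrs_transfer, mrs_mrs, this]
    exact LocalBasis.transfer_eq_transfer _ _ _ _ _ _
  · refine mrs_ext K _ (fun _ => inf_le_left) hcov fun y => ?_
    rw [ht, ht' (B y)]

/-- A morphism `α : M → f_* Q` exhibits `Q` as `f^* M` as soon as there are local generators of `M`
whose images form local bases of `Q`. By the Yoneda lemma it suffices that every `β : M → f_* K`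
factors uniquely through `α`, and `α(e j) ↦ β(e j)` defines this factorization locally. -/
theorem isIso_of_localBasis (H : ∀ y : Y, ∃ B : LocalBasis α, f y ∈ B.U) :
    IsIso (((Scheme.Modules.pullbackPushforwardAdjunction f).homEquiv _ _).symm α) := by
  refine isIso_of_coyoneda_map_bijective _ fun K => ?_
  have hinj : Function.Injective fun γ : Q ⟶ K => α ≫ (Scheme.Modules.pushforward f).map γ := by
    intro γ γ' hγ
    refine Scheme.Modules.hom_ext _ _ fun V => ?_
    refine AddCommGrpCat.hom_ext (AddMonoidHom.ext fun s => ?_)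
    choose B hB using H
    refine mrs_ext K (fun y => V ⊓ f ⁻¹ᵁ (B y).U) (fun _ => inf_le_left)
      (fun y hy => Opens.mem_iSup.2 ⟨y, hy, hB y⟩) fun y => ?_
    have key : ∀ j, γ.app _ (pushApp α (B y).U ((B y).e j)) =
        γ'.app _ (pushApp α (B y).U ((B y).e j)) := fun j => by
      rw [← pushApp_comp, ← pushApp_comp]
      exact congrArg (fun δ => pushApp δ (B y).U ((B y).e j)) hγ
    have h1 := (B y).eq_sum_coord inf_le_right
      (mrs Q (inf_le_left : V ⊓ f ⁻¹ᵁ (B y).U ≤ V) s)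
    change mrs K _ (γ.app V s) = mrs K _ (γ'.app V s)
    rw [← app_mrs, ← app_mrs, h1, map_sum, map_sum]
    refine Finset.sum_congr rfl fun j _ => ?_
    rw [Scheme.Modules.Hom.app_smul, Scheme.Modules.Hom.app_smul, app_mrs, app_mrs, key]
  have hsurj : Function.Surjective
      fun γ : Q ⟶ K => α ≫ (Scheme.Modules.pushforward f).map γ := by
    intro β
    choose g hg hgu using exists_unique_extension (K := K) H β
    refine ⟨modulesHomMk (M := Q) (M' := K) (fun V => AddMonoidHom.mk' (g V) fun s t => ?_)
      (fun {V V'} i s => ?_) (fun V r s => ?_), ?_⟩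
    · refine (hgu V _ _ fun B V' h h' => ?_).symm
      rw [map_add, map_add, hg V s B V' h h', hg V t B V' h h', LocalBasis.transfer_add]
    · refine (hgu V' _ _ fun B V'' h h' => ?_).symm
      have := hg V s B V'' (h.trans i.le) h'
      change mrs K h (mrs K i.le (g V s)) = B.transfer β h' (mrs Q h (mrs Q i.le s))
      rw [mrs_mrs, mrs_mrs, this]
    · refine (hgu V _ _ fun B V' h h' => ?_).symm
      rw [mrs_smul, mrs_smul, LocalBasis.transfer_smul]
      exact congrArg _ (hg V s B V' h h')
    · refine Scheme.Modules.hom_ext _ _ fun U => ?_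
      refine AddCommGrpCat.hom_ext (AddMonoidHom.ext fun m => ?_)
      change g (f ⁻¹ᵁ U) (pushApp α U m) = pushApp β U m
      refine (hgu _ _ _ fun B V' h h' => ?_).symm
      have h1 := B.transfer_pushApp β (W := U ⊓ B.U) inf_le_right (mrs M inf_le_left m)
      have hV : V' ≤ f ⁻¹ᵁ (U ⊓ B.U) := le_inf h h'
      have h2 := congrArg (mrs K hV) h1
      rw [LocalBasis.mrs_transfer, pushApp_mrs, pushApp_mrs, mrs_mrs, mrs_mrs] at h2
      exact h2.symm
  have hcomp : (fun γ : Q ⟶ K =>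
      ((Scheme.Modules.pullbackPushforwardAdjunction f).homEquiv _ _).symm α ≫ γ) =
      ((Scheme.Modules.pullbackPushforwardAdjunction f).homEquiv _ _).symm ∘
      fun γ : Q ⟶ K => α ≫ (Scheme.Modules.pushforward f).map γ := by
    funext γ
    exact ((Scheme.Modules.pullbackPushforwardAdjunction f).homEquiv_naturality_right_symm α γ).symm
  rw [hcomp]
  exact (Equiv.bijective _).comp ⟨hinj, hsurj⟩

end LocalBasis

/-! ### Derivations on affine open sets -/

section AffineDerivations

open TopologicalSpace Opposite

theorem rs_ext {Y : Scheme.{u}} {ι : Type*} {V : Y.Opens} (U : ι → Y.Opens) (hU : ∀ i, U i ≤ V)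
    (hV : V ≤ iSup U) {s t : Γ(Y, V)} (h : ∀ i, rs (hU i) s = rs (hU i) t) : s = t :=
  Y.sheaf.eq_of_locally_eq' U V (fun i => homOfLE (hU i)) hV s t h

theorem rs_glue {Y : Scheme.{u}} {ι : Type*} {V : Y.Opens} (U : ι → Y.Opens) (hU : ∀ i, U i ≤ V)
    (hV : V ≤ iSup U) (s : ∀ i, Γ(Y, U i))
    (h : ∀ i j, rs (inf_le_left : U i ⊓ U j ≤ U i) (s i) =
      rs (inf_le_right : U i ⊓ U j ≤ U j) (s j)) :
    ∃ t : Γ(Y, V), ∀ i, rs (hU i) t = s i :=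
  (Y.sheaf.existsUnique_gluing' U V (fun i => homOfLE (hU i)) hV s h).exists

theorem rs_ext_of_mem {Y : Scheme.{u}} {V : Y.Opens} {s t : Γ(Y, V)}
    (H : ∀ y ∈ V, ∃ (V' : Y.Opens) (h : V' ≤ V), y ∈ V' ∧ rs h s = rs h t) : s = t := by
  choose! V' h hy hst using H
  exact rs_ext (fun y : V => V' y.1) (fun y => h y.1 y.2)
    (fun y hyV => Opens.mem_iSup.2 ⟨⟨y, hyV⟩, hy y hyV⟩) fun y => hst y.1 y.2

theorem rs_injective_of_le {Y : Scheme.{u}} {V V' : Y.Opens} (h : V' ≤ V) (h' : V ≤ V') :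
    Function.Injective (rs h) := fun s t hst => by
  have := congrArg (rs h') hst
  rwa [rs_rs, rs_rs, rs_refl, rs_refl] at this

variable {S X Y : Scheme.{u}} (f : Y ⟶ X) {p : X ⟶ S}

/-- The pullback of functions followed by restriction. -/
noncomputable def pullRes {V : Y.Opens} {U : X.Opens} (h : V ≤ f ⁻¹ᵁ U) : Γ(X, U) →+* Γ(Y, V) :=
  (rs h).comp (f.app U).hom

variable {f}

theorem rs_pullRes {V V' : Y.Opens} {U : X.Opens} (h : V ≤ f ⁻¹ᵁ U) (h' : V' ≤ V) (x : Γ(X, U)) :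
    rs h' (pullRes f h x) = pullRes f (h'.trans h) x := rs_rs _ _ _

theorem pullRes_rs {V : Y.Opens} {U U' : X.Opens} (h : V ≤ f ⁻¹ᵁ U') (h' : U' ≤ U) (x : Γ(X, U)) :
    pullRes f h (rs h' x) = pullRes f (h.trans (f.preimage_mono h')) x := by
  change rs h (f.app U' (rs h' x)) = _
  rw [app_rs, rs_rs]; rfl

theorem pullSection_eq (V : Y.Opens) {U : X.Opens} (x : Γ(X, U)) :
    pullSection f V x = pullRes f inf_le_right x := rfl

/-- Near a point of an affine open set `U`, a function is a fraction of functions on `U`. -/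
theorem exists_fraction {U W : X.Opens} (hU : IsAffineOpen U) (x : Γ(X, W)) {z : X} (hzU : z ∈ U)
    (hzW : z ∈ W) : ∃ (O : X.Opens) (hOU : O ≤ U) (hOW : O ≤ W) (a b : Γ(X, U)), z ∈ O ∧
      rs hOU b * rs hOW x = rs hOU a ∧ IsUnit (rs hOU b) := by
  obtain ⟨g, hgW, hzg⟩ := hU.exists_basicOpen_le (V := W) ⟨z, hzW⟩ hzU
  have := hU.isLocalization_basicOpen g
  obtain ⟨n, a, ha⟩ := IsLocalization.Away.surj g (rs hgW x)
  have hg : IsUnit (rs (X.basicOpen_le g) g) :=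
    IsLocalization.Away.algebraMap_isUnit (S := Γ(X, X.basicOpen g)) g
  refine ⟨X.basicOpen g, X.basicOpen_le g, hgW, a, g ^ n, hzg, ?_, ?_⟩
  · rw [mul_comm, map_pow]; exact ha
  · rw [map_pow]; exact hg.pow n

/-- A function on an affine open set `U` that vanishes near a point of `U` is annihilated by a
function on `U` that is invertible near this point. -/
theorem exists_annihilator {U O : X.Opens} (hU : IsAffineOpen U) (hO : O ≤ U) {x : Γ(X, U)}
    (hx : rs hO x = 0) {z : X} (hz : z ∈ O) :
    ∃ (O' : X.Opens) (hO' : O' ≤ O) (b : Γ(X, U)), z ∈ O' ∧ b * x = 0 ∧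
      IsUnit (rs (hO'.trans hO) b) := by
  obtain ⟨g, hgO, hzg⟩ := hU.exists_basicOpen_le (V := O) ⟨z, hz⟩ (hO hz)
  have := hU.isLocalization_basicOpen g
  have hg : IsUnit (rs (X.basicOpen_le g) g) :=
    IsLocalization.Away.algebraMap_isUnit (S := Γ(X, X.basicOpen g)) g
  have h0 : algebraMap Γ(X, U) Γ(X, X.basicOpen g) x =
      algebraMap Γ(X, U) Γ(X, X.basicOpen g) 0 := by
    rw [map_zero]
    change rs (X.basicOpen_le g) x = 0
    rw [← rs_rs hO hgO, hx, map_zero]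
  obtain ⟨n, hn⟩ := IsLocalization.Away.exists_of_eq g h0
  refine ⟨X.basicOpen g, hgO, g ^ n, hzg, by rw [hn, mul_zero], ?_⟩
  rw [map_pow]; exact hg.pow n

/-- A derivation is determined by its values on the functions on an affine open set. -/
theorem IsDerivationAlong.ext_of_isAffineOpen {V : Y.Opens} {U : X.Opens} (hU : IsAffineOpen U)
    (hV : V ≤ f ⁻¹ᵁ U) {D D' : ∀ W : X.Opens, Γ(X, W) → Γ(Y, V ⊓ f ⁻¹ᵁ W)}
    (hD : IsDerivationAlong f p V D) (hD' : IsDerivationAlong f p V D')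
    (h : ∀ a : Γ(X, U), D U a = D' U a) (W : X.Opens) (x : Γ(X, W)) : D W x = D' W x := by
  refine rs_ext_of_mem fun y hy => ?_
  obtain ⟨O, hOU, hOW, a, b, hyO, hab, hb⟩ := exists_fraction hU x (hV hy.1) hy.2
  refine ⟨V ⊓ f ⁻¹ᵁ O, inf_le_inf_left V (f.preimage_mono hOW), ⟨hy.1, hyO⟩, ?_⟩
  have e : ∀ c : Γ(X, U), D' O (rs hOU c) = D O (rs hOU c) := fun c => by
    rw [hD.map_res, hD'.map_res, h]
  have h1 := hD.leibniz O (rs hOU b) (rs hOW x)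
  have h2 := hD'.leibniz O (rs hOU b) (rs hOW x)
  rw [hab, hD.map_res W] at h1
  rw [hab, hD'.map_res W, e, e, h1] at h2
  have hb' : IsUnit (pullSection f V (rs hOU b)) := hb.map (pullRes f inf_le_right)
  exact hb'.mul_left_cancel (add_right_cancel h2)

section Extension

variable {V : Y.Opens} {U : X.Opens} (hU : IsAffineOpen U) (hV : V ≤ f ⁻¹ᵁ U)
  (d : Γ(X, U) →+ Γ(Y, V))

include hU in
/-- Derivations are local: `d z` vanishes over an open set over which `z` vanishes. -/
theorem rs_derivation_eq_zero
    (hd : ∀ a b, d (a * b) = pullRes f hV a * d b + pullRes f hV b * d a)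
    {O : X.Opens} (hO : O ≤ U) {z : Γ(X, U)} (hz : rs hO z = 0)
    {V' : Y.Opens} (h : V' ≤ V) (h' : V' ≤ f ⁻¹ᵁ O) : rs h (d z) = 0 := by
  refine rs_ext_of_mem fun y hy => ?_
  obtain ⟨O', hO', b, hyO', hbz, hb⟩ := exists_annihilator hU hO hz (h' hy)
  have hW : V' ⊓ f ⁻¹ᵁ O' ≤ V' := inf_le_left
  have hW' : V' ⊓ f ⁻¹ᵁ O' ≤ f ⁻¹ᵁ O' := inf_le_right
  refine ⟨V' ⊓ f ⁻¹ᵁ O', hW, ⟨hy, hyO'⟩, ?_⟩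
  have h1 := congrArg (rs (hW.trans h)) (hd b z)
  rw [hbz, map_zero, map_zero, map_add, map_mul, map_mul, rs_pullRes, rs_pullRes,
    ← pullRes_rs (hW.trans h') hO z, hz, map_zero, zero_mul, add_zero,
    ← pullRes_rs hW' (hO'.trans hO) b] at h1
  rw [rs_rs, map_zero]
  exact ((hb.map (pullRes f hW')).mul_right_eq_zero.1 h1.symm)

/-- `t` is a value at `x` of an extension of the derivation `d`: it satisfies the quotient rule for
all ways of writing `x` locally as a fraction `a / b`. -/
def IsQuotientValue {W : X.Opens} (x : Γ(X, W)) {V' : Y.Opens} (hVV : V' ≤ V)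
    (hVW : V' ≤ f ⁻¹ᵁ W) (t : Γ(Y, V')) : Prop :=
  ∀ (a b : Γ(X, U)) (O : X.Opens) (hOU : O ≤ U) (hOW : O ≤ W), rs hOU b * rs hOW x = rs hOU a →
    ∀ (V'' : Y.Opens) (h : V'' ≤ V'), V'' ≤ f ⁻¹ᵁ O →
      pullRes f (h.trans (hVV.trans hV)) b * rs h t +
        pullRes f (h.trans hVW) x * rs (h.trans hVV) (d b) = rs (h.trans hVV) (d a)

variable {d hV}

theorem IsQuotientValue.res {W : X.Opens} {x : Γ(X, W)} {V' : Y.Opens} {hVV : V' ≤ V}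
    {hVW : V' ≤ f ⁻¹ᵁ W} {t : Γ(Y, V')} (ht : IsQuotientValue hV d x hVV hVW t) {V'' : Y.Opens}
    (h : V'' ≤ V') {W' : X.Opens} (hW : W' ≤ W) (h' : V'' ≤ f ⁻¹ᵁ W') :
    IsQuotientValue hV d (rs hW x) (h.trans hVV) h' (rs h t) := by
  intro a b O hOU hOW hab V₃ h₃ hO
  rw [rs_rs] at hab
  have := ht a b O hOU (hOW.trans hW) hab V₃ (h₃.trans h) hO
  rw [rs_rs, pullRes_rs]
  exact this

include hU in
theorem IsQuotientValue.unique {W : X.Opens} {x : Γ(X, W)} {V' : Y.Opens} {hVV : V' ≤ V}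
    {hVW : V' ≤ f ⁻¹ᵁ W} {t t' : Γ(Y, V')} (ht : IsQuotientValue hV d x hVV hVW t)
    (ht' : IsQuotientValue hV d x hVV hVW t') : t = t' := by
  refine rs_ext_of_mem fun y hy => ?_
  obtain ⟨O, hOU, hOW, a, b, hyO, hab, hb⟩ := exists_fraction hU x (hV (hVV hy)) (hVW hy)
  refine ⟨V' ⊓ f ⁻¹ᵁ O, inf_le_left, ⟨hy, hyO⟩, ?_⟩
  have h1 := ht a b O hOU hOW hab (V' ⊓ f ⁻¹ᵁ O) inf_le_left inf_le_right
  have h2 := ht' a b O hOU hOW hab (V' ⊓ f ⁻¹ᵁ O) inf_le_left inf_le_right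
  rw [← h2] at h1
  have hb' := hb.map (pullRes f (inf_le_right : V' ⊓ f ⁻¹ᵁ O ≤ f ⁻¹ᵁ O))
  rw [pullRes_rs] at hb'
  exact hb'.mul_left_cancel (add_right_cancel h1)

include hU in
/-- The quotient rule for one fraction with invertible denominator implies it for all fractions. -/
theorem isQuotientValue_of_isUnit
    (hd : ∀ a b, d (a * b) = pullRes f hV a * d b + pullRes f hV b * d a)
    {W : X.Opens} {x : Γ(X, W)} {V' : Y.Opens} (hVV : V' ≤ V) (hVW : V' ≤ f ⁻¹ᵁ W)
    {O : X.Opens} (hOU : O ≤ U) (hOW : O ≤ W) (hVO : V' ≤ f ⁻¹ᵁ O) {a b : Γ(X, U)}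
    (hab : rs hOU b * rs hOW x = rs hOU a) (hb : IsUnit (rs hOU b)) {t : Γ(Y, V')}
    (ht : pullRes f (hVV.trans hV) b * t + pullRes f hVW x * rs hVV (d b) = rs hVV (d a)) :
    IsQuotientValue hV d x hVV hVW t := by
  intro a' b' O' hOU' hOW' hab' V'' h hVO'
  have hz : rs (inf_le_left.trans hOU : O ⊓ O' ≤ U) (b * a' - b' * a) = 0 := by
    have e1 := congrArg (rs (inf_le_left : O ⊓ O' ≤ O)) hab
    have e2 := congrArg (rs (inf_le_right : O ⊓ O' ≤ O')) hab'
    rw [map_mul, rs_rs, rs_rs, rs_rs] at e1 e2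
    rw [map_sub, map_mul, map_mul, ← e1, ← e2]
    ring
  have hdz := rs_derivation_eq_zero hU hV d hd _ hz (h.trans hVV)
    (le_inf (h.trans hVO) hVO')
  rw [map_sub, hd, hd, map_sub, map_add, map_add, map_mul, map_mul, map_mul, map_mul] at hdz
  simp only [rs_pullRes] at hdz
  have e1 := congrArg (pullRes f (h.trans hVO)) hab
  have e2 := congrArg (pullRes f hVO') hab'
  have e3 := congrArg (rs h) ht
  rw [map_mul] at e1 e2
  rw [map_add, map_mul, map_mul] at e3
  simp only [pullRes_rs, rs_pullRes, rs_rs] at e1 e2 e3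
  have hb' := hb.map (pullRes f (h.trans hVO))
  rw [pullRes_rs] at hb'
  refine hb'.mul_left_cancel ?_
  -- after multiplication by `b`, both sides agree because `d (b * a') = d (b' * a)`
  linear_combination (pullRes f (h.trans (hVV.trans hV)) b') * e3 - hdz +
    rs (h.trans hVV) (d b') * e1 - rs (h.trans hVV) (d b) * e2

include hU in
theorem exists_isQuotientValue
    (hd : ∀ a b, d (a * b) = pullRes f hV a * d b + pullRes f hV b * d a)
    (W : X.Opens) (x : Γ(X, W)) :
    ∃ t : Γ(Y, V ⊓ f ⁻¹ᵁ W), IsQuotientValue hV d x inf_le_left inf_le_right t := by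
  have H : ∀ y : (V ⊓ f ⁻¹ᵁ W : Y.Opens), ∃ (V' : Y.Opens) (h : V' ≤ V ⊓ f ⁻¹ᵁ W)
      (t : Γ(Y, V')), y.1 ∈ V' ∧
        IsQuotientValue hV d x (h.trans inf_le_left) (h.trans inf_le_right) t := by
    rintro ⟨y, hy⟩
    obtain ⟨O, hOU, hOW, a, b, hyO, hab, hb⟩ := exists_fraction hU x (hV hy.1) hy.2
    have h : V ⊓ f ⁻¹ᵁ O ≤ V ⊓ f ⁻¹ᵁ W := inf_le_inf_left V (f.preimage_mono hOW)
    have hb' := hb.map (pullRes f (inf_le_right : V ⊓ f ⁻¹ᵁ O ≤ f ⁻¹ᵁ O))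
    rw [pullRes_rs] at hb'
    obtain ⟨c, hc⟩ := hb'
    refine ⟨V ⊓ f ⁻¹ᵁ O, h, (c⁻¹ : Γ(Y, V ⊓ f ⁻¹ᵁ O)ˣ).1 * (rs inf_le_left (d a) -
      pullRes f (h.trans inf_le_right) x * rs inf_le_left (d b)), ⟨hy.1, hyO⟩, ?_⟩
    refine isQuotientValue_of_isUnit hU hd _ _ hOU hOW inf_le_right hab hb ?_
    rw [← hc, Units.mul_inv_cancel_left, sub_add_cancel]
  choose V' h t hy ht using H
  have hcov : V ⊓ f ⁻¹ᵁ W ≤ ⨆ y, V' y := fun y hyV => Opens.mem_iSup.2 ⟨⟨y, hyV⟩, hy _⟩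
  obtain ⟨s, hs⟩ := rs_glue V' h hcov t fun y y' => by
    have h1 := (ht y).res (inf_le_left : V' y ⊓ V' y' ≤ V' y) le_rfl
      (inf_le_left.trans ((h y).trans inf_le_right))
    have h2 := (ht y').res (inf_le_right : V' y ⊓ V' y' ≤ V' y') le_rfl
      (inf_le_right.trans ((h y').trans inf_le_right))
    exact h1.unique hU h2
  refine ⟨s, fun a b O hOU hOW hab V'' h'' hO => ?_⟩
  refine rs_ext (fun y => V'' ⊓ V' y) (fun _ => inf_le_left) (fun y hyV => ?_) fun y => ?_
  · obtain ⟨i, hi⟩ := Opens.mem_iSup.1 (hcov (h'' hyV))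
    exact Opens.mem_iSup.2 ⟨i, hyV, hi⟩
  · have := ht y a b O hOU hOW hab (V'' ⊓ V' y) inf_le_right (inf_le_left.trans hO)
    rw [← hs y, rs_rs] at this
    rw [map_add, map_mul, map_mul]
    simp only [rs_pullRes, rs_rs]
    exact this

include hU in
/-- A derivation of the functions on an affine open set `U` extends to the sheaf `𝒪_U`. The
condition on `S` reduces linearity over `𝒪_S` to linearity over the global functions of `S`. -/
theorem exists_isDerivationAlong (hS : ∀ O : S.Opens, O = ⊥ ∨ O = ⊤)
    (hd : ∀ a b, d (a * b) = pullRes f hV a * d b + pullRes f hV b * d a)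
    (hconst : ∀ c : Γ(S, ⊤), d (rs (show U ≤ p ⁻¹ᵁ ⊤ from le_top) (p.app ⊤ c)) = 0) :
    ∃ D : ∀ W : X.Opens, Γ(X, W) → Γ(Y, V ⊓ f ⁻¹ᵁ W), IsDerivationAlong f p V D ∧
      ∀ a, D U a = rs inf_le_left (d a) := by
  choose D hD using fun W => exists_isQuotientValue hU hd W (hV := hV)
  have hDU : ∀ a, D U a = rs inf_le_left (d a) := by
    intro a
    have := hD U a a 1 U le_rfl le_rfl (by rw [map_one, one_mul]) _ le_rfl inf_le_right
    have h1 : d 1 = 0 := by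
      have := hd 1 1
      rw [mul_one, map_one (pullRes f hV), one_mul] at this
      exact left_eq_add.1 this
    rw [h1, map_zero, mul_zero, add_zero, map_one, one_mul, rs_refl] at this
    exact this
  have hres : ∀ (W W' : X.Opens) (h : W' ≤ W) (x : Γ(X, W)),
      D W' (rs h x) = rs (inf_le_inf_left V (f.preimage_mono h)) (D W x) := by
    intro W W' h x
    exact (hD W' (rs h x)).unique hU
      ((hD W x).res (inf_le_inf_left V (f.preimage_mono h)) h inf_le_right)
  -- additivity and the Leibniz rule are checked on fractions
  have hfrac : ∀ (W : X.Opens) (x x' : Γ(X, W)), ∀ y ∈ V ⊓ f ⁻¹ᵁ W,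
      ∃ (O : X.Opens) (hOU : O ≤ U) (hOW : O ≤ W) (a a' b : Γ(X, U)), f y ∈ O ∧
        rs hOU b * rs hOW x = rs hOU a ∧ rs hOU b * rs hOW x' = rs hOU a' ∧
        IsUnit (rs hOU b) := by
    intro W x x' y hy
    obtain ⟨O, hOU, hOW, a, b, hyO, hab, hb⟩ := exists_fraction hU x (hV hy.1) hy.2
    obtain ⟨O', hOU', hOW', a', b', hyO', hab', hb'⟩ := exists_fraction hU x' (hV hy.1) hy.2
    refine ⟨O ⊓ O', inf_le_left.trans hOU, inf_le_left.trans hOW, a * b', a' * b, b * b',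
      ⟨hyO, hyO'⟩, ?_, ?_, ?_⟩
    · have := congrArg (rs (inf_le_left : O ⊓ O' ≤ O)) hab
      rw [map_mul, rs_rs, rs_rs, rs_rs] at this
      rw [map_mul, map_mul, ← this]; ring
    · have := congrArg (rs (inf_le_right : O ⊓ O' ≤ O')) hab'
      rw [map_mul, rs_rs, rs_rs, rs_rs] at this
      rw [map_mul, map_mul, ← this]; ring
    · rw [map_mul]
      have h1 := hb.map (rs (inf_le_left : O ⊓ O' ≤ O))
      have h2 := hb'.map (rs (inf_le_right : O ⊓ O' ≤ O'))
      rw [rs_rs] at h1 h2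
      exact h1.mul h2
  refine ⟨D, ⟨hres, ?_, ?_, ?_⟩, hDU⟩
  · intro W x x'
    refine rs_ext_of_mem fun y hy => ?_
    obtain ⟨O, hOU, hOW, a, a', b, hyO, hab, hab', hb⟩ := hfrac W x x' y hy
    have h : V ⊓ f ⁻¹ᵁ O ≤ V ⊓ f ⁻¹ᵁ W := inf_le_inf_left V (f.preimage_mono hOW)
    refine ⟨V ⊓ f ⁻¹ᵁ O, h, ⟨hy.1, hyO⟩, ?_⟩
    have e1 := hD W x a b O hOU hOW hab _ h inf_le_right
    have e2 := hD W x' a' b O hOU hOW hab' _ h inf_le_right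
    have e3 := hD W (x + x') (a + a') b O hOU hOW
      (by rw [map_add, map_add, mul_add, hab, hab']) _ h inf_le_right
    have hb' := hb.map (pullRes f (inf_le_right : V ⊓ f ⁻¹ᵁ O ≤ f ⁻¹ᵁ O))
    rw [pullRes_rs] at hb'
    refine hb'.mul_left_cancel ?_
    rw [map_add, map_add, map_add] at e3
    rw [map_add]
    linear_combination e3 - e1 - e2
  · intro W x x'
    refine rs_ext_of_mem fun y hy => ?_
    obtain ⟨O, hOU, hOW, a, a', b, hyO, hab, hab', hb⟩ := hfrac W x x' y hy
    have h : V ⊓ f ⁻¹ᵁ O ≤ V ⊓ f ⁻¹ᵁ W := inf_le_inf_left V (f.preimage_mono hOW)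
    have hO : V ⊓ f ⁻¹ᵁ O ≤ f ⁻¹ᵁ O := inf_le_right
    refine ⟨V ⊓ f ⁻¹ᵁ O, h, ⟨hy.1, hyO⟩, ?_⟩
    have e1 := hD W x a b O hOU hOW hab _ h inf_le_right
    have e2 := hD W x' a' b O hOU hOW hab' _ h inf_le_right
    have e3 := hD W (x * x') (a * a') (b * b) O hOU hOW
      (by rw [map_mul, map_mul, map_mul, ← hab, ← hab']; ring) _ h inf_le_right
    have e4 := congrArg (pullRes f hO) hab
    have e5 := congrArg (pullRes f hO) hab'
    have hb' := hb.map (pullRes f hO)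
    rw [pullRes_rs] at hb'
    refine (hb'.mul hb').mul_left_cancel ?_
    rw [hd, hd] at e3
    rw [map_mul] at e4 e5
    rw [map_add, map_mul, map_mul, pullSection_eq, pullSection_eq]
    simp only [map_add, map_mul, pullRes_rs, rs_pullRes] at e3 e4 e5 ⊢
    rw [← e4, ← e5, ← e1, ← e2] at e3
    linear_combination e3
  · intro O c
    obtain rfl | rfl := hS O
    · refine rs_ext_of_mem fun y hy => ?_
      exact hy.2.elim
    · have h1 := hres (p ⁻¹ᵁ ⊤) U (show U ≤ p ⁻¹ᵁ ⊤ from le_top) (p.app ⊤ c)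
      rw [hDU, hconst, map_zero] at h1
      exact rs_injective_of_le
        (inf_le_inf_left V (f.preimage_mono (show U ≤ p ⁻¹ᵁ ⊤ from le_top)))
        (le_inf inf_le_left (inf_le_left.trans hV)) (h1.symm.trans (map_zero _).symm)

end Extension

end AffineDerivations

/-! ### The kernel of the restriction of derivations to the ideal sheaf -/

section Descent

open TopologicalSpace Opposite

variable {S X Y : Scheme.{u}} {f : Y ⟶ X} {p : X ⟶ S}

/-- Functions on a closed subscheme extend locally to the ambient scheme. -/
theorem exists_app_eq [IsClosedImmersion f] {W : Y.Opens} (s : Γ(Y, W)) {y : Y} (hy : y ∈ W) :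
    ∃ (U : X.Opens) (hU : f ⁻¹ᵁ U ≤ W) (x : Γ(X, U)), f y ∈ U ∧ f.app U x = rs hU s := by
  obtain ⟨U₀, hU₀, hW⟩ := f.isClosedEmbedding.isOpen_iff.1 W.2
  have hyU : f y ∈ U₀ := by
    change y ∈ f ⁻¹' U₀
    rw [hW]; exact hy
  obtain ⟨_, ⟨U, hU, rfl⟩, hyU', hUU⟩ := X.isBasis_affineOpens.exists_subset_of_mem_open hyU hU₀
  have h : f ⁻¹ᵁ U ≤ W := fun z hz => by
    change z ∈ W.carrier
    rw [← hW]
    exact hUU hz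
  obtain ⟨x, hx⟩ := f.app_surjective U hU (rs h s)
  exact ⟨U, h, x, hyU', hx⟩

theorem IsDerivationAlong.eq_of_app_eq {V : Y.Opens}
    {D : ∀ U : X.Opens, Γ(X, U) → Γ(Y, V ⊓ f ⁻¹ᵁ U)} (hD : IsDerivationAlong f p V D)
    (h0 : ∀ (U : X.Opens), ∀ x ∈ idealSections f U, D U x = 0) {U : X.Opens} {x x' : Γ(X, U)}
    (h : f.app U x = f.app U x') : D U x = D U x' := by
  have h1 : x - x' ∈ idealSections f U := by
    rw [mem_idealSections, _root_.map_sub, h, sub_self]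
  have h2 := hD.map_add U (x - x') x'
  rwa [h0 U _ h1, zero_add, sub_add_cancel] at h2

/-- If `D` vanishes on the ideal sheaf, then its values at two lifts of a function on `Y` agree where
both are defined. -/
theorem IsDerivationAlong.rs_eq_of_app_eq {V : Y.Opens}
    {D : ∀ U : X.Opens, Γ(X, U) → Γ(Y, V ⊓ f ⁻¹ᵁ U)} (hD : IsDerivationAlong f p V D)
    (h0 : ∀ (U : X.Opens), ∀ x ∈ idealSections f U, D U x = 0) {W : Y.Opens} {s : Γ(Y, W)}
    {U U' : X.Opens} (hU : f ⁻¹ᵁ U ≤ W) (hU' : f ⁻¹ᵁ U' ≤ W) {x : Γ(X, U)} {x' : Γ(X, U')}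
    (h : f.app U x = rs hU s) (h' : f.app U' x' = rs hU' s) {V' : Y.Opens}
    (hV : V' ≤ V ⊓ f ⁻¹ᵁ U) (hV' : V' ≤ V ⊓ f ⁻¹ᵁ U') :
    rs hV (D U x) = rs hV' (D U' x') := by
  have h1 := hD.eq_of_app_eq h0 (U := U ⊓ U') (x := rs inf_le_left x) (x' := rs inf_le_right x')
    (by rw [app_rs, app_rs, h, h', rs_rs, rs_rs])
  rw [hD.map_res, hD.map_res] at h1
  have hle : V' ≤ V ⊓ f ⁻¹ᵁ (U ⊓ U') :=
    le_inf (hV.trans inf_le_left) (le_inf (hV.trans inf_le_right) (hV'.trans inf_le_right))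
  have h2 := congrArg (rs hle) h1
  rwa [rs_rs, rs_rs] at h2

/-- A derivation from `𝒪_X` to `𝒪_Y` that vanishes on the ideal sheaf of `Y` comes from a derivation
of `𝒪_Y`. -/
theorem IsDerivationAlong.exists_descent [IsClosedImmersion f] {V : Y.Opens}
    {D : ∀ U : X.Opens, Γ(X, U) → Γ(Y, V ⊓ f ⁻¹ᵁ U)} (hD : IsDerivationAlong f p V D)
    (h0 : ∀ (U : X.Opens), ∀ x ∈ idealSections f U, D U x = 0) :
    ∃ E : ∀ W : Y.Opens, Γ(Y, W) → Γ(Y, V ⊓ (𝟙 Y) ⁻¹ᵁ W), IsDerivationAlong (𝟙 Y) (f ≫ p) V E ∧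
      ∀ (U : X.Opens) (x : Γ(X, U)), E (f ⁻¹ᵁ U) (f.app U x) = D U x := by
  have H : ∀ (W : Y.Opens) (s : Γ(Y, W)), ∃ t : Γ(Y, V ⊓ W), ∀ (U : X.Opens) (hU : f ⁻¹ᵁ U ≤ W)
      (x : Γ(X, U)), f.app U x = rs hU s → rs (inf_le_inf_left V hU) t = D U x := by
    intro W s
    choose U hU x hyU hx using fun y : W => exists_app_eq (f := f) s y.2
    have hcov : V ⊓ W ≤ ⨆ y, V ⊓ f ⁻¹ᵁ (U y) := fun y hy =>
      Opens.mem_iSup.2 ⟨⟨y, hy.2⟩, hy.1, hyU ⟨y, hy.2⟩⟩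
    obtain ⟨t, ht⟩ := rs_glue (fun y => V ⊓ f ⁻¹ᵁ (U y)) (fun y => inf_le_inf_left V (hU y)) hcov
      (fun y => D (U y) (x y))
      (fun y y' => hD.rs_eq_of_app_eq h0 (hU y) (hU y') (hx y) (hx y') _ _)
    refine ⟨t, fun U' hU' x' hx' => ?_⟩
    refine rs_ext (fun y => (V ⊓ f ⁻¹ᵁ U') ⊓ (V ⊓ f ⁻¹ᵁ (U y))) (fun _ => inf_le_left)
      (fun y hy => ?_) fun y => ?_
    · obtain ⟨i, hi⟩ := Opens.mem_iSup.1 (hcov (inf_le_inf_left V hU' hy))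
      exact Opens.mem_iSup.2 ⟨i, hy, hi⟩
    · rw [hD.rs_eq_of_app_eq h0 hU' (hU y) hx' (hx y) inf_le_left inf_le_right, ← ht y, rs_rs,
        rs_rs]
  choose E hE using H
  have hloc : ∀ (W : Y.Opens) (s s' : Γ(Y, W)), ∀ y ∈ W, ∃ (U : X.Opens) (hU : f ⁻¹ᵁ U ≤ W)
      (x x' : Γ(X, U)), f y ∈ U ∧ f.app U x = rs hU s ∧ f.app U x' = rs hU s' := by
    intro W s s' y hy
    obtain ⟨U, hU, x, hyU, hx⟩ := exists_app_eq (f := f) s hy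
    obtain ⟨U', hU', x', hyU', hx'⟩ := exists_app_eq (f := f) s' hy
    refine ⟨U ⊓ U', (f.preimage_mono inf_le_left).trans hU, rs inf_le_left x, rs inf_le_right x',
      ⟨hyU, hyU'⟩, ?_, ?_⟩
    · rw [app_rs, hx, rs_rs]
    · rw [app_rs, hx', rs_rs]
  refine ⟨E, ⟨?_, ?_, ?_, ?_⟩, ?_⟩
  · intro W W' h s
    refine rs_ext_of_mem fun y hy => ?_
    obtain ⟨U, hU, x, hyU, hx⟩ := exists_app_eq (f := f) (rs h s) hy.2
    refine ⟨V ⊓ f ⁻¹ᵁ U, inf_le_inf_left V hU, ⟨hy.1, hyU⟩, ?_⟩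
    refine (hE W' (rs h s) U hU x hx).trans ?_
    rw [rs_rs] at hx
    exact (hE W s U (hU.trans h) x hx).symm.trans (rs_rs _ _ _).symm
  · intro W s s'
    refine rs_ext_of_mem fun y hy => ?_
    obtain ⟨U, hU, x, x', hyU, hx, hx'⟩ := hloc W s s' y hy.2
    refine ⟨V ⊓ f ⁻¹ᵁ U, inf_le_inf_left V hU, ⟨hy.1, hyU⟩, ?_⟩
    have h3 := hE W (s + s') U hU (x + x') (by rw [_root_.map_add, _root_.map_add, hx, hx'])
    rw [hD.map_add, ← hE W s U hU x hx, ← hE W s' U hU x' hx', ← _root_.map_add] at h3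
    exact h3
  · intro W s s'
    refine rs_ext_of_mem fun y hy => ?_
    obtain ⟨U, hU, x, x', hyU, hx, hx'⟩ := hloc W s s' y hy.2
    refine ⟨V ⊓ f ⁻¹ᵁ U, inf_le_inf_left V hU, ⟨hy.1, hyU⟩, ?_⟩
    have h3 := hE W (s * s') U hU (x * x') (by rw [map_mul, map_mul, hx, hx'])
    have e : ∀ (a : Γ(Y, W)) (b : Γ(X, U)), f.app U b = rs hU a →
        pullSection f V b = rs (inf_le_inf_left V hU) (rs (inf_le_right : V ⊓ W ≤ W) a) := by
      intro a b hab
      rw [rs_rs, pullSection, hab, rs_rs]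
    rw [hD.leibniz, ← hE W s U hU x hx, ← hE W s' U hU x' hx', e s x hx, e s' x' hx', ← map_mul,
      ← map_mul, ← _root_.map_add] at h3
    exact h3
  · intro O c
    have := hE (f ⁻¹ᵁ (p ⁻¹ᵁ O)) (f.app _ (p.app O c)) (p ⁻¹ᵁ O) le_rfl (p.app O c)
      (rs_refl _ _).symm
    rw [rs_refl, hD.map_const] at this
    exact this
  · intro U x
    have := hE (f ⁻¹ᵁ U) (f.app U x) U le_rfl x (rs_refl _ _).symm
    rwa [rs_refl] at this

theorem tangentToDerivations_injective [IsClosedImmersion f] (V : Y.Opens) :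
    Function.Injective ((tangentToDerivations f p).app V) := by
  intro E E' h
  have h' : ∀ (U : X.Opens) (x : Γ(X, U)), E.1 ⟨f ⁻¹ᵁ U, f.app U x⟩ = E'.1 ⟨f ⁻¹ᵁ U, f.app U x⟩ :=
    fun U x => congr_fun (congrArg Subtype.val h) ⟨U, x⟩
  have hE : IsDerivationAlong (𝟙 Y) (f ≫ p) V fun U x => E.1 ⟨U, x⟩ := E.2
  have hE' : IsDerivationAlong (𝟙 Y) (f ≫ p) V fun U x => E'.1 ⟨U, x⟩ := E'.2
  refine Subtype.ext (funext fun ⟨W, s⟩ => ?_)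
  refine rs_ext_of_mem fun y hy => ?_
  obtain ⟨U, hU, x, hyU, hx⟩ := exists_app_eq (f := f) s hy.2
  refine ⟨V ⊓ f ⁻¹ᵁ U, inf_le_inf_left V hU, ⟨hy.1, hyU⟩, ?_⟩
  have h1 := hE.map_res W (f ⁻¹ᵁ U) hU s
  have h2 := hE'.map_res W (f ⁻¹ᵁ U) hU s
  rw [← hx] at h1 h2
  exact h1.symm.trans ((h' U x).trans h2)

theorem exists_tangentToDerivations_eq [IsClosedImmersion f] {V : Y.Opens}
    (D : Γ(derivationSheaf f p, V)) (hD : (derivationsToNormal f p).app V D = 0) :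
    ∃ E : Γ(tangentSheaf (f ≫ p), V), (tangentToDerivations f p).app V E = D := by
  have h : IsDerivationAlong f p V fun U x => D.1 ⟨U, x⟩ := D.2
  obtain ⟨E, hE, hED⟩ := h.exists_descent fun U x hx =>
    congr_fun (congrArg Subtype.val hD) ⟨U, ⟨x, hx⟩⟩
  exact ⟨(⟨fun a => E a.1 a.2, hE⟩ : (derivations (𝟙 Y) (f ≫ p)).sections V),
    Subtype.ext (funext fun a => hED a.1 a.2)⟩

/-- A section of `𝒟er(f⁻¹𝒪_X, 𝒪_Y) → N_{Y/X}` splits the normal sequence. -/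
theorem nonempty_splitting [IsClosedImmersion f] [IsIso (restrictedTangentToDerivations f p)]
    (s : normalSheaf f ⟶ derivationSheaf f p) (hs : s ≫ derivationsToNormal f p = 𝟙 _) :
    Nonempty (normalSequence f p).Splitting := by
  have hs' : ∀ (V : Y.Opens) (φ : Γ(normalSheaf f, V)),
      (derivationsToNormal f p).app V (s.app V φ) = φ := fun V φ =>
    congrArg (fun a : normalSheaf f ⟶ normalSheaf f => a.app V φ) hs
  have H : ∀ (V : Y.Opens) (D : Γ(derivationSheaf f p, V)), ∃ E : Γ(tangentSheaf (f ≫ p), V),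
      (tangentToDerivations f p).app V E = D - s.app V ((derivationsToNormal f p).app V D) := by
    intro V D
    refine exists_tangentToDerivations_eq _ ?_
    rw [map_sub, hs', sub_self]
  choose r hr using H
  have hinj := tangentToDerivations_injective (f := f) (p := p)
  let R : derivationSheaf f p ⟶ tangentSheaf (f ≫ p) :=
    modulesHomMk (M := derivationSheaf f p) (M' := tangentSheaf (f ≫ p))
      (fun V => AddMonoidHom.mk' (r V) fun D D' => hinj V (by
        rw [map_add, hr, hr, hr, map_add, map_add]; abel))
      (fun {V V'} i D => hinj V' (by
        change (tangentToDerivations f p).app V' (r V' (mrs _ i.le D)) =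
          (tangentToDerivations f p).app V' (mrs _ i.le (r V D))
        rw [app_mrs, hr, hr, app_mrs, app_mrs, map_sub]))
      (fun V a D => hinj V (by
        change (tangentToDerivations f p).app V (r V (a • D)) =
          (tangentToDerivations f p).app V (a • r V D)
        rw [Scheme.Modules.Hom.app_smul, hr, hr, Scheme.Modules.Hom.app_smul,
          Scheme.Modules.Hom.app_smul, smul_sub]))
  have hR : R ≫ tangentToDerivations f p + derivationsToNormal f p ≫ s = 𝟙 _ := by
    refine Scheme.Modules.hom_ext _ _ fun V => ?_
    refine AddCommGrpCat.hom_ext (AddMonoidHom.ext fun D => ?_)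
    change (tangentToDerivations f p).app V (r V D) +
      s.app V ((derivationsToNormal f p).app V D) = D
    rw [hr, sub_add_cancel]
  have hTR : tangentToDerivations f p ≫ R = 𝟙 _ := by
    refine Scheme.Modules.hom_ext _ _ fun V => ?_
    refine AddCommGrpCat.hom_ext (AddMonoidHom.ext fun E => hinj V ?_)
    change (tangentToDerivations f p).app V (r V ((tangentToDerivations f p).app V E)) =
      (tangentToDerivations f p).app V E
    have h0 : (derivationsToNormal f p).app V ((tangentToDerivations f p).app V E) = 0 :=
      congrArg (fun a : tangentSheaf (f ≫ p) ⟶ normalSheaf f => a.app V E)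
        (tangentToDerivations_comp f p)
    rw [hr, h0, map_zero, sub_zero]
  let s' : normalSheaf f ⟶ (Scheme.Modules.pullback f).obj (tangentSheaf p) :=
    s ≫ inv (restrictedTangentToDerivations f p)
  exact ⟨{
    r := restrictedTangentToDerivations f p ≫ R
    s := s'
    f_r := by
      change (tangentToDerivations f p ≫ inv (restrictedTangentToDerivations f p)) ≫
        restrictedTangentToDerivations f p ≫ R = 𝟙 _
      rw [Category.assoc, IsIso.inv_hom_id_assoc, hTR]
    s_g := by
      change (s ≫ inv (restrictedTangentToDerivations f p)) ≫
        restrictedTangentToDerivations f p ≫ derivationsToNormal f p = 𝟙 _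
      rw [Category.assoc, IsIso.inv_hom_id_assoc, hs]
    id := by
      change (restrictedTangentToDerivations f p ≫ R) ≫ tangentToDerivations f p ≫
        inv (restrictedTangentToDerivations f p) + (restrictedTangentToDerivations f p ≫
        derivationsToNormal f p) ≫ s ≫ inv (restrictedTangentToDerivations f p) = 𝟙 _
      have := congrArg (fun a => restrictedTangentToDerivations f p ≫ a ≫
        inv (restrictedTangentToDerivations f p)) hR
      simpa only [Preadditive.comp_add, Preadditive.add_comp, Category.assoc, Category.id_comp,
        IsIso.hom_inv_id] using this }⟩

variable (f p) in
/-- A vector field `δ` on `X` which takes values in the ideal sheaf `ℐ` of `Y` and induces the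
identity on `ℐ/ℐ²` (as seen by the homomorphisms from `ℐ` to `𝒪_Y`). -/
structure IsEulerField (δ : ∀ U : X.Opens, Γ(X, U) → Γ(X, U)) : Prop where
  map_res : ∀ (U U' : X.Opens) (h : U' ≤ U) (x : Γ(X, U)), δ U' (rs h x) = rs h (δ U x)
  map_add : ∀ (U : X.Opens) (x y : Γ(X, U)), δ U (x + y) = δ U x + δ U y
  leibniz : ∀ (U : X.Opens) (x y : Γ(X, U)), δ U (x * y) = x * δ U y + y * δ U x
  map_const : ∀ (O : S.Opens) (c : Γ(S, O)), δ (p ⁻¹ᵁ O) (p.app O c) = 0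
  mem : ∀ (U : X.Opens) (x : Γ(X, U)), δ U x ∈ idealSections f U
  normal : ∀ (V : Y.Opens) (φ : ∀ U : X.Opens, idealSections f U → Γ(Y, V ⊓ f ⁻¹ᵁ U)),
    IsNormalHom f V φ → ∀ (U : X.Opens) (x : idealSections f U), φ U ⟨δ U x.1, mem U x.1⟩ = φ U x

theorem IsNormalHom.map_zero {V : Y.Opens}
    {φ : ∀ U : X.Opens, idealSections f U → Γ(Y, V ⊓ f ⁻¹ᵁ U)} (hφ : IsNormalHom f V φ)
    (U : X.Opens) : φ U 0 = 0 := by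
  have := hφ.map_add U 0 0
  rw [add_zero] at this
  exact left_eq_add.1 this

/-- If `δ` is an Euler field, then `φ ↦ φ ∘ δ` is a section of the restriction of derivations to the
ideal sheaf. -/
theorem IsEulerField.exists_section {δ : ∀ U : X.Opens, Γ(X, U) → Γ(X, U)}
    (hδ : IsEulerField f p δ) :
    ∃ s : normalSheaf f ⟶ derivationSheaf f p, s ≫ derivationsToNormal f p = 𝟙 _ := by
  have key : ∀ (V : Y.Opens) (φ : ∀ U : X.Opens, idealSections f U → Γ(Y, V ⊓ f ⁻¹ᵁ U)),
      IsNormalHom f V φ → IsDerivationAlong f p V fun U x => φ U ⟨δ U x, hδ.mem U x⟩ := by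
    intro V φ hφ
    refine ⟨fun U U' h x => ?_, fun U x y => ?_, fun U x y => ?_, fun O c => ?_⟩
    · rw [← hφ.map_res U U' h]
      congr 1
      exact Subtype.ext (hδ.map_res U U' h x)
    · rw [← hφ.map_add]
      congr 1
      exact Subtype.ext (hδ.map_add U x y)
    · rw [← hφ.map_smul, ← hφ.map_smul, ← hφ.map_add]
      congr 1
      exact Subtype.ext (hδ.leibniz U x y)
    · rw [← hφ.map_zero (p ⁻¹ᵁ O)]
      congr 1
      exact Subtype.ext (hδ.map_const O c)
  refine ⟨modulesHomMk (M := normalSheaf f) (M' := derivationSheaf f p)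
    (fun V =>
      { toFun := fun (s : (normalHoms f).sections V) =>
          (⟨fun a => s.1 ⟨a.1, ⟨δ a.1 a.2, hδ.mem a.1 a.2⟩⟩,
            key V (fun U x => s.1 ⟨U, x⟩) s.2⟩ : (derivations f p).sections V)
        map_zero' := rfl
        map_add' := fun _ _ => rfl })
    (fun _ _ => rfl) (fun _ _ _ => rfl), ?_⟩
  refine Scheme.Modules.hom_ext _ _ fun V => ?_
  refine AddCommGrpCat.hom_ext (AddMonoidHom.ext fun s => ?_)
  exact Subtype.ext (funext fun a => hδ.normal V (fun U x => s.1 ⟨U, x⟩) s.2 a.1 a.2)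

end Descent

/-! ### Affine semigroups with a smooth semigroup algebra -/

section Semigroups

open Polynomial

section LeadingTerm

variable {k : Type u} [Field k] {M : Type u} [AddCommGroup M] {S : AddSubmonoid M}
  {R B : Type u} [CommRing R] [CommRing B]

/-- The image of `χ^s` under `ψ : k[S] → B` is of the form `T X ^ d + …`, where `B` is a quotient of
`R[X]`, typically `R[X]/(X ^ n)`. -/
def HasLeadingTerm (π : R[X] →+* B) (ψ : AddMonoidAlgebra k S →+* B) (s : S) (d : ℕ) (T : R) :
    Prop :=
  ∃ r : R[X], ψ (.single s 1) = π (X ^ d * (C T + X * r))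

variable {π : R[X] →+* B} {ψ : AddMonoidAlgebra k S →+* B}

theorem HasLeadingTerm.zero : HasLeadingTerm π ψ 0 0 1 :=
  ⟨0, by rw [← AddMonoidAlgebra.one_def, map_one]; simp⟩

theorem HasLeadingTerm.add {s s' : S} {d d' : ℕ} {T T' : R}
    (h : HasLeadingTerm π ψ s d T) (h' : HasLeadingTerm π ψ s' d' T') :
    HasLeadingTerm π ψ (s + s') (d + d') (T * T') := by
  obtain ⟨r, hr⟩ := h
  obtain ⟨r', hr'⟩ := h'
  refine ⟨r * C T' + C T * r' + X * r * r', ?_⟩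
  have : (.single (s + s') 1 : AddMonoidAlgebra k S) = .single s 1 * .single s' 1 := by
    rw [AddMonoidAlgebra.single_mul_single, mul_one]
  rw [this, map_mul, hr, hr', ← map_mul, C_mul]
  congr 1
  ring

theorem HasLeadingTerm.nsmul {s : S} {d : ℕ} {T : R}
    (h : HasLeadingTerm π ψ s d T) (e : ℕ) : HasLeadingTerm π ψ (e • s) (e * d) (T ^ e) := by
  induction e with
  | zero => simpa using HasLeadingTerm.zero
  | succ e ih =>
    rw [succ_nsmul, add_mul, one_mul, pow_succ]
    exact ih.add h

theorem HasLeadingTerm.sum {ι : Type*} (F : Finset ι) {s : ι → S} {d : ι → ℕ}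
    {T : ι → R} (h : ∀ i, HasLeadingTerm π ψ (s i) (d i) (T i)) :
    HasLeadingTerm π ψ (∑ i ∈ F, s i) (∑ i ∈ F, d i) (∏ i ∈ F, T i) := by
  classical
  induction F using Finset.induction_on with
  | empty => simpa using HasLeadingTerm.zero
  | insert a F ha ih =>
    rw [Finset.sum_insert ha, Finset.sum_insert ha, Finset.prod_insert ha]
    exact (h a).add ih

theorem HasLeadingTerm.eq_zero_of_lt {n : ℕ} (hπ : ∀ P, π P = 0 → X ^ n ∣ P) {s : S} {d d' : ℕ}
    {T T' : R} (h : HasLeadingTerm π ψ s d T) (h' : HasLeadingTerm π ψ s d' T') (hd : d < n)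
    (hdd : d < d') : T = 0 := by
  obtain ⟨r, hr⟩ := h
  obtain ⟨r', hr'⟩ := h'
  rw [hr, ← sub_eq_zero, ← map_sub] at hr'
  have := X_pow_dvd_iff.1 (hπ _ hr') d hd
  rw [coeff_sub, coeff_X_pow_mul', coeff_X_pow_mul', if_pos le_rfl, if_neg (not_le.2 hdd)] at this
  simpa using this

theorem HasLeadingTerm.eq {n : ℕ} (hπ : ∀ P, π P = 0 → X ^ n ∣ P) {s : S} {d : ℕ} {T T' : R}
    (h : HasLeadingTerm π ψ s d T) (h' : HasLeadingTerm π ψ s d T') (hd : d < n) : T = T' := by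
  obtain ⟨r, hr⟩ := h
  obtain ⟨r', hr'⟩ := h'
  rw [hr, ← sub_eq_zero, ← map_sub] at hr'
  simpa [coeff_X_pow_mul', sub_eq_zero] using X_pow_dvd_iff.1 (hπ _ hr') d hd

end LeadingTerm

variable {M : Type u} [AddCommGroup M] (S : AddSubmonoid M)

/-- The group of units of a semigroup `S` in a lattice. -/
def unitSubgroup : Submodule ℤ M := AddSubgroup.toIntSubmodule
  { carrier := {m | m ∈ S ∧ -m ∈ S}
    zero_mem' := ⟨zero_mem S, by rw [neg_zero]; exact zero_mem S⟩
    add_mem' := fun ha hb => ⟨add_mem ha.1 hb.1, by rw [neg_add]; exact add_mem ha.2 hb.2⟩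
    neg_mem' := fun ha => ⟨ha.2, by rw [neg_neg]; exact ha.1⟩ }

/-- The irreducible elements of a semigroup `S` in a lattice. -/
structure IsIrreducibleIn (m : M) : Prop where
  mem : m ∈ S
  neg_notMem : -m ∉ S
  isUnit_or : ∀ a ∈ S, ∀ b ∈ S, m = a + b → -a ∈ S ∨ -b ∈ S

/-- The classes of the irreducible elements of `S` modulo units. -/
abbrev IrreducibleClass : Type u :=
  {q : M ⧸ unitSubgroup S // ∃ m, IsIrreducibleIn S m ∧ (unitSubgroup S).mkQ m = q}

variable {S}

theorem IsIrreducibleIn.add_unit {m u : M} (hm : IsIrreducibleIn S m) (hu : u ∈ S)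
    (hu' : -u ∈ S) : IsIrreducibleIn S (m + u) where
  mem := add_mem hm.mem hu
  neg_notMem h := hm.neg_notMem (by
    have := add_mem h hu
    rwa [neg_add, neg_add_cancel_right] at this)
  isUnit_or a ha b hb hab := by
    rcases hm.isUnit_or a ha (b + -u) (add_mem hb hu') (by
      rw [← add_assoc, ← hab, add_neg_cancel_right]) with h | h
    · exact Or.inl h
    · refine Or.inr ?_
      have := add_mem h hu'
      rwa [neg_add, neg_neg, add_assoc, add_neg_cancel, add_zero] at this

theorem isIrreducibleIn_add_unit_iff {m u : M} (hu : u ∈ S) (hu' : -u ∈ S) :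
    IsIrreducibleIn S (m + u) ↔ IsIrreducibleIn S m :=
  ⟨fun h => by
    have := h.add_unit hu' (by rwa [neg_neg])
    rwa [add_neg_cancel_right] at this, fun h => h.add_unit hu hu'⟩

section

variable (k : Type u) [Field k]

open Classical in
/-- The first order deformation `χ^m ↦ 1` for units `m`, `χ^m ↦ t_q x` for irreducible elements `m` of
class `q`, and `χ^m ↦ 0` otherwise, where `x ^ 2 = 0`. -/
noncomputable def deformationFun {B : Type u} [CommRing B] (t : IrreducibleClass S → B) (x : B)
    (m : S) : B :=
  if -m.1 ∈ S then 1 else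
    if h : IsIrreducibleIn S m.1 then t ⟨(unitSubgroup S).mkQ m.1, m.1, h, rfl⟩ * x else 0

theorem deformationFun_unit_add {B : Type u} [CommRing B] (t : IrreducibleClass S → B) (x : B)
    (u m : S) (hu : -u.1 ∈ S) : deformationFun t x (m + u) = deformationFun t x m := by
  have h1 : -(m + u).1 ∈ S ↔ -m.1 ∈ S := by
    refine ⟨fun h => ?_, fun h => ?_⟩
    · have := add_mem h u.2
      rwa [AddSubmonoid.coe_add, neg_add, neg_add_cancel_right] at this
    · rw [AddSubmonoid.coe_add, neg_add]
      exact add_mem h hu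
  have h2 : IsIrreducibleIn S (m + u).1 ↔ IsIrreducibleIn S m.1 :=
    isIrreducibleIn_add_unit_iff u.2 hu
  have h3 : (unitSubgroup S).mkQ (m + u).1 = (unitSubgroup S).mkQ m.1 := by
    rw [AddSubmonoid.coe_add, map_add, add_eq_left]
    exact (Submodule.Quotient.mk_eq_zero _).2 ⟨u.2, hu⟩
  unfold deformationFun
  by_cases hm : -m.1 ∈ S
  · rw [if_pos hm, if_pos (h1.2 hm)]
  rw [if_neg hm, if_neg (mt h1.1 hm)]
  by_cases hi : IsIrreducibleIn S m.1
  · rw [dif_pos hi, dif_pos (h2.2 hi)]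
    congr 2
    exact Subtype.ext h3
  · rw [dif_neg hi, dif_neg (mt h2.1 hi)]

theorem deformationFun_add {B : Type u} [CommRing B] (t : IrreducibleClass S → B) {x : B}
    (hx : x * x = 0) (m m' : S) :
    deformationFun t x (m + m') = deformationFun t x m * deformationFun t x m' := by
  by_cases hm : -m.1 ∈ S
  · rw [add_comm, deformationFun_unit_add t x m m' hm]
    conv_rhs => rw [deformationFun, if_pos hm, one_mul]
  by_cases hm' : -m'.1 ∈ S
  · rw [deformationFun_unit_add t x m' m hm']
    conv_rhs => rw [mul_comm, deformationFun, if_pos hm', one_mul]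
  have h1 : ¬ -(m + m').1 ∈ S := fun h => hm (by
    have := add_mem h m'.2
    rwa [AddSubmonoid.coe_add, neg_add, neg_add_cancel_right] at this)
  have h2 : ¬ IsIrreducibleIn S (m + m').1 := fun h =>
    (h.isUnit_or m.1 m.2 m'.1 m'.2 rfl).elim hm hm'
  have h3 : ∀ s : S, -s.1 ∉ S → ∃ b, deformationFun t x s = b * x := by
    intro s hs
    unfold deformationFun
    rw [if_neg hs]
    split_ifs
    · exact ⟨_, rfl⟩
    · exact ⟨0, (zero_mul _).symm⟩
  obtain ⟨b, hb⟩ := h3 m hm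
  obtain ⟨b', hb'⟩ := h3 m' hm'
  rw [hb, hb', mul_mul_mul_comm, hx, mul_zero, deformationFun, if_neg h1, dif_neg h2]

/-- If `k[S]` is formally smooth, then the first order deformation lifts to all orders. -/
theorem exists_deformation [Algebra.FormallySmooth k (AddMonoidAlgebra k S)]
    {B : Type u} [CommRing B] [Algebra k B] {π : (MvPolynomial (IrreducibleClass S) k)[X] →+* B}
    (hπ : Function.Surjective π) {n : ℕ} (hn : π X ^ n = 0) :
    ∃ ψ : AddMonoidAlgebra k S →ₐ[k] B,
      (∀ u : S, -u.1 ∈ S → HasLeadingTerm π ψ.toRingHom u 0 1) ∧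
      ∀ (m : S) (h : IsIrreducibleIn S m.1),
        HasLeadingTerm π ψ.toRingHom m 1 (.X ⟨(unitSubgroup S).mkQ m.1, m.1, h, rfl⟩) := by
  let J : Ideal B := Ideal.span {π X ^ 2}
  have hJ : IsNilpotent J := by
    refine ⟨n, ?_⟩
    rw [Ideal.span_singleton_pow, ← pow_mul, mul_comm, pow_mul, hn, zero_pow two_ne_zero]
    exact Ideal.span_singleton_zero
  let π' : B →+* B ⧸ J := Ideal.Quotient.mk J
  let t : IrreducibleClass S → B ⧸ J := fun q => π' (π (C (.X q)))
  have hx : π' (π X) * π' (π X) = 0 := by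
    rw [← map_mul, ← pow_two]
    exact Ideal.Quotient.eq_zero_iff_mem.2 (Ideal.mem_span_singleton_self _)
  obtain ⟨ψ, hψ⟩ := Algebra.FormallySmooth.exists_lift J hJ
    (AddMonoidAlgebra.lift k (B ⧸ J) S
      { toFun := fun m => deformationFun t (π' (π X)) m.toAdd
        map_one' := by
          change deformationFun t _ 0 = 1
          rw [deformationFun, if_pos]
          simp
        map_mul' := fun m m' => deformationFun_add t hx _ _ })
  have hψ' : ∀ m : S, π' (ψ (.single m 1)) = deformationFun t (π' (π X)) m := by
    intro m
    have := congrArg (fun g : AddMonoidAlgebra k S →ₐ[k] B ⧸ J => g (.single m 1)) hψ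
    simpa using this
  -- a congruence modulo `X ^ 2` is an equation with a correction term
  have key : ∀ (m : S) (b : (MvPolynomial (IrreducibleClass S) k)[X]),
      π' (ψ (.single m 1)) = π' (π b) → ∃ r, ψ (.single m 1) = π (b + X ^ 2 * r) := by
    intro m b hb
    obtain ⟨c, hc⟩ := Ideal.mem_span_singleton.1 (Ideal.Quotient.eq.1 hb)
    obtain ⟨r, rfl⟩ := hπ c
    refine ⟨r, ?_⟩
    rw [map_add, map_mul, map_pow, ← sub_eq_iff_eq_add', hc]
  refine ⟨ψ, fun u hu => ?_, fun m hm => ?_⟩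
  · obtain ⟨r, hr⟩ := key u 1 (by
      rw [hψ', deformationFun, if_pos hu, map_one, map_one])
    refine ⟨X * r, hr.trans ?_⟩
    congr 1
    simp only [map_one]; ring
  · obtain ⟨r, hr⟩ := key m (C (.X ⟨(unitSubgroup S).mkQ m.1, m.1, hm, rfl⟩) * X) (by
      rw [hψ', deformationFun, if_neg hm.neg_notMem, dif_pos hm, map_mul, map_mul])
    refine ⟨r, hr.trans ?_⟩
    congr 1
    ring

theorem exists_truncation (R : Type u) [CommRing R] [Algebra k R] (n : ℕ) :
    ∃ (B : Type u) (_ : CommRing B) (_ : Algebra k B) (π : R[X] →+* B), Function.Surjective π ∧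
      π X ^ n = 0 ∧ ∀ P, π P = 0 → X ^ n ∣ P :=
  ⟨R[X] ⧸ Ideal.span {(X : R[X]) ^ n}, inferInstance, inferInstance, Ideal.Quotient.mk _,
    Ideal.Quotient.mk_surjective, by
      rw [← map_pow]
      exact Ideal.Quotient.eq_zero_iff_mem.2 (Ideal.mem_span_singleton_self _),
    fun _ hP => Ideal.mem_span_singleton.1 (Ideal.Quotient.eq_zero_iff_mem.1 hP)⟩

/-- If `k[S]` is formally smooth, then the irreducible elements of `S` are linearly independent modulo
units: a relation between them contradicts the existence of deformations with independent leading
coefficients. -/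
theorem linearIndependent_irreducibleClass [Algebra.FormallySmooth k (AddMonoidAlgebra k S)] :
    LinearIndependent ℤ (Subtype.val : IrreducibleClass S → M ⧸ unitSubgroup S) := by
  classical
  rw [linearIndependent_iff]
  intro l hl
  choose m hm hmq using fun q : IrreducibleClass S => q.2
  let a : IrreducibleClass S → ℕ := fun q => (l q).toNat
  let b : IrreducibleClass S → ℕ := fun q => (-l q).toNat
  have hab : ∀ q, l q = a q - b q := fun q => by simp only [a, b]; omega
  let s : IrreducibleClass S → S := fun q => ⟨m q, (hm q).mem⟩
  obtain ⟨n, hna, hnb⟩ : ∃ n, ∑ q ∈ l.support, a q * 1 < n ∧ ∑ q ∈ l.support, b q * 1 < n :=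
    ⟨(∑ q ∈ l.support, a q * 1) + (∑ q ∈ l.support, b q * 1) + 1, by omega, by omega⟩
  obtain ⟨B, _, _, π, hπs, hπn, hπ⟩ :=
    exists_truncation k (MvPolynomial (IrreducibleClass S) k) n
  obtain ⟨ψ, hψ0, hψ1⟩ := exists_deformation k hπs hπn
  have hψs : ∀ q, HasLeadingTerm π ψ.toRingHom (s q) 1 (MvPolynomial.X q) := fun q => by
    have := hψ1 (s q) (hm q)
    have e : (⟨(unitSubgroup S).mkQ (s q).1, (s q).1, hm q, rfl⟩ : IrreducibleClass S) = q :=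
      Subtype.ext (hmq q)
    rwa [e] at this
  have hu : (∑ q ∈ l.support, a q • m q) - ∑ q ∈ l.support, b q • m q ∈ unitSubgroup S := by
    rw [← Submodule.Quotient.mk_eq_zero, ← Submodule.mkQ_apply, ← hl, map_sub, map_sum, map_sum,
      Finsupp.linearCombination_apply, Finsupp.sum, ← Finset.sum_sub_distrib]
    refine Finset.sum_congr rfl fun q _ => ?_
    rw [map_nsmul, map_nsmul, hmq, hab, sub_smul, natCast_zsmul, natCast_zsmul]
  let u : S := ⟨_, hu.1⟩
  have hsum : ∑ q ∈ l.support, a q • s q = (∑ q ∈ l.support, b q • s q) + u := by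
    refine Subtype.ext ?_
    simp [u, s]
  have h1 := HasLeadingTerm.sum l.support (fun q => (hψs q).nsmul (a q))
  have h2 := (HasLeadingTerm.sum l.support (fun q => (hψs q).nsmul (b q))).add (hψ0 u hu.2)
  rw [← hsum, mul_one, add_zero] at h2
  have hne : ∀ c : IrreducibleClass S → ℕ,
      ∏ q ∈ l.support, (MvPolynomial.X q : MvPolynomial (IrreducibleClass S) k) ^ c q ≠ 0 :=
    fun c => Finset.prod_ne_zero_iff.2 fun q _ => pow_ne_zero _ (MvPolynomial.X_ne_zero q)
  have hprod : ∀ c : IrreducibleClass S → ℕ,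
      ∏ q ∈ l.support, (MvPolynomial.X q : MvPolynomial (IrreducibleClass S) k) ^ c q =
        MvPolynomial.monomial (∑ q ∈ l.support, Finsupp.single q (c q)) 1 := fun c => by
    rw [MvPolynomial.monomial_sum_one]
    exact Finset.prod_congr rfl fun q _ => MvPolynomial.X_pow_eq_monomial
  have hT : ∏ q ∈ l.support, (MvPolynomial.X q : MvPolynomial (IrreducibleClass S) k) ^ a q =
      ∏ q ∈ l.support, MvPolynomial.X q ^ b q := by
    rcases lt_trichotomy (∑ q ∈ l.support, a q * 1) (∑ q ∈ l.support, b q * 1) with h | h | h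
    · exact absurd (h1.eq_zero_of_lt hπ h2 hna h) (hne a)
    · rw [← h] at h2
      exact h1.eq hπ h2 hna
    · exact absurd (h2.eq_zero_of_lt hπ h1 hnb h) (hne b)
  rw [hprod, hprod] at hT
  have hT' := MvPolynomial.monomial_left_injective one_ne_zero hT
  ext q
  by_cases hq : q ∈ l.support
  · have := DFunLike.congr_fun hT' q
    simp only [Finsupp.finsetSum_apply, Finsupp.single_apply] at this
    rw [Finset.sum_ite_eq', Finset.sum_ite_eq', if_pos hq, if_pos hq] at this
    rw [hab, this, sub_self, Finsupp.zero_apply]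
  · exact Finsupp.notMem_support_iff.1 hq

end

/-- If the units are detected by a degree, then `S` is generated by its units and its irreducible
elements. -/
theorem mkQ_mem_closure (deg : M →+ ℤ) (hdeg : ∀ m ∈ S, 0 ≤ deg m)
    (hdeg0 : ∀ m ∈ S, deg m = 0 → -m ∈ S) {m : M} (hm : m ∈ S) :
    (unitSubgroup S).mkQ m ∈ AddSubmonoid.closure
      (Set.range (Subtype.val : IrreducibleClass S → M ⧸ unitSubgroup S)) := by
  induction h : (deg m).toNat using Nat.strong_induction_on generalizing m with
  | _ n ih =>
    by_cases hu : -m ∈ S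
    · have : (unitSubgroup S).mkQ m = 0 := (Submodule.Quotient.mk_eq_zero _).2 ⟨hm, hu⟩
      rw [this]; exact zero_mem _
    by_cases hi : IsIrreducibleIn S m
    · exact AddSubmonoid.subset_closure ⟨⟨_, m, hi, rfl⟩, rfl⟩
    have : ∃ a ∈ S, ∃ b ∈ S, m = a + b ∧ -a ∉ S ∧ -b ∉ S := by
      by_contra H
      push Not at H
      refine hi ⟨hm, hu, fun a ha b hb hab => ?_⟩
      by_contra! hab'
      exact hab'.2 (H a ha b hb hab hab'.1)
    obtain ⟨a, ha, b, hb, rfl, ha', hb'⟩ := this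
    have h1 : 0 < deg a := lt_of_le_of_ne (hdeg a ha) fun e => ha' (hdeg0 a ha e.symm)
    have h2 : 0 < deg b := lt_of_le_of_ne (hdeg b hb) fun e => hb' (hdeg0 b hb e.symm)
    rw [map_add] at h
    rw [map_add]
    exact add_mem (ih _ (by omega) ha rfl) (ih _ (by omega) hb rfl)

/-- A semigroup with units detected by a degree which generates the lattice `M` and has a formally
smooth semigroup algebra is given by the nonnegativity of some coordinates of a basis of `M`. -/
theorem exists_basis_of_formallySmooth (k : Type u) [Field k] [Module.Free ℤ M]
    [Module.Finite ℤ M] [Algebra.FormallySmooth k (AddMonoidAlgebra k S)] (deg : M →+ ℤ)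
    (hdeg : ∀ m ∈ S, 0 ≤ deg m) (hdeg0 : ∀ m ∈ S, deg m = 0 → -m ∈ S)
    (hgen : ∀ m : M, ∃ a ∈ S, ∃ b ∈ S, m = a - b) :
    ∃ (ι : Type u) (_ : Fintype ι) (b : Module.Basis ι ℤ M) (J : Set ι),
      ∀ m, m ∈ S ↔ ∀ j ∈ J, 0 ≤ b.repr m j := by
  have hspan : ⊤ ≤ Submodule.span ℤ
      (Set.range (Subtype.val : IrreducibleClass S → M ⧸ unitSubgroup S)) := by
    rintro q -
    obtain ⟨m, rfl⟩ := (unitSubgroup S).mkQ_surjective q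
    obtain ⟨a, ha, b, hb, rfl⟩ := hgen m
    have hle : AddSubmonoid.closure (Set.range
        (Subtype.val : IrreducibleClass S → M ⧸ unitSubgroup S)) ≤
        (Submodule.span ℤ (Set.range Subtype.val)).toAddSubmonoid :=
      AddSubmonoid.closure_le.2 Submodule.subset_span
    rw [map_sub]
    exact sub_mem (hle (mkQ_mem_closure deg hdeg hdeg0 ha))
      (hle (mkQ_mem_closure deg hdeg hdeg0 hb))
  let bQ := Module.Basis.mk (linearIndependent_irreducibleClass k (S := S)) hspan
  let bU := Module.Free.chooseBasis ℤ (unitSubgroup S)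
  have hbQ : ∀ q, bQ q = q.1 := fun q => Module.Basis.mk_apply _ _ q
  have hmem : ∀ m, m ∈ S ↔ ∀ q, 0 ≤ bQ.repr ((unitSubgroup S).mkQ m) q := by
    intro m
    constructor
    · intro hm
      have := mkQ_mem_closure deg hdeg hdeg0 hm
      generalize (unitSubgroup S).mkQ m = x at this
      induction this using AddSubmonoid.closure_induction with
      | mem x hx =>
        obtain ⟨q, rfl⟩ := hx
        intro q'
        classical
        rw [← hbQ, Module.Basis.repr_self, Finsupp.single_apply]
        split_ifs <;> simp
      | zero => intro q; rw [map_zero]; rfl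
      | add x y _ _ hx hy =>
        intro q
        rw [map_add, Finsupp.add_apply]
        exact add_nonneg (hx q) (hy q)
    · intro h
      have key : ∃ s ∈ S, (unitSubgroup S).mkQ s = (unitSubgroup S).mkQ m := by
        choose r hr hrq using fun q : IrreducibleClass S => q.2
        refine ⟨∑ q ∈ (bQ.repr ((unitSubgroup S).mkQ m)).support,
          (bQ.repr ((unitSubgroup S).mkQ m) q).toNat • r q,
          sum_mem fun q _ => nsmul_mem (hr q).mem _, ?_⟩
        rw [map_sum]
        conv_rhs => rw [← bQ.linearCombination_repr ((unitSubgroup S).mkQ m),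
          Finsupp.linearCombination_apply, Finsupp.sum]
        refine Finset.sum_congr rfl fun q _ => ?_
        rw [map_nsmul, hrq, hbQ, ← natCast_zsmul, Int.toNat_of_nonneg (h q)]
      obtain ⟨s, hs, hsm⟩ := key
      have : m - s ∈ unitSubgroup S := by
        rw [← Submodule.Quotient.mk_eq_zero, ← Submodule.mkQ_apply, map_sub, hsm, sub_self]
      have := add_mem hs this.1
      rwa [add_sub_cancel] at this
  let b := bU.sumQuot bQ
  have : Finite (Module.Free.ChooseBasisIndex ℤ (unitSubgroup S) ⊕ IrreducibleClass S) :=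
    Module.Finite.finite_basis b
  refine ⟨_, Fintype.ofFinite _, b, Set.range Sum.inr, fun m => (hmem m).trans ?_⟩
  constructor
  · rintro h _ ⟨q, rfl⟩
    rw [Module.Basis.sumQuot_repr_inr]
    exact h q
  · intro h q
    have := h _ ⟨q, rfl⟩
    rwa [Module.Basis.sumQuot_repr_inr] at this

end Semigroups

/-! ### Rational cones and their semigroups -/

section Cones

variable {N : Type u} [AddCommGroup N]

theorem mem_dualMonoid_latticeCone {G : Finset N} {m : Module.Dual ℤ N} :
    m ∈ dualMonoid (latticeCone (G : Set N)) ↔ ∀ v ∈ G, 0 ≤ m v := by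
  constructor
  · intro h v hv
    have := h _ (Submodule.subset_span ⟨v, hv, rfl⟩)
    rw [pairing_tmul, mul_one] at this
    exact_mod_cast this
  · intro h x hx
    obtain ⟨c, hc, rfl⟩ := mem_latticeCone_iff.1 hx
    rw [map_sum]
    refine Finset.sum_nonneg fun v hv => ?_
    rw [map_smul, smul_eq_mul, pairing_tmul, mul_one]
    exact mul_nonneg (hc v) (by exact_mod_cast h v hv)

/-- The sum of the generators of a rational cone defines a degree on its semigroup which detects the
units. -/
theorem exists_degree {σ : PointedCone ℝ (ℝ ⊗[ℤ] N)}
    (hσ : ∃ G : Finset N, σ = latticeCone (G : Set N)) :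
    ∃ deg : Module.Dual ℤ N →+ ℤ, (∀ m ∈ dualMonoid σ, 0 ≤ deg m) ∧
      ∀ m ∈ dualMonoid σ, deg m = 0 → -m ∈ dualMonoid σ := by
  obtain ⟨G, rfl⟩ := hσ
  refine ⟨AddMonoidHom.mk' (fun m => ∑ v ∈ G, m v) fun m m' => by
    simp [Finset.sum_add_distrib], fun m hm => ?_, fun m hm h => ?_⟩
  · exact Finset.sum_nonneg (mem_dualMonoid_latticeCone.1 hm)
  · refine mem_dualMonoid_latticeCone.2 fun v hv => ?_
    have := (Finset.sum_eq_zero_iff_of_nonneg (mem_dualMonoid_latticeCone.1 hm)).1 h v hv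
    simp [this]

/-- The vertex of a strongly convex cone is a face. -/
theorem bot_isFaceOf {σ : PointedCone ℝ (ℝ ⊗[ℤ] N)}
    (hσ : ∀ L : Submodule ℝ (ℝ ⊗[ℤ] N), (L : Set (ℝ ⊗[ℤ] N)) ⊆ σ → L = ⊥) :
    (⊥ : PointedCone ℝ (ℝ ⊗[ℤ] N)).IsFaceOf σ where
  le := bot_le
  mem_of_smul_add_mem := by
    intro x y a hx hy ha h
    have hxy : a • x + y = 0 := h
    have hneg : -x ∈ σ := by
      have e : -x = a⁻¹ • y := by
        rw [eq_comm, inv_smul_eq_iff₀ ha.ne', smul_neg]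
        exact eq_neg_of_add_eq_zero_right hxy
      rw [e]
      exact PointedCone.smul_mem _ (inv_nonneg.2 ha.le) hy
    have hL := hσ (Submodule.span ℝ {x}) (by
      intro z hz
      obtain ⟨r, rfl⟩ := Submodule.mem_span_singleton.1 hz
      rcases le_total 0 r with hr | hr
      · exact PointedCone.smul_mem _ hr hx
      · have := PointedCone.smul_mem σ (neg_nonneg.2 hr) hneg
        rwa [smul_neg, neg_smul, neg_neg] at this)
    have : x ∈ Submodule.span ℝ {x} := Submodule.mem_span_singleton_self x
    rw [hL] at this
    exact this

/-- The semigroup of a strongly convex cone generates the lattice `M`. -/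
theorem exists_eq_sub [Module.Free ℤ N] [Module.Finite ℤ N] {σ : PointedCone ℝ (ℝ ⊗[ℤ] N)}
    (hσ : IsStronglyConvexRational σ) (m : Module.Dual ℤ N) :
    ∃ a ∈ dualMonoid σ, ∃ b ∈ dualMonoid σ, m = a - b := by
  have hface := bot_isFaceOf hσ.stronglyConvex
  obtain ⟨m₀, hm₀⟩ := exists_exposes hσ.rational hface
  obtain ⟨n, hn⟩ := (hm₀.localization hσ.rational bot_le).2 m (by
    intro x hx
    have : x = 0 := hx
    rw [this, map_zero])
  exact ⟨_, hn, _, nsmul_mem hm₀.1 n, (add_sub_cancel_right _ _).symm⟩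

end Cones

/-! ### Semigroup algebras of regular cones -/

section RegularSemigroups

variable {M : Type u} [AddCommGroup M] {S : AddSubmonoid M} {ι : Type u}
  {b : Module.Basis ι ℤ M} {J : Set ι}

section

variable (hS : ∀ m, m ∈ S ↔ ∀ j ∈ J, 0 ≤ b.repr m j)
include hS

theorem basis_mem (i : ι) : b i ∈ S := by
  classical
  refine (hS _).2 fun j _ => ?_
  rw [b.repr_self, Finsupp.single_apply]
  split_ifs <;> simp

theorem neg_basis_mem {i : ι} (hi : i ∉ J) : -b i ∈ S := by
  classical
  refine (hS _).2 fun j hj => ?_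
  rw [map_neg, b.repr_self, Finsupp.neg_apply, Finsupp.single_apply, if_neg]
  · simp
  · rintro rfl; exact hi hj

theorem le_of_basis_mem [Fintype ι] {P : AddSubmonoid M} (h : ∀ i, b i ∈ P)
    (h' : ∀ i ∉ J, -b i ∈ P) : S ≤ P := by
  intro m hm
  rw [← b.sum_repr m]
  refine sum_mem fun i _ => ?_
  by_cases hi : 0 ≤ b.repr m i
  · rw [← Int.toNat_of_nonneg hi, natCast_zsmul]
    exact nsmul_mem (h i) _
  · have hiJ : i ∉ J := fun hiJ => hi ((hS m).1 hm i hiJ)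
    have e : b.repr m i • b i = (-b.repr m i).toNat • (-b i) := by
      rw [← natCast_zsmul, Int.toNat_of_nonneg (by omega), smul_neg, neg_smul, neg_neg]
    rw [e]
    exact nsmul_mem (h' i hiJ) _

theorem sub_basis_mem_or (i : ι) {m : M} (hm : m ∈ S) : m - b i ∈ S ∨ i ∈ J ∧ b.repr m i = 0 := by
  classical
  by_cases h : i ∈ J ∧ b.repr m i = 0
  · exact Or.inr h
  · refine Or.inl ((hS _).2 fun j hj => ?_)
    have h1 := (hS m).1 hm j hj
    rw [map_sub, b.repr_self, Finsupp.sub_apply, Finsupp.single_apply]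
    by_cases hij : i = j
    · subst hij
      have : b.repr m i ≠ 0 := fun e => h ⟨hj, e⟩
      rw [if_pos rfl]
      omega
    · rw [if_neg hij]; omega

theorem exists_eq_sub_of_repr_eq_zero [Fintype ι] {j : ι} {m : M} (hm : b.repr m j = 0) :
    ∃ a ∈ S, ∃ c ∈ S, b.repr a j = 0 ∧ b.repr c j = 0 ∧ m = a - c := by
  classical
  have key : ∀ r : ι → ℤ, (∀ i, 0 ≤ r i) → r j = 0 →
      ∑ i, r i • b i ∈ S ∧ b.repr (∑ i, r i • b i) j = 0 := by
    intro r hr hrj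
    have e : ∀ i, b.repr (∑ i, r i • b i) i = r i := fun i => by
      rw [b.repr_sum_self]
    exact ⟨(hS _).2 fun i _ => by rw [e]; exact hr i, by rw [e, hrj]⟩
  obtain ⟨h1, h2⟩ := key (fun i => max (b.repr m i) 0) (fun i => le_max_right _ _) (by simp [hm])
  obtain ⟨h3, h4⟩ := key (fun i => max (-b.repr m i) 0) (fun i => le_max_right _ _) (by simp [hm])
  refine ⟨_, h1, _, h3, h2, h4, ?_⟩
  rw [← Finset.sum_sub_distrib]
  conv_lhs => rw [← b.sum_repr m]
  refine Finset.sum_congr rfl fun i _ => ?_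
  rw [← sub_smul]
  congr 1
  rcases le_total 0 (b.repr m i) with h | h
  · rw [max_eq_left h, max_eq_right (by omega), sub_zero]
  · rw [max_eq_right h, max_eq_left (by omega), zero_sub, neg_neg]

end

variable (k : Type u) [Field k]

theorem isDomain_of_basis {M : Type u} [AddCommGroup M] (S : AddSubmonoid M) {ι : Type u}
    (b : Module.Basis ι ℤ M) : IsDomain (AddMonoidAlgebra k S) := by
  have : UniqueSums S := UniqueSums.of_injective_addHom
    ((b.repr.toAddEquiv.toAddMonoidHom.comp S.subtype : S →+ (ι →₀ ℤ)) : S →ₙ+ (ι →₀ ℤ))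
    (b.repr.injective.comp Subtype.val_injective) inferInstance
  have : NoZeroDivisors (AddMonoidAlgebra k S) := inferInstance
  exact NoZeroDivisors.to_isDomain _

variable {k}

/-- The additive map of semigroup algebras with given values on monomials. -/
noncomputable def monomialMap (E : S → AddMonoidAlgebra k S) :
    AddMonoidAlgebra k S →+ AddMonoidAlgebra k S :=
  AddMonoidAlgebra.liftNC (algebraMap k (AddMonoidAlgebra k S)).toAddMonoidHom
    fun m => E m.toAdd

theorem monomialMap_single (E : S → AddMonoidAlgebra k S) (m : S) (c : k) :
    monomialMap E (.single m c) = c • E m := by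
  rw [monomialMap, AddMonoidAlgebra.liftNC_single, Algebra.smul_def]; rfl

theorem monomialMap_mul {E : S → AddMonoidAlgebra k S}
    (hE : ∀ m m', E (m + m') = .single m 1 * E m' + .single m' 1 * E m)
    (x y : AddMonoidAlgebra k S) :
    monomialMap E (x * y) = x * monomialMap E y + y * monomialMap E x := by
  induction x using AddMonoidAlgebra.induction_linear with
  | zero => simp
  | add x x' hx hx' => rw [add_mul, map_add, hx, hx', map_add]; ring
  | single m c =>
    induction y using AddMonoidAlgebra.induction_linear with
    | zero => simp
    | add y y' hy hy' => rw [mul_add, map_add, hy, hy', map_add]; ring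
    | single m' c' =>
      have e : ∀ (m : S) (c : k), (.single m c : AddMonoidAlgebra k S) = c • .single m 1 := by
        intro m c
        rw [AddMonoidAlgebra.smul_single, smul_eq_mul, mul_one]
      rw [AddMonoidAlgebra.single_mul_single, monomialMap_single, monomialMap_single,
        monomialMap_single, hE, e m c, e m' c', smul_mul_smul_comm, smul_mul_smul_comm, smul_add,
        mul_comm c' c]

theorem monomialMap_algebraMap {E : S → AddMonoidAlgebra k S} (hE : E 0 = 0) (c : k) :
    monomialMap E (algebraMap k _ c) = 0 := by
  have : algebraMap k (AddMonoidAlgebra k S) c = .single 0 c := rfl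
  rw [this, monomialMap_single, hE, smul_zero]

/-- The derivation `χ^m ↦ w(m) χ^m` of `k[S]` given by a one-parameter subgroup `w` of the torus. -/
noncomputable def eulerMap (k : Type u) [Field k] (S : AddSubmonoid M) (w : M →+ ℤ) :
    AddMonoidAlgebra k S →+ AddMonoidAlgebra k S :=
  monomialMap fun m => .single m (w m.1 : k)

theorem eulerMap_single (w : M →+ ℤ) (m : S) (c : k) :
    eulerMap k S w (.single m c) = .single m (c * w m.1) := by
  rw [eulerMap, monomialMap_single, AddMonoidAlgebra.smul_single, smul_eq_mul]

theorem eulerMap_mul (w : M →+ ℤ) (x y : AddMonoidAlgebra k S) :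
    eulerMap k S w (x * y) = x * eulerMap k S w y + y * eulerMap k S w x := by
  refine monomialMap_mul (fun m m' => ?_) x y
  rw [AddMonoidAlgebra.single_mul_single, AddMonoidAlgebra.single_mul_single, add_comm m' m,
    ← AddMonoidAlgebra.single_add]
  congr 1
  simp [add_comm]

theorem eulerMap_algebraMap (w : M →+ ℤ) (c : k) : eulerMap k S w (algebraMap k _ c) = 0 :=
  monomialMap_algebraMap (by simp) c

open Classical in
/-- The partial derivative `χ^m ↦ m_i χ^(m - b_i)` of `k[S]` with respect to the coordinate
`χ^(b_i)`. The coefficient `m_i` vanishes if `m - b_i ∉ S`. -/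
noncomputable def partialMap (k : Type u) [Field k] (S : AddSubmonoid M) (b : Module.Basis ι ℤ M)
    (i : ι) : AddMonoidAlgebra k S →+ AddMonoidAlgebra k S :=
  monomialMap fun m =>
    if h : m.1 - b i ∈ S then .single ⟨m.1 - b i, h⟩ (b.repr m.1 i : k) else 0

theorem partialMap_mul (hS : ∀ m, m ∈ S ↔ ∀ j ∈ J, 0 ≤ b.repr m j) (i : ι)
    (x y : AddMonoidAlgebra k S) :
    partialMap k S b i (x * y) = x * partialMap k S b i y + y * partialMap k S b i x := by
  classical
  let F : S → k → AddMonoidAlgebra k S := fun m c =>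
    if h : m.1 - b i ∈ S then .single ⟨m.1 - b i, h⟩ c else 0
  have hF : ∀ m m' : S, (.single m' 1 * F m (b.repr m.1 i : k) : AddMonoidAlgebra k S) =
      F (m + m') (b.repr m.1 i : k) := by
    intro m m'
    rcases sub_basis_mem_or hS i m.2 with h | h
    · have e : (m + m').1 - b i = m'.1 + (m.1 - b i) := by
        rw [AddSubmonoid.coe_add]; abel
      have h' : (m + m').1 - b i ∈ S := by
        rw [e]
        exact add_mem m'.2 h
      simp only [F, dif_pos h, dif_pos h', AddMonoidAlgebra.single_mul_single, one_mul]
      congr 1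
      exact Subtype.ext e.symm
    · simp [F, h.2]
  have hF' : ∀ m c c', F m c + F m c' = F m (c + c') := by
    intro m c c'
    simp only [F]
    split_ifs
    · exact (AddMonoidAlgebra.single_add _ _ _).symm
    · exact add_zero _
  refine monomialMap_mul (fun m m' => ?_) x y
  change F (m + m') _ = _ * F m' _ + _ * F m _
  rw [hF, hF, add_comm m' m, hF']
  congr 1
  simp [add_comm]

theorem partialMap_algebraMap (i : ι) (c : k) : partialMap k S b i (algebraMap k _ c) = 0 :=
  monomialMap_algebraMap (by simp) c

theorem partialMap_basis [DecidableEq ι] (hS : ∀ m, m ∈ S ↔ ∀ j ∈ J, 0 ≤ b.repr m j) (i j : ι) :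
    partialMap k S b i (.single ⟨b j, basis_mem hS j⟩ 1) = if i = j then 1 else 0 := by
  rw [partialMap, monomialMap_single, one_smul]
  by_cases h : i = j
  · subst h
    rw [dif_pos (by rw [sub_self]; exact zero_mem S), if_pos rfl, AddMonoidAlgebra.one_def]
    congr 1
    · exact Subtype.ext (sub_self _)
    · simp
  · rw [if_neg h]
    split_ifs
    · rw [b.repr_self, Finsupp.single_eq_of_ne h, Int.cast_zero]
      exact AddMonoidAlgebra.single_zero _
    · rfl

/-- A derivation of `k[S]` is determined by its values on the coordinates. -/
theorem derivation_ext [Fintype ι] (hS : ∀ m, m ∈ S ↔ ∀ j ∈ J, 0 ≤ b.repr m j) {B : Type u}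
    [CommRing B] (g : AddMonoidAlgebra k S →+* B) {d d' : AddMonoidAlgebra k S →+ B}
    (hd : ∀ x y, d (x * y) = g x * d y + g y * d x)
    (hd' : ∀ x y, d' (x * y) = g x * d' y + g y * d' x)
    (hc : ∀ c, d (algebraMap k _ c) = 0) (hc' : ∀ c, d' (algebraMap k _ c) = 0)
    (h : ∀ i, d (.single ⟨b i, basis_mem hS i⟩ 1) = d' (.single ⟨b i, basis_mem hS i⟩ 1)) :
    d = d' := by
  have hone : ∀ {d : AddMonoidAlgebra k S →+ B}, (∀ c, d (algebraMap k _ c) = 0) →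
      d (.single 0 1) = 0 := fun h => h 1
  have hle : S ≤ AddSubmonoid.map S.subtype
      { carrier := {m : S | d (.single m 1) = d' (.single m 1)}
        zero_mem' := (hone hc).trans (hone hc').symm
        add_mem' := fun {m m'} hm hm' => by
          have e : (.single (m + m') 1 : AddMonoidAlgebra k S) = .single m 1 * .single m' 1 := by
            rw [AddMonoidAlgebra.single_mul_single, one_mul]
          change d (.single (m + m') 1) = d' (.single (m + m') 1)
          rw [e, hd, hd', show d (.single m 1) = d' (.single m 1) from hm,
            show d (.single m' 1) = d' (.single m' 1) from hm'] } := by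
    refine le_of_basis_mem hS (fun i => ⟨⟨b i, basis_mem hS i⟩, h i, rfl⟩) fun i hi =>
      ⟨⟨-b i, neg_basis_mem hS hi⟩, ?_, rfl⟩
    -- `d (x⁻¹) = -x⁻² d x` for the unit `x = χ^(b i)`
    have e : (.single ⟨b i, basis_mem hS i⟩ 1 * .single ⟨-b i, neg_basis_mem hS hi⟩ 1 :
        AddMonoidAlgebra k S) = .single 0 1 := by
      rw [AddMonoidAlgebra.single_mul_single, one_mul]
      congr 1
      exact Subtype.ext (add_neg_cancel _)
    have hu : IsUnit (g (.single ⟨b i, basis_mem hS i⟩ 1)) := by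
      refine IsUnit.map g (IsUnit.of_mul_eq_one _ (e.trans ?_))
      rw [AddMonoidAlgebra.one_def]
    have h1 := congrArg d e
    have h2 := congrArg d' e
    rw [hd, hone hc] at h1
    rw [hd', hone hc', ← h, ← h1] at h2
    exact (hu.mul_left_cancel (add_right_cancel h2)).symm
  refine AddMonoidHom.ext fun x => ?_
  induction x using AddMonoidAlgebra.induction_linear with
  | zero => rw [map_zero, map_zero]
  | add x y hx hy => rw [map_add, map_add, hx, hy]
  | single m c =>
    obtain ⟨m', hm', hmm⟩ := hle m.2
    obtain rfl : m' = m := Subtype.ext hmm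
    have e : (.single m' c : AddMonoidAlgebra k S) = algebraMap k _ c * .single m' 1 := by
      rw [← Algebra.smul_def, AddMonoidAlgebra.smul_single, smul_eq_mul, mul_one]
    rw [e, hd, hd', hc, hc', show d (.single m' 1) = d' (.single m' 1) from hm']

/-- The projection of `k[S]` to the span of the monomials `χ^m` with `m_j = 0`. -/
theorem exists_projection (hS : ∀ m, m ∈ S ↔ ∀ j ∈ J, 0 ≤ b.repr m j) {j : ι} (hj : j ∈ J) :
    ∃ ρ : AddMonoidAlgebra k S →+* AddMonoidAlgebra k S,
      (∀ (m : S) (c : k), b.repr m.1 j = 0 → ρ (.single m c) = .single m c) ∧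
      ∀ (m : S) (c : k), b.repr m.1 j ≠ 0 → ρ (.single m c) = 0 := by
  classical
  refine ⟨(AddMonoidAlgebra.lift k (AddMonoidAlgebra k S) S
    { toFun := fun m => if b.repr m.toAdd.1 j = 0 then .single m.toAdd 1 else 0
      map_one' := by
        change (if b.repr (0 : M) j = 0 then AddMonoidAlgebra.single (0 : S) (1 : k) else 0) = 1
        rw [map_zero, Finsupp.zero_apply, if_pos rfl]; rfl
      map_mul' := fun m m' => by
        have h1 := (hS _).1 m.toAdd.2 j hj
        have h2 := (hS _).1 m'.toAdd.2 j hj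
        have h3 : b.repr (m * m').toAdd.1 j = b.repr m.toAdd.1 j + b.repr m'.toAdd.1 j := by
          rw [← Finsupp.add_apply, ← map_add]; rfl
        rw [h3]
        by_cases h4 : b.repr m.toAdd.1 j = 0
        · by_cases h5 : b.repr m'.toAdd.1 j = 0
          · rw [if_pos h4, if_pos h5, if_pos (by omega), AddMonoidAlgebra.single_mul_single, mul_one]
            rfl
          · rw [if_neg h5, if_neg (by omega), mul_zero]
        · rw [if_neg h4, if_neg (by omega), zero_mul] }).toRingHom, fun m c hm => ?_, fun m c hm => ?_⟩
  · refine (AddMonoidAlgebra.lift_single _ _ _).trans ?_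
    change c • (if b.repr m.1 j = 0 then _ else _) = _
    rw [if_pos hm, AddMonoidAlgebra.smul_single, smul_eq_mul, mul_one]; rfl
  · refine (AddMonoidAlgebra.lift_single _ _ _).trans ?_
    change c • (if b.repr m.1 j = 0 then _ else _) = _
    rw [if_neg hm, smul_zero]

/-- A coordinate of `k[S]` generates a prime ideal, which consists of the elements that only involve
monomials divisible by this coordinate. -/
theorem isPrime_span_coordinate (hS : ∀ m, m ∈ S ↔ ∀ j ∈ J, 0 ≤ b.repr m j) {j : ι} (hj : j ∈ J) :
    (Ideal.span {(.single ⟨b j, basis_mem hS j⟩ 1 : AddMonoidAlgebra k S)}).IsPrime ∧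
      ∀ m : S, .single m 1 ∈ Ideal.span {(.single ⟨b j, basis_mem hS j⟩ 1 : AddMonoidAlgebra k S)} ↔
        0 < b.repr m.1 j := by
  obtain ⟨ρ, hρ0, hρ1⟩ := exists_projection (k := k) hS hj
  have hbj : b.repr (b j) j = 1 := by rw [b.repr_self, Finsupp.single_eq_same]
  have hker : Ideal.span {(.single ⟨b j, basis_mem hS j⟩ 1 : AddMonoidAlgebra k S)} =
      RingHom.ker ρ := by
    refine le_antisymm ?_ ?_
    · rw [Ideal.span_singleton_le_iff_mem, RingHom.mem_ker]
      refine hρ1 _ _ ?_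
      rw [hbj]; exact one_ne_zero
    · intro x hx
      have key : ∀ x, x - ρ x ∈
          Ideal.span {(.single ⟨b j, basis_mem hS j⟩ 1 : AddMonoidAlgebra k S)} := by
        intro x
        induction x using AddMonoidAlgebra.induction_linear with
        | zero => rw [map_zero, sub_zero]; exact zero_mem _
        | add x y hx hy =>
          rw [map_add, add_sub_add_comm]
          exact add_mem hx hy
        | single m c =>
          by_cases h : b.repr m.1 j = 0
          · rw [hρ0 m c h, sub_self]; exact zero_mem _
          · rw [hρ1 m c h, sub_zero]
            have h1 : m.1 - b j ∈ S :=
              (sub_basis_mem_or hS j m.2).resolve_right fun h' => h h'.2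
            refine Ideal.mem_span_singleton.2 ⟨.single ⟨_, h1⟩ c, ?_⟩
            rw [AddMonoidAlgebra.single_mul_single, one_mul]
            congr 1
            exact Subtype.ext (add_sub_cancel _ _).symm
      have := key x
      rwa [RingHom.mem_ker.1 hx, sub_zero] at this
  rw [hker]
  have := isDomain_of_basis k S b
  refine ⟨RingHom.ker_isPrime ρ, fun m => ?_⟩
  rw [RingHom.mem_ker]
  have h1 := (hS _).1 m.2 j hj
  by_cases h : b.repr m.1 j = 0
  · rw [hρ0 m 1 h, h]
    simp [AddMonoidAlgebra.single_eq_zero]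
  · rw [hρ1 m 1 h]
    simp only [true_iff]
    omega

end RegularSemigroups

/-! ### Torus-invariant prime ideals -/

section InvariantIdeals

variable {N : Type u} [AddCommGroup N] {k : Type u} [Field k]

/-- The points of the torus over an infinite field separate the characters. -/
theorem exists_character_ne [Infinite k] {m m' : Module.Dual ℤ N} (h : m ≠ m') :
    ∃ t : Torus N k, character t (.ofAdd m) ≠ character t (.ofAdd m') := by
  classical
  obtain ⟨v, hv⟩ : ∃ v, m v ≠ m' v := by
    by_contra! H
    exact h (LinearMap.ext H)
  let n : ℕ := (m v - m' v).natAbs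
  have hn : 0 < n := Int.natAbs_pos.2 (sub_ne_zero.2 hv)
  obtain ⟨c, hc⟩ := Infinite.exists_notMem_finset
    (insert 0 (Polynomial.nthRoots n (1 : k)).toFinset)
  rw [Finset.mem_insert, not_or, Multiset.mem_toFinset, Polynomial.mem_nthRoots hn] at hc
  let u : kˣ := Units.mk0 c hc.1
  refine ⟨v ⊗ₜ[ℤ] Additive.ofMul u, fun e => hc.2 ?_⟩
  rw [character_tmul, character_tmul] at e
  have h1 : u ^ (m v - m' v) = 1 := by
    rw [zpow_sub, e, mul_inv_cancel]
  have h2 : u ^ n = 1 := by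
    rcases Int.natAbs_eq (m v - m' v) with h | h
    · rw [h, zpow_natCast] at h1
      exact h1
    · rw [h, zpow_neg, inv_eq_one, zpow_natCast] at h1
      exact h1
  have := congrArg Units.val h2
  simpa [u] using this

theorem coeff_torusCoordHom (t : Torus N k) (σ : PointedCone ℝ (ℝ ⊗[ℤ] N)) (x : coordRing k σ)
    (m : dualMonoid σ) :
    (torusCoordHom t σ x).coeff m = x.coeff m * character t (.ofAdd m.1) := by
  classical
  induction x using AddMonoidAlgebra.induction_linear with
  | zero => simp
  | add x y hx hy => simp [hx, hy, add_mul]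
  | single m' c =>
    rw [torusCoordHom_single, AddMonoidAlgebra.coeff_single, AddMonoidAlgebra.coeff_single,
      Finsupp.single_apply, Finsupp.single_apply]
    split_ifs with h
    · rw [h]
    · rw [zero_mul]

/-- A nonzero torus-invariant ideal contains a monomial: take a nonzero element with as few terms as
possible. -/
theorem exists_monomial_mem [Infinite k] {σ : PointedCone ℝ (ℝ ⊗[ℤ] N)} {P : Ideal (coordRing k σ)}
    (hP : ∀ (t : Torus N k), ∀ x ∈ P, torusCoordHom t σ x ∈ P) (h0 : P ≠ ⊥) :
    ∃ m : dualMonoid σ, .single m 1 ∈ P := by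
  classical
  have key : ∀ (n : ℕ) (x : coordRing k σ), x ∈ P → x ≠ 0 → x.coeff.support.card = n →
      ∃ m : dualMonoid σ, .single m 1 ∈ P := by
    intro n
    induction n using Nat.strong_induction_on with
    | _ n ih =>
      intro x hx hx0 hn
      have hc0 : x.coeff ≠ 0 := fun e => hx0 (AddMonoidAlgebra.coeff_injective e)
      obtain ⟨m, hm⟩ := Finsupp.support_nonempty_iff.2 hc0
      by_cases H : ∃ m' ∈ x.coeff.support, m' ≠ m
      · obtain ⟨m', hm', hne⟩ := H
        obtain ⟨t, ht⟩ := exists_character_ne (k := k) (m := m'.1) (m' := m.1)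
          fun e => hne (Subtype.ext e)
        let y : coordRing k σ := torusCoordHom t σ x -
          algebraMap k _ (character t (.ofAdd m.1) : k) * x
        have hy : ∀ a, y.coeff a = x.coeff a * ((character t (.ofAdd a.1) : k) -
            character t (.ofAdd m.1)) := by
          intro a
          have h1 : y.coeff a = (torusCoordHom t σ x).coeff a -
              (character t (.ofAdd m.1) : k) * x.coeff a := by
            rw [← smul_eq_mul (character t (.ofAdd m.1) : k)]
            simp only [y, ← Algebra.smul_def]
            simp
          rw [h1, coeff_torusCoordHom]; ring
        have hyP : y ∈ P := sub_mem (hP t x hx) (P.mul_mem_left _ hx)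
        have hsub : y.coeff.support ⊆ x.coeff.support.erase m := by
          intro a ha
          rw [Finsupp.mem_support_iff, hy] at ha
          refine Finset.mem_erase.2 ⟨?_, Finsupp.mem_support_iff.2 (left_ne_zero_of_mul ha)⟩
          rintro rfl
          simp at ha
        have hy0 : y ≠ 0 := by
          intro e
          have h1 := hy m'
          rw [e] at h1
          have h2 : x.coeff m' * ((character t (.ofAdd m'.1) : k) -
            character t (.ofAdd m.1)) = 0 := h1.symm
          rcases mul_eq_zero.1 h2 with h3 | h3
          · exact Finsupp.mem_support_iff.1 hm' h3
          · exact ht (Units.ext (sub_eq_zero.1 h3))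
        refine ih _ ?_ y hyP hy0 rfl
        rw [← hn]
        exact (Finset.card_le_card hsub).trans_lt (Finset.card_erase_lt_of_mem hm)
      · push Not at H
        refine ⟨m, ?_⟩
        have hx1 : x = .single m (x.coeff m) := by
          refine AddMonoidAlgebra.coeff_injective (Finsupp.ext fun a => ?_)
          rw [AddMonoidAlgebra.coeff_single, Finsupp.single_apply]
          split_ifs with h
          · rw [h]
          · by_contra hne
            exact h (H a (Finsupp.mem_support_iff.2 hne)).symm
        have hcm : x.coeff m ≠ 0 := Finsupp.mem_support_iff.1 hm
        have e : (.single m 1 : coordRing k σ) = algebraMap k _ (x.coeff m)⁻¹ * x := by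
          conv_rhs => rw [hx1]
          rw [← Algebra.smul_def, AddMonoidAlgebra.smul_single, smul_eq_mul,
            AddMonoidAlgebra.coeff_single, Finsupp.single_eq_same, inv_mul_cancel₀ hcm]
        rw [e]
        exact P.mul_mem_left _ hx
  obtain ⟨x, hx, hx0⟩ := Submodule.exists_mem_ne_zero_of_ne_bot h0
  exact key _ x hx hx0 rfl

/-- A torus-invariant prime ideal of height one is generated by a coordinate. -/
theorem exists_eq_span_coordinate [Infinite k] {σ : PointedCone ℝ (ℝ ⊗[ℤ] N)} {ι : Type u}
    [Fintype ι] {b : Module.Basis ι ℤ (Module.Dual ℤ N)} {J : Set ι}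
    (hS : ∀ m, m ∈ dualMonoid σ ↔ ∀ j ∈ J, 0 ≤ b.repr m j) {P : Ideal (coordRing k σ)}
    [P.IsPrime] (hP : ∀ (t : Torus N k), ∀ x ∈ P, torusCoordHom t σ x ∈ P) (hh : P.height = 1) :
    ∃ j ∈ J, P = Ideal.span {(.single ⟨b j, basis_mem hS j⟩ 1 : coordRing k σ)} := by
  have := isDomain_of_basis k (dualMonoid σ) b
  have hbot : P ≠ ⊥ := Ideal.ne_bot_of_height_eq_one hh
  obtain ⟨m, hm⟩ := exists_monomial_mem hP hbot
  have hJ : ∃ j ∈ J, (.single ⟨b j, basis_mem hS j⟩ 1 : coordRing k σ) ∈ P := by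
    by_contra! H
    have hle : dualMonoid σ ≤ AddSubmonoid.map (dualMonoid σ).subtype
        { carrier := {m : dualMonoid σ | (.single m 1 : coordRing k σ) ∉ P}
          zero_mem' := fun h => Ideal.IsPrime.ne_top ‹_› ((Ideal.eq_top_iff_one P).2 h)
          add_mem' := fun {m m'} hm hm' h => by
            have e : (.single (m + m') 1 : coordRing k σ) = .single m 1 * .single m' 1 := by
              rw [AddMonoidAlgebra.single_mul_single, one_mul]
            rw [e] at h
            exact (Ideal.IsPrime.mem_or_mem ‹_› h).elim hm hm' } := by
      have hunit : ∀ (i : ι) (hi : i ∉ J), (.single ⟨b i, basis_mem hS i⟩ 1 *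
          .single ⟨-b i, neg_basis_mem hS hi⟩ 1 : coordRing k σ) = 1 := by
        intro i hi
        rw [AddMonoidAlgebra.single_mul_single, one_mul, AddMonoidAlgebra.one_def]
        congr 1
        exact Subtype.ext (add_neg_cancel _)
      have htop := Ideal.IsPrime.ne_top (I := P) ‹_›
      refine le_of_basis_mem hS (fun i => ⟨⟨b i, basis_mem hS i⟩, fun h => ?_, rfl⟩) fun i hi =>
        ⟨⟨-b i, neg_basis_mem hS hi⟩, fun h => ?_, rfl⟩
      · by_cases hi : i ∈ J
        · exact H i hi h
        · refine htop ((Ideal.eq_top_iff_one P).2 ?_)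
          rw [← hunit i hi]
          exact P.mul_mem_right _ h
      · refine htop ((Ideal.eq_top_iff_one P).2 ?_)
        rw [← hunit i hi]
        exact P.mul_mem_left _ h
    obtain ⟨m', hm', hmm⟩ := hle m.2
    obtain rfl : m' = m := Subtype.ext hmm
    exact hm' hm
  obtain ⟨j, hj, hjP⟩ := hJ
  refine ⟨j, hj, ?_⟩
  obtain ⟨hprime, -⟩ := isPrime_span_coordinate (k := k) hS hj
  by_contra hne
  have hlt : Ideal.span {(.single ⟨b j, basis_mem hS j⟩ 1 : coordRing k σ)} < P :=
    lt_of_le_of_ne ((Ideal.span_singleton_le_iff_mem P).2 hjP) (Ne.symm hne)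
  have h1 := Ideal.height_add_one_le_of_lt_of_isPrime hlt
  rw [hh] at h1
  have h2 : (Ideal.span {(.single ⟨b j, basis_mem hS j⟩ 1 : coordRing k σ)}).height = 0 := by
    have h3 : (Ideal.span {(.single ⟨b j, basis_mem hS j⟩ 1 : coordRing k σ)}).height + 1 ≤
      0 + 1 := by rwa [zero_add]
    exact nonpos_iff_eq_zero.1 ((WithTop.add_le_add_iff_right WithTop.one_ne_top).1 h3)
  rw [Ideal.height_eq_zero_iff_eq_bot, Ideal.span_singleton_eq_bot] at h2
  exact one_ne_zero (AddMonoidAlgebra.single_eq_zero.1 h2)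

end InvariantIdeals

/-! ### The affine charts of a toric variety -/

open TopologicalSpace

theorem pullRes_comp {X Y Z : Scheme.{u}} (f : Y ⟶ X) (g : Z ⟶ Y) {U : X.Opens} {V : Y.Opens}
    {W : Z.Opens} (h : V ≤ f ⁻¹ᵁ U) (h' : W ≤ g ⁻¹ᵁ V) (x : Γ(X, U)) :
    pullRes g h' (pullRes f h x) =
      pullRes (g ≫ f) (h'.trans (g.preimage_mono h) : W ≤ g ⁻¹ᵁ f ⁻¹ᵁ U) x :=
  pullRes_rs _ _ _

theorem pullRes_congr {X Y : Scheme.{u}} {f g : Y ⟶ X} (e : f = g) {U : X.Opens} {V : Y.Opens}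
    (h : V ≤ f ⁻¹ᵁ U) (h' : V ≤ g ⁻¹ᵁ U) (x : Γ(X, U)) : pullRes f h x = pullRes g h' x := by
  subst e; rfl

section Charts

variable {N : Type u} [AddCommGroup N] [Module.Free ℤ N] [Module.Finite ℤ N]
  (k : Type u) [Field k] (Δ : Fan N)

instance (σ : Δ.Cone) : IsOpenImmersion (Δ.chart k σ) :=
  inferInstanceAs (IsOpenImmersion (colimit.ι (Δ.chartFunctor k) σ))

theorem map_comp_chart {τ σ : Δ.Cone} (h : τ ≤ σ) :
    affineToricMap k (show τ.1 ≤ σ.1 from h) ≫ Δ.chart k σ = Δ.chart k τ :=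
  colimit.w (Δ.chartFunctor k) (homOfLE h)

theorem chart_comp_structureMap (σ : Δ.Cone) : Δ.chart k σ ≫ Δ.structureMap k =
    Spec.map (CommRingCat.ofHom (algebraMap k (coordRing k σ.1))) :=
  colimit.ι_desc _ _

theorem chart_comp_torusAction (σ : Δ.Cone) (t : Torus N k) :
    Δ.chart k σ ≫ Δ.torusAction t =
      Spec.map (CommRingCat.ofHom (torusCoordHom t σ.1)) ≫ Δ.chart k σ :=
  ι_colimMap _ _

/-- The open subscheme `U_σ` of `X(Δ)`. -/
noncomputable def chartOpen (σ : Δ.Cone) : (Δ.toricVariety k).Opens := Δ.chart k σ ''ᵁ ⊤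

theorem mem_chartOpen {σ : Δ.Cone} {x : Δ.toricVariety k} :
    x ∈ chartOpen k Δ σ ↔ ∃ z, Δ.chart k σ z = x := by
  constructor
  · rintro ⟨z, -, rfl⟩; exact ⟨z, rfl⟩
  · rintro ⟨z, rfl⟩; exact ⟨z, trivial, rfl⟩

theorem isAffineOpen_chartOpen (σ : Δ.Cone) : IsAffineOpen (chartOpen k Δ σ) :=
  (isAffineOpen_top _).image_of_isOpenImmersion _

theorem le_preimage_chartOpen (σ : Δ.Cone) : ⊤ ≤ Δ.chart k σ ⁻¹ᵁ chartOpen k Δ σ :=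
  fun z _ => (mem_chartOpen k Δ).2 ⟨z, rfl⟩

theorem chartOpen_mono {τ σ : Δ.Cone} (h : τ ≤ σ) : chartOpen k Δ τ ≤ chartOpen k Δ σ := by
  intro x hx
  obtain ⟨z, rfl⟩ := (mem_chartOpen k Δ).1 hx
  rw [← map_comp_chart k Δ h]
  exact (mem_chartOpen k Δ).2 ⟨affineToricMap k h z, rfl⟩

theorem exists_mem_chartOpen (x : Δ.toricVariety k) : ∃ σ : Δ.Cone, x ∈ chartOpen k Δ σ := by
  obtain ⟨σ, z, hz⟩ := Scheme.IsLocallyDirected.ι_jointly_surjective (Δ.chartFunctor k) x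
  exact ⟨σ, (mem_chartOpen k Δ).2 ⟨z, hz⟩⟩

theorem exists_le_mem_chartOpen {σ σ' : Δ.Cone} {x : Δ.toricVariety k}
    (hx : x ∈ chartOpen k Δ σ) (hx' : x ∈ chartOpen k Δ σ') :
    ∃ τ : Δ.Cone, τ ≤ σ ∧ τ ≤ σ' ∧ x ∈ chartOpen k Δ τ := by
  obtain ⟨z, rfl⟩ := (mem_chartOpen k Δ).1 hx
  obtain ⟨z', hz'⟩ := (mem_chartOpen k Δ).1 hx'
  obtain ⟨τ, a, b, w, hw, -⟩ :=
    (Scheme.IsLocallyDirected.ι_eq_ι_iff (Δ.chartFunctor k)).1 hz'.symm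
  refine ⟨τ, a.le, b.le, (mem_chartOpen k Δ).2 ⟨w, ?_⟩⟩
  rw [← map_comp_chart k Δ a.le, ← hw]; rfl

/-- The functions on `U_σ`. -/
noncomputable def chartEquiv (σ : Δ.Cone) :
    coordRing k σ.1 ≃+* Γ(Δ.toricVariety k, chartOpen k Δ σ) :=
  ((Scheme.ΓSpecIso (.of (coordRing k σ.1))).symm ≪≫
    ((Δ.chart k σ).appIso ⊤).symm).commRingCatIsoToRingEquiv

theorem appIso_hom_eq_pullRes (σ : Δ.Cone) (a : Γ(Δ.toricVariety k, chartOpen k Δ σ)) :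
    ((Δ.chart k σ).appIso ⊤).hom a =
      pullRes (Δ.chart k σ) (le_preimage_chartOpen k Δ σ) a := by
  rw [Scheme.Hom.appIso_hom]
  rfl

theorem pullRes_chart_injective (σ : Δ.Cone) :
    Function.Injective (pullRes (Δ.chart k σ) (le_preimage_chartOpen k Δ σ)) := by
  intro a b hab
  rw [← appIso_hom_eq_pullRes, ← appIso_hom_eq_pullRes] at hab
  exact ((Δ.chart k σ).appIso ⊤).commRingCatIsoToRingEquiv.injective hab

theorem pullRes_chart_chartEquiv (σ : Δ.Cone) (a : coordRing k σ.1) :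
    pullRes (Δ.chart k σ) (le_preimage_chartOpen k Δ σ) (chartEquiv k Δ σ a) =
      (Scheme.ΓSpecIso (.of (coordRing k σ.1))).inv a := by
  rw [← appIso_hom_eq_pullRes]
  exact ((Δ.chart k σ).appIso ⊤).commRingCatIsoToRingEquiv.apply_symm_apply _

theorem pullRes_Spec_map {A B : Type u} [CommRing A] [CommRing B] (φ : A →+* B) {V : Opens _}
    (h : V ≤ Spec.map (CommRingCat.ofHom φ) ⁻¹ᵁ ⊤) (a : A) :
    pullRes (Spec.map (CommRingCat.ofHom φ)) h ((Scheme.ΓSpecIso (.of A)).inv a) =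
      rs le_top ((Scheme.ΓSpecIso (.of B)).inv (φ a)) :=
  congrArg (rs le_top) congr($(Scheme.ΓSpecIso_inv_naturality (CommRingCat.ofHom φ)) a).symm

theorem rs_chartEquiv {τ σ : Δ.Cone} (h : τ ≤ σ) (a : coordRing k σ.1) :
    rs (chartOpen_mono k Δ h) (chartEquiv k Δ σ a) =
      chartEquiv k Δ τ (coordRingMap k (show τ.1 ≤ σ.1 from h) a) := by
  apply pullRes_chart_injective k Δ τ
  rw [pullRes_chart_chartEquiv, pullRes_rs]
  have h2 := pullRes_Spec_map (coordRingMap k (show τ.1 ≤ σ.1 from h)) (V := ⊤) le_top a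
  rw [rs_refl] at h2
  rw [← h2, ← pullRes_chart_chartEquiv]
  refine (pullRes_congr (map_comp_chart k Δ h).symm _ _ _).trans (pullRes_comp _ _ _ _ _).symm

theorem chartEquiv_algebraMap (σ : Δ.Cone) (c : k) :
    chartEquiv k Δ σ (algebraMap k _ c) =
      rs (show chartOpen k Δ σ ≤ Δ.structureMap k ⁻¹ᵁ ⊤ from le_top)
        ((Δ.structureMap k).app ⊤ ((Scheme.ΓSpecIso (.of k)).inv c)) := by
  apply pullRes_chart_injective k Δ σ
  rw [pullRes_chart_chartEquiv]
  have h2 := pullRes_Spec_map (algebraMap k (coordRing k σ.1)) (V := ⊤) le_top c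
  rw [rs_refl] at h2
  rw [← h2]
  exact (pullRes_congr (chart_comp_structureMap k Δ σ).symm _ le_top _).trans
    (pullRes_comp (Δ.structureMap k) (Δ.chart k σ) le_top _ _).symm

theorem formallySmooth_coordRing (hsmooth : AlgebraicGeometry.Smooth (Δ.structureMap k))
    (σ : Δ.Cone) : Algebra.FormallySmooth k (coordRing k σ.1) := by
  have h : AlgebraicGeometry.Smooth (Δ.chart k σ ≫ Δ.structureMap k) := inferInstance
  rw [chart_comp_structureMap] at h
  have h1 := HasRingHomProperty.Spec_iff.1 h
  have h2 : Algebra.Smooth k (coordRing k σ.1) := by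
    rw [← RingHom.smooth_algebraMap]
    exact h1
  exact h2.formallySmooth

/-- The dual monoid of a cone of a smooth toric variety is given by the nonnegativity of some of the
coordinates with respect to a basis of `M`. -/
theorem exists_basis_dualMonoid (hsmooth : AlgebraicGeometry.Smooth (Δ.structureMap k))
    (σ : Δ.Cone) : ∃ (ι : Type u) (_ : Fintype ι) (b : Module.Basis ι ℤ (Module.Dual ℤ N))
      (J : Set ι), ∀ m, m ∈ dualMonoid σ.1 ↔ ∀ j ∈ J, 0 ≤ b.repr m j := by
  have hσ := Δ.isStronglyConvexRational _ σ.2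
  obtain ⟨deg, hdeg, hdeg0⟩ := exists_degree hσ.rational
  have : Algebra.FormallySmooth k (AddMonoidAlgebra k (dualMonoid σ.1)) :=
    formallySmooth_coordRing k Δ hsmooth σ
  exact exists_basis_of_formallySmooth k deg hdeg hdeg0 (exists_eq_sub hσ)

theorem opens_spec_field (O : (Spec (.of k)).Opens) : O = ⊥ ∨ O = ⊤ := by
  rw [or_iff_not_imp_left]
  intro hO
  obtain ⟨x, hx⟩ := (Opens.ne_bot_iff_nonempty O).1 hO
  refine Opens.ext (Set.eq_univ_of_forall fun y => ?_)
  have : y = x := Subsingleton.elim (α := PrimeSpectrum k) y x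
  rwa [this]

end Charts

/-! ### The weight of an invariant prime divisor -/

section Weight

variable {N : Type u} [AddCommGroup N] [Module.Free ℤ N] [Module.Finite ℤ N]
  {k : Type u} [Field k] {Δ : Fan N}

theorem basicOpen_rs {X : Scheme.{u}} {U V : X.Opens} (h : V ≤ U) (x : Γ(X, U)) :
    X.basicOpen (rs h x) = V ⊓ X.basicOpen x :=
  Scheme.basicOpen_res _ _ _

theorem rs_injective {Y : Scheme.{u}} [IsIntegral Y] {U V : Y.Opens} (h : V ≤ U) {y : Y}
    (hy : y ∈ V) : Function.Injective (rs h) :=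
  have : Nonempty V := ⟨⟨y, hy⟩⟩
  map_injective_of_isIntegral Y (homOfLE h)

theorem chart_mem_basicOpen_iff {σ : Δ.Cone} (z : affineToric k σ.1) (a : coordRing k σ.1) :
    Δ.chart k σ z ∈ (Δ.toricVariety k).basicOpen (chartEquiv k Δ σ a) ↔
      a ∉ PrimeSpectrum.asIdeal (R := coordRing k σ.1) z := by
  change z ∈ Δ.chart k σ ⁻¹ᵁ (Δ.toricVariety k).basicOpen (chartEquiv k Δ σ a) ↔ _
  have h := pullRes_chart_chartEquiv k Δ σ a
  have h1 : (affineToric k σ.1).basicOpen (pullRes (Δ.chart k σ) (le_preimage_chartOpen k Δ σ)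
      (chartEquiv k Δ σ a)) =
      Δ.chart k σ ⁻¹ᵁ (Δ.toricVariety k).basicOpen (chartEquiv k Δ σ a) := by
    refine (basicOpen_rs (le_preimage_chartOpen k Δ σ) _).trans ?_
    rw [top_inf_eq, Scheme.preimage_basicOpen]
  rw [← h1, h]
  exact (Iff.of_eq (congrArg (z ∈ ·)
    (basicOpen_eq_of_affine (R := .of (coordRing k σ.1)) a))).trans
    (PrimeSpectrum.mem_basicOpen _ _)

theorem genericPoint_mem {Y : Scheme.{u}} [IsIntegral Y] {V : Y.Opens} {y : Y} (hy : y ∈ V) :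
    genericPoint Y ∈ V :=
  (genericPoint_specializes y).mem_open V.2 hy

variable {Y : Scheme.{u}} [IsIntegral Y] {i : Y ⟶ Δ.toricVariety k}

/-- The point of the chart `U_σ` that is the generic point of `Y` corresponds to the prime ideal of
the functions on `U_σ` that vanish on `Y`. -/
theorem mem_asIdeal_iff {σ : Δ.Cone} {z : affineToric k σ.1}
    (hz : Δ.chart k σ z = i (genericPoint Y)) (a : coordRing k σ.1) :
    a ∈ PrimeSpectrum.asIdeal (R := coordRing k σ.1) z ↔
      i.app (chartOpen k Δ σ) (chartEquiv k Δ σ a) = 0 := by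
  rw [← not_iff_not, ← chart_mem_basicOpen_iff, hz]
  change genericPoint Y ∈ i ⁻¹ᵁ (Δ.toricVariety k).basicOpen (chartEquiv k Δ σ a) ↔ _
  rw [Scheme.preimage_basicOpen, ← not_iff_not, not_not, ← basicOpen_eq_bot_iff]
  constructor
  · intro h
    by_contra hne
    obtain ⟨y, hy⟩ := (TopologicalSpace.Opens.ne_bot_iff_nonempty _).1 hne
    exact h (genericPoint_mem hy)
  · rintro h
    rw [h]
    exact fun h => h

/-- The ideal of an invariant subvariety is stable under the torus: a point of the torus maps the
generic point of `Y` to a specialization. -/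
theorem torusCoordHom_mem_asIdeal (hinv : IsTorusInvariant Δ (Set.range i)) {σ : Δ.Cone}
    {z : affineToric k σ.1} (hz : Δ.chart k σ z = i (genericPoint Y)) (t : Torus N k)
    {a : coordRing k σ.1} (ha : a ∈ PrimeSpectrum.asIdeal (R := coordRing k σ.1) z) :
    torusCoordHom t σ.1 a ∈ PrimeSpectrum.asIdeal (R := coordRing k σ.1) z := by
  obtain ⟨y, hy⟩ : Δ.torusAction t (i (genericPoint Y)) ∈ Set.range i := by
    rw [← hinv t]
    exact ⟨_, ⟨_, rfl⟩, rfl⟩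
  have h1 : Δ.torusAction t (Δ.chart k σ z) =
      Δ.chart k σ (Spec.map (CommRingCat.ofHom (torusCoordHom t σ.1)) z) :=
    congr($(chart_comp_torusAction k Δ σ t) z)
  have h2 : i (genericPoint Y) ⤳ i y := (genericPoint_specializes y).map i.continuous
  rw [hy, ← hz, h1, (Δ.chart k σ).isOpenEmbedding.isInducing.specializes_iff] at h2
  exact (PrimeSpectrum.le_iff_specializes (R := coordRing k σ.1) _ _).2 h2 ha

theorem height_asIdeal {σ : Δ.Cone} {z : affineToric k σ.1} {x : Δ.toricVariety k}
    (hz : Δ.chart k σ z = x) (hx : ringKrullDim ((Δ.toricVariety k).presheaf.stalk x) = 1) :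
    (PrimeSpectrum.asIdeal (R := coordRing k σ.1) z).height = 1 := by
  subst hz
  have : (PrimeSpectrum.asIdeal (R := coordRing k σ.1) z).IsPrime :=
    PrimeSpectrum.isPrime (R := coordRing k σ.1) z
  have e : (Δ.toricVariety k).presheaf.stalk (Δ.chart k σ z) ≃+*
      Localization.AtPrime (PrimeSpectrum.asIdeal (R := coordRing k σ.1) z) :=
    (asIso ((Δ.chart k σ).stalkMap z) ≪≫
      Spec.stalkIso (.of (coordRing k σ.1)) z).commRingCatIsoToRingEquiv
  rw [ringKrullDim_eq_of_ringEquiv e, IsLocalization.AtPrime.ringKrullDim_eq_height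
    (PrimeSpectrum.asIdeal (R := coordRing k σ.1) z)] at hx
  exact_mod_cast hx

variable (i) in
/-- `w : M → ℤ` is the order of vanishing along `Y` of the characters, as seen on the chart `U_σ`: it
is nonnegative on `σ^∨ ∩ M`, a character vanishes on `Y ∩ U_σ` if and only if its weight is positive,
the ideal of `Y ∩ U_σ` is generated by a character of weight one, and the characters of weight zero
are quotients of characters in `σ^∨ ∩ M` of weight zero. -/
structure IsDivisorWeight (σ : Δ.Cone) (w : Module.Dual ℤ N →+ ℤ) : Prop where
  nonneg : ∀ m ∈ dualMonoid σ.1, 0 ≤ w m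
  app_eq_zero_iff : ∀ m : dualMonoid σ.1,
    i.app (chartOpen k Δ σ) (chartEquiv k Δ σ (.single m 1)) = 0 ↔ 0 < w m.1
  exists_eq_sub : ∀ m, w m = 0 →
    ∃ a ∈ dualMonoid σ.1, ∃ c ∈ dualMonoid σ.1, w a = 0 ∧ w c = 0 ∧ m = a - c
  exists_eq_one : ∃ m : dualMonoid σ.1, w m.1 = 1 ∧ ∀ a : coordRing k σ.1,
    i.app (chartOpen k Δ σ) (chartEquiv k Δ σ a) = 0 → ∃ a', a = .single m 1 * a'

theorem exists_isDivisorWeight [Infinite k] (hinv : IsTorusInvariant Δ (Set.range i))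
    (hdim : ringKrullDim ((Δ.toricVariety k).presheaf.stalk (i (genericPoint Y))) = 1)
    (hsmooth : AlgebraicGeometry.Smooth (Δ.structureMap k)) {σ : Δ.Cone}
    (hσ : i (genericPoint Y) ∈ chartOpen k Δ σ) : ∃ w, IsDivisorWeight i σ w := by
  obtain ⟨z, hz⟩ := (mem_chartOpen k Δ).1 hσ
  have hprime : (PrimeSpectrum.asIdeal (R := coordRing k σ.1) z).IsPrime :=
    PrimeSpectrum.isPrime (R := coordRing k σ.1) z
  obtain ⟨ι, _, b, J, hS⟩ := exists_basis_dualMonoid k Δ hsmooth σ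
  obtain ⟨j, hj, hP⟩ := exists_eq_span_coordinate hS
    (fun t a ha => torusCoordHom_mem_asIdeal hinv hz t ha) (height_asIdeal hz hdim)
  have hw : ∀ m, (b.coord j).toAddMonoidHom m = b.repr m j := fun m => rfl
  refine ⟨(b.coord j).toAddMonoidHom, fun m hm => (hS m).1 hm j hj, fun m => ?_, fun m hm => ?_,
    ⟨b j, basis_mem hS j⟩, ?_, fun a ha => ?_⟩
  · rw [← mem_asIdeal_iff hz, hP]
    exact (isPrime_span_coordinate hS hj).2 m
  · exact exists_eq_sub_of_repr_eq_zero hS hm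
  · rw [hw, b.repr_self, Finsupp.single_eq_same]
  · rw [← mem_asIdeal_iff hz, hP] at ha
    obtain ⟨a', rfl⟩ := Ideal.mem_span_singleton'.1 ha
    exact ⟨a', mul_comm _ _⟩

/-- The weights on a chart and on a smaller chart are proportional, hence equal as both take the
value one. -/
theorem IsDivisorWeight.eq_of_le {τ σ : Δ.Cone} (h : τ ≤ σ)
    (hτ : i (genericPoint Y) ∈ chartOpen k Δ τ) {w w' : Module.Dual ℤ N →+ ℤ}
    (hw : IsDivisorWeight i σ w) (hw' : IsDivisorWeight i τ w') : w = w' := by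
  have hker : ∀ m, w m = 0 → w' m = 0 := by
    have key : ∀ a (ha : a ∈ dualMonoid σ.1), w a = 0 → w' a = 0 := by
      intro a ha h0
      have ha' : a ∈ dualMonoid τ.1 := dualMonoid_anti (show τ.1 ≤ σ.1 from h) ha
      refine le_antisymm (not_lt.1 fun hpos => ?_) (hw'.nonneg a ha')
      have h1 := (hw'.app_eq_zero_iff ⟨a, ha'⟩).2 hpos
      have h2 := rs_chartEquiv k Δ h (.single ⟨a, ha⟩ 1)
      rw [coordRingMap_single] at h2
      have h3 : i.app (chartOpen k Δ σ) (chartEquiv k Δ σ (.single ⟨a, ha⟩ 1)) = 0 := by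
        refine rs_injective (i.preimage_mono (chartOpen_mono k Δ h)) hτ ?_
        rw [← app_rs i (chartOpen_mono k Δ h), h2, map_zero]
        exact h1
      exact (((hw.app_eq_zero_iff ⟨a, ha⟩).1 h3).ne' h0)
    intro m hm
    obtain ⟨a, ha, c, hc, ha0, hc0, rfl⟩ := hw.exists_eq_sub m hm
    rw [map_sub, key a ha ha0, key c hc hc0, sub_zero]
  obtain ⟨⟨m, hm⟩, hm1, -⟩ := hw.exists_eq_one
  obtain ⟨⟨m', hm'⟩, hm1', -⟩ := hw'.exists_eq_one
  dsimp only at hm1 hm1'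
  have hprop : ∀ l, w' l = w l * w' m := fun l => by
    have := hker (l - w l • m) (by rw [map_sub, map_zsmul, hm1]; simp)
    rw [map_sub, map_zsmul, sub_eq_zero] at this
    simpa using this
  have h1 : w' m = 1 := by
    have h2 := hprop m'
    rw [hm1'] at h2
    exact Int.eq_one_of_mul_eq_one_left
      (hw'.nonneg m (dualMonoid_anti (show τ.1 ≤ σ.1 from h) hm)) h2.symm
  ext l
  rw [hprop l, h1, mul_one]

/-- There is a common weight on all the charts that meet `Y`. -/
theorem exists_forall_isDivisorWeight
    (H : ∀ σ : Δ.Cone, i (genericPoint Y) ∈ chartOpen k Δ σ → ∃ w, IsDivisorWeight i σ w) :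
    ∃ w, ∀ σ : Δ.Cone, i (genericPoint Y) ∈ chartOpen k Δ σ → IsDivisorWeight i σ w := by
  obtain ⟨σ₀, hσ₀⟩ := exists_mem_chartOpen k Δ (i (genericPoint Y))
  obtain ⟨w, hw⟩ := H σ₀ hσ₀
  refine ⟨w, fun σ hσ => ?_⟩
  obtain ⟨w', hw'⟩ := H σ hσ
  obtain ⟨τ, h0, h, hτ⟩ := exists_le_mem_chartOpen k Δ hσ₀ hσ
  obtain ⟨v, hv⟩ := H τ hτ
  rwa [hw.eq_of_le h0 hτ hv, ← hw'.eq_of_le h hτ hv]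

end Weight

/-! ### Derivations on the charts -/

section Eval

variable {S X Y : Scheme.{u}} {f : Y ⟶ X} {p : X ⟶ S}

/-- The value of a section of the sheaf of derivations at a function. -/
noncomputable def derEval {V : Y.Opens} (U : X.Opens) (x : Γ(X, U)) :
    Γ(derivationSheaf f p, V) →+ Γ(Y, V ⊓ f ⁻¹ᵁ U) where
  toFun := fun (s : (derivations f p).sections V) => s.1 ⟨U, x⟩
  map_zero' := rfl
  map_add' _ _ := rfl

theorem isDerivationAlong_derEval {V : Y.Opens} (s : Γ(derivationSheaf f p, V)) :
    IsDerivationAlong f p V fun U x => derEval U x s :=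
  Subtype.property (show (derivations f p).sections V from s)

theorem derEval_ext {V : Y.Opens} {s t : Γ(derivationSheaf f p, V)}
    (h : ∀ U x, derEval U x s = derEval U x t) : s = t :=
  Subtype.ext (p := (· ∈ (derivations f p).sections V)) (funext fun a => h a.1 a.2)

theorem exists_derEval_eq {V : Y.Opens} {D : ∀ U : X.Opens, Γ(X, U) → Γ(Y, V ⊓ f ⁻¹ᵁ U)}
    (hD : IsDerivationAlong f p V D) :
    ∃ s : Γ(derivationSheaf f p, V), ∀ U x, derEval U x s = D U x :=
  ⟨(⟨fun a => D a.1 a.2, hD⟩ : (derivations f p).sections V), fun _ _ => rfl⟩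

theorem derEval_smul {V : Y.Opens} (U : X.Opens) (x : Γ(X, U)) (r : Γ(Y, V))
    (s : Γ(derivationSheaf f p, V)) : derEval U x (r • s) = rs inf_le_left r * derEval U x s :=
  rfl

theorem derEval_mrs {V V' : Y.Opens} (h : V' ≤ V) (U : X.Opens) (x : Γ(X, U))
    (s : Γ(derivationSheaf f p, V)) :
    derEval U x (mrs _ h s) = rs (inf_le_inf_right _ h) (derEval U x s) :=
  rfl

theorem derEval_pushApp {V : X.Opens} (U : X.Opens) (x : Γ(X, U)) (s : Γ(tangentSheaf p, V)) :
    derEval U x (pushApp (tangentToPushforward f p) V s) =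
      f.app (V ⊓ U) (derEval (f := 𝟙 X) U x s) :=
  rfl

end Eval

section ChartDerivations

variable {N : Type u} [AddCommGroup N] [Module.Free ℤ N] [Module.Finite ℤ N]
  {k : Type u} [Field k] {Δ : Fan N} {Y : Scheme.{u}} {f : Y ⟶ Δ.toricVariety k} {σ : Δ.Cone}
  {V : Y.Opens}

/-- A derivation of the coordinate ring `k[σ^∨ ∩ M]` extends to a derivation of the sheaf of
functions on `U_σ`. -/
theorem exists_derEval_chartEquiv (hV : V ≤ f ⁻¹ᵁ chartOpen k Δ σ)
    (d : coordRing k σ.1 →+ Γ(Y, V))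
    (hd : ∀ a b, d (a * b) = pullRes f hV (chartEquiv k Δ σ a) * d b +
      pullRes f hV (chartEquiv k Δ σ b) * d a)
    (hc : ∀ c, d (algebraMap k _ c) = 0) :
    ∃ s : Γ(derivationSheaf f (Δ.structureMap k), V), ∀ a,
      derEval (chartOpen k Δ σ) (chartEquiv k Δ σ a) s = rs inf_le_left (d a) := by
  obtain ⟨D, hD, hDa⟩ := exists_isDerivationAlong (f := f) (p := Δ.structureMap k) (V := V)
    (hV := hV) (isAffineOpen_chartOpen k Δ σ)
    (d := d.comp (chartEquiv k Δ σ).symm.toAddEquiv.toAddMonoidHom)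
    (opens_spec_field k) (fun a b => by
      have := hd ((chartEquiv k Δ σ).symm a) ((chartEquiv k Δ σ).symm b)
      rw [← map_mul] at this
      simpa using this) (fun c => by
      have h := chartEquiv_algebraMap k Δ σ ((Scheme.ΓSpecIso (.of k)).hom c)
      have h1 : (Scheme.ΓSpecIso (.of k)).inv ((Scheme.ΓSpecIso (.of k)).hom c) = c :=
        congr($((Scheme.ΓSpecIso (.of k)).hom_inv_id) c)
      rw [h1] at h
      rw [← h]
      simpa using hc _)
  obtain ⟨s, hs⟩ := exists_derEval_eq hD
  refine ⟨s, fun a => ?_⟩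
  rw [hs, hDa]
  simp

/-- A derivation over an open set that maps to `U_σ` is determined by its values on the coordinates
of `U_σ`. -/
theorem derEval_ext_chartEquiv {ι : Type u} [Fintype ι]
    {b : Module.Basis ι ℤ (Module.Dual ℤ N)} {J : Set ι}
    (hS : ∀ m, m ∈ dualMonoid σ.1 ↔ ∀ j ∈ J, 0 ≤ b.repr m j)
    (hV : V ≤ f ⁻¹ᵁ chartOpen k Δ σ) {s t : Γ(derivationSheaf f (Δ.structureMap k), V)}
    (h : ∀ j, derEval (chartOpen k Δ σ) (chartEquiv k Δ σ (.single ⟨b j, basis_mem hS j⟩ 1)) s =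
      derEval (chartOpen k Δ σ) (chartEquiv k Δ σ (.single ⟨b j, basis_mem hS j⟩ 1)) t) :
    s = t := by
  have hconst : ∀ (s : Γ(derivationSheaf f (Δ.structureMap k), V)) (c : k),
      derEval (chartOpen k Δ σ) (chartEquiv k Δ σ (algebraMap k _ c)) s = 0 := fun s c => by
    rw [chartEquiv_algebraMap, (isDerivationAlong_derEval s).map_res,
      (isDerivationAlong_derEval s).map_const ⊤, map_zero]
  let d : Γ(derivationSheaf f (Δ.structureMap k), V) →
      (coordRing k σ.1 →+ Γ(Y, V ⊓ f ⁻¹ᵁ chartOpen k Δ σ)) := fun s =>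
    AddMonoidHom.mk' (fun a => derEval (chartOpen k Δ σ) (chartEquiv k Δ σ a) s) fun a b => by
      rw [map_add, (isDerivationAlong_derEval s).map_add]
  have hd : ∀ s x y, d s (x * y) =
      ((pullRes f inf_le_right).comp (chartEquiv k Δ σ).toRingHom) x * d s y +
      ((pullRes f inf_le_right).comp (chartEquiv k Δ σ).toRingHom) y * d s x := fun s x y => by
    have := (isDerivationAlong_derEval s).leibniz _ (chartEquiv k Δ σ x) (chartEquiv k Δ σ y)
    rw [← map_mul] at this
    exact this
  have key : d s = d t :=
    derivation_ext (S := dualMonoid σ.1) hS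
      ((pullRes f inf_le_right).comp (chartEquiv k Δ σ).toRingHom) (hd s) (hd t) (hconst s)
      (hconst t) h
  refine derEval_ext fun U x =>
    (isDerivationAlong_derEval s).ext_of_isAffineOpen (isAffineOpen_chartOpen k Δ σ) hV
      (isDerivationAlong_derEval t) (fun a => ?_) U x
  have := DFunLike.congr_fun key ((chartEquiv k Δ σ).symm a)
  simpa [d] using this

/-- Derivations that are dual to the coordinates of `U_σ` form a basis of the sheaf of
derivations. -/
theorem existsUnique_coord {ι : Type u} [Fintype ι] [DecidableEq ι]
    {b : Module.Basis ι ℤ (Module.Dual ℤ N)} {J : Set ι}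
    (hS : ∀ m, m ∈ dualMonoid σ.1 ↔ ∀ j ∈ J, 0 ≤ b.repr m j)
    (hV : V ≤ f ⁻¹ᵁ chartOpen k Δ σ) {e : ι → Γ(derivationSheaf f (Δ.structureMap k), V)}
    (he : ∀ i j, derEval (chartOpen k Δ σ)
      (chartEquiv k Δ σ (.single ⟨b j, basis_mem hS j⟩ 1)) (e i) = if i = j then 1 else 0)
    (s : Γ(derivationSheaf f (Δ.structureMap k), V)) :
    ∃! c : ι → Γ(Y, V), s = ∑ j, c j • e j := by
  have hsum : ∀ (c : ι → Γ(Y, V)) j, derEval (chartOpen k Δ σ)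
      (chartEquiv k Δ σ (.single ⟨b j, basis_mem hS j⟩ 1)) (∑ j, c j • e j) =
      rs inf_le_left (c j) := fun c j => by
    rw [map_sum, Finset.sum_eq_single j]
    · rw [derEval_smul, he, if_pos rfl, mul_one]
    · intro i _ hij
      rw [derEval_smul, he, if_neg hij, mul_zero]
    · simp
  have hle : V ≤ V ⊓ f ⁻¹ᵁ chartOpen k Δ σ := le_inf le_rfl hV
  refine ⟨fun j => rs hle (derEval (chartOpen k Δ σ)
    (chartEquiv k Δ σ (.single ⟨b j, basis_mem hS j⟩ 1)) s), ?_, ?_⟩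
  · refine derEval_ext_chartEquiv hS hV fun j => ?_
    rw [hsum, rs_rs, rs_refl]
  · rintro c rfl
    funext j
    rw [hsum, rs_rs, rs_refl]

variable (f) in
/-- The partial derivatives with respect to the coordinates of `U_σ` form a local basis of the
tangent sheaf. -/
theorem exists_localBasis_tangentToPushforward
    (hsmooth : AlgebraicGeometry.Smooth (Δ.structureMap k)) (σ : Δ.Cone) :
    ∃ B : LocalBasis (tangentToPushforward f (Δ.structureMap k)), B.U = chartOpen k Δ σ := by
  classical
  obtain ⟨ι, hι, b, J, hS⟩ := exists_basis_dualMonoid k Δ hsmooth σ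
  have hid : ∀ a, pullRes (𝟙 (Δ.toricVariety k)) (le_refl (chartOpen k Δ σ)) a = a :=
    fun a => rs_refl _ _
  have H : ∀ j, ∃ s : Γ(tangentSheaf (Δ.structureMap k), chartOpen k Δ σ), ∀ a,
      derEval (f := 𝟙 _) (chartOpen k Δ σ) (chartEquiv k Δ σ a) s =
        rs inf_le_left (chartEquiv k Δ σ (partialMap k (dualMonoid σ.1) b j a)) := fun j =>
    exists_derEval_chartEquiv (f := 𝟙 _) (σ := σ) (V := chartOpen k Δ σ) le_rfl
      ((chartEquiv k Δ σ).toRingHom.toAddMonoidHom.comp (partialMap k (dualMonoid σ.1) b j))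
      (fun x y => by
        rw [hid, hid]
        exact (congrArg (chartEquiv k Δ σ) (partialMap_mul hS j x y)).trans (by simp))
      (fun c => (congrArg (chartEquiv k Δ σ) (partialMap_algebraMap j c)).trans (map_zero _))
  choose e he using H
  have he' : ∀ i j, derEval (f := 𝟙 _) (chartOpen k Δ σ)
      (chartEquiv k Δ σ (.single ⟨b j, basis_mem hS j⟩ 1)) (e i) = if i = j then 1 else 0 :=
    fun i j => by
      rw [he, partialMap_basis hS]
      split_ifs
      · exact (congrArg (rs _) (map_one (chartEquiv k Δ σ))).trans (map_one _)
      · exact (congrArg (rs _) (map_zero (chartEquiv k Δ σ))).trans (map_zero _)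
  refine ⟨⟨chartOpen k Δ σ, ι, hι, e, fun {V} h m => ?_, fun {V} h s => ?_⟩, rfl⟩
  · refine (existsUnique_coord (f := 𝟙 _) (V := V) hS h (fun i j => ?_) m).exists
    refine ((derEval_mrs (f := 𝟙 _) h _ _ (e i)).trans (congrArg (rs _) (he' i j))).trans ?_
    split_ifs
    · exact map_one _
    · exact map_zero _
  · refine existsUnique_coord (f := f) (V := V) hS h (fun i j => ?_) s
    rw [derEval_mrs, derEval_pushApp, he']
    split_ifs
    · exact (congrArg (rs (inf_le_inf_right (f ⁻¹ᵁ chartOpen k Δ σ) h))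
        (map_one (f.app (chartOpen k Δ σ ⊓ chartOpen k Δ σ)).hom)).trans (map_one _)
    · exact (congrArg (rs (inf_le_inf_right (f ⁻¹ᵁ chartOpen k Δ σ) h))
        (map_zero (f.app (chartOpen k Δ σ ⊓ chartOpen k Δ σ)).hom)).trans (map_zero _)

theorem isIso_restrictedTangentToDerivations (f : Y ⟶ Δ.toricVariety k)
    (hsmooth : AlgebraicGeometry.Smooth (Δ.structureMap k)) :
    IsIso (restrictedTangentToDerivations f (Δ.structureMap k)) :=
  isIso_of_localBasis fun y => by
    obtain ⟨σ, hσ⟩ := exists_mem_chartOpen k Δ (f y)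
    obtain ⟨B, hB⟩ := exists_localBasis_tangentToPushforward f hsmooth σ
    exact ⟨B, hB ▸ hσ⟩

end ChartDerivations

/-! ### The Euler field of an invariant prime divisor -/

section GlobalField

variable {S X : Scheme.{u}} {p : X ⟶ S} (t : Γ(tangentSheaf p, ⊤))

/-- A global vector field as an endomorphism of the structure sheaf. -/
noncomputable def fieldMap (U : X.Opens) (x : Γ(X, U)) : Γ(X, U) :=
  rs (show U ≤ ⊤ ⊓ (𝟙 X) ⁻¹ᵁ U from le_inf le_top le_rfl) (derEval (f := 𝟙 X) U x t)

theorem fieldMap_rs {U U' : X.Opens} (h : U' ≤ U) (x : Γ(X, U)) :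
    fieldMap t U' (rs h x) = rs h (fieldMap t U x) := by
  rw [fieldMap, (isDerivationAlong_derEval (f := 𝟙 X) t).map_res, rs_rs, fieldMap, rs_rs]

theorem fieldMap_add (U : X.Opens) (x y : Γ(X, U)) :
    fieldMap t U (x + y) = fieldMap t U x + fieldMap t U y := by
  rw [fieldMap, (isDerivationAlong_derEval (f := 𝟙 X) t).map_add, map_add]; rfl

theorem fieldMap_mul (U : X.Opens) (x y : Γ(X, U)) :
    fieldMap t U (x * y) = x * fieldMap t U y + y * fieldMap t U x := by
  have h : ∀ x : Γ(X, U), rs (show U ≤ ⊤ ⊓ (𝟙 X) ⁻¹ᵁ U from le_inf le_top le_rfl)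
      (pullSection (𝟙 X) ⊤ x) = x := fun x => (rs_rs _ _ _).trans (rs_refl _ _)
  rw [fieldMap, (isDerivationAlong_derEval (f := 𝟙 X) t).leibniz, map_add, map_mul, map_mul, h, h]
  rfl

theorem fieldMap_const (O : S.Opens) (c : Γ(S, O)) : fieldMap t (p ⁻¹ᵁ O) (p.app O c) = 0 := by
  rw [fieldMap, (isDerivationAlong_derEval (f := 𝟙 X) t).map_const, map_zero]

theorem derEval_id_mrs {V V' : X.Opens} (h : V' ≤ V) (U : X.Opens) (x : Γ(X, U))
    (s : Γ(tangentSheaf p, V)) : derEval (f := 𝟙 X) U x (mrs (tangentSheaf p) h s) =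
      rs (inf_le_inf_right _ h) (derEval (f := 𝟙 X) U x s) :=
  rfl

/-- A vector field is determined by its values on the functions on an affine open set. -/
theorem derEval_id_ext {U V : X.Opens} (hU : IsAffineOpen U) (h : V ≤ U)
    {s t : Γ(tangentSheaf p, V)} (H : ∀ a : Γ(X, U), derEval (f := 𝟙 X) V (rs h a) s =
      derEval (f := 𝟙 X) V (rs h a) t) : s = t := by
  refine derEval_ext (f := 𝟙 X) fun W x =>
    (isDerivationAlong_derEval (f := 𝟙 X) s).ext_of_isAffineOpen hU h
      (isDerivationAlong_derEval (f := 𝟙 X) t) (fun a => ?_) W x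
  have h1 := H a
  rw [(isDerivationAlong_derEval (f := 𝟙 X) s).map_res _ _ h,
    (isDerivationAlong_derEval (f := 𝟙 X) t).map_res _ _ h] at h1
  exact rs_injective_of_le _ (le_inf inf_le_left inf_le_left) h1

end GlobalField

theorem coordRingMap_eulerMap {N : Type u} [AddCommGroup N] {k : Type u} [Field k]
    {τ σ : PointedCone ℝ (ℝ ⊗[ℤ] N)} (h : τ ≤ σ)
    (w : Module.Dual ℤ N →+ ℤ) (a : coordRing k σ) :
    coordRingMap k h (eulerMap k (dualMonoid σ) w a) =
      eulerMap k (dualMonoid τ) w (coordRingMap k h a) := by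
  induction a using AddMonoidAlgebra.induction_linear with
  | zero => simp
  | add x y hx hy => simp only [map_add, hx, hy]
  | single m c =>
    rw [eulerMap_single, coordRingMap_single, coordRingMap_single, eulerMap_single]
    rfl

section EulerField

variable {N : Type u} [AddCommGroup N] [Module.Free ℤ N] [Module.Finite ℤ N]
  {k : Type u} [Field k] {Δ : Fan N}

/-- A one-parameter subgroup `w` of the torus gives the global vector field `χ^m ↦ w(m) χ^m` on the
toric variety. -/
theorem exists_fieldMap_eq (k : Type u) [Field k] (Δ : Fan N) (w : Module.Dual ℤ N →+ ℤ) :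
    ∃ t : Γ(tangentSheaf (Δ.structureMap k), ⊤), ∀ (σ : Δ.Cone) (a : coordRing k σ.1),
      fieldMap t (chartOpen k Δ σ) (chartEquiv k Δ σ a) =
        chartEquiv k Δ σ (eulerMap k (dualMonoid σ.1) w a) := by
  have hid : ∀ σ a, pullRes (𝟙 (Δ.toricVariety k)) (le_refl (chartOpen k Δ σ)) a = a :=
    fun σ a => rs_refl _ _
  have H : ∀ σ, ∃ s : Γ(tangentSheaf (Δ.structureMap k), chartOpen k Δ σ), ∀ a,
      derEval (f := 𝟙 _) (chartOpen k Δ σ) (chartEquiv k Δ σ a) s =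
        rs inf_le_left (chartEquiv k Δ σ (eulerMap k (dualMonoid σ.1) w a)) := fun σ =>
    exists_derEval_chartEquiv (f := 𝟙 _) (σ := σ) (V := chartOpen k Δ σ) le_rfl
      ((chartEquiv k Δ σ).toRingHom.toAddMonoidHom.comp (eulerMap k (dualMonoid σ.1) w))
      (fun x y => by
        rw [hid, hid]
        exact (congrArg (chartEquiv k Δ σ) (eulerMap_mul w x y)).trans (by simp))
      (fun c => (congrArg (chartEquiv k Δ σ) (eulerMap_algebraMap w c)).trans (map_zero _))
  choose s hs using H
  have hres : ∀ {τ σ : Δ.Cone} (h : τ ≤ σ), mrs _ (chartOpen_mono k Δ h) (s σ) = s τ := by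
    intro τ σ h
    refine derEval_id_ext (isAffineOpen_chartOpen k Δ σ) (chartOpen_mono k Δ h) fun a => ?_
    obtain ⟨a, rfl⟩ := (chartEquiv k Δ σ).surjective a
    rw [rs_chartEquiv k Δ h, hs, ← coordRingMap_eulerMap (show τ.1 ≤ σ.1 from h),
      ← rs_chartEquiv k Δ h, ← rs_chartEquiv k Δ h]
    rw [derEval_id_mrs,
      (isDerivationAlong_derEval (f := 𝟙 _) (s σ)).map_res _ _ (chartOpen_mono k Δ h), hs, rs_rs,
      rs_rs, rs_rs]
  obtain ⟨t, ht⟩ := mrs_glue (tangentSheaf (Δ.structureMap k)) (V := ⊤) (chartOpen k Δ)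
    (fun _ => le_top) (fun x _ => by
      obtain ⟨σ, hσ⟩ := exists_mem_chartOpen k Δ x
      exact TopologicalSpace.Opens.mem_iSup.2 ⟨σ, hσ⟩) s (fun σ σ' => by
      have H : ∀ x : (chartOpen k Δ σ ⊓ chartOpen k Δ σ' : (Δ.toricVariety k).Opens),
          ∃ τ : Δ.Cone, τ ≤ σ ∧ τ ≤ σ' ∧ x.1 ∈ chartOpen k Δ τ :=
        fun x => exists_le_mem_chartOpen k Δ x.2.1 x.2.2
      choose τ h h' hx using H
      refine mrs_ext _ (fun x => chartOpen k Δ (τ x))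
        (fun x => le_inf (chartOpen_mono k Δ (h x)) (chartOpen_mono k Δ (h' x)))
        (fun x hxV => TopologicalSpace.Opens.mem_iSup.2 ⟨⟨x, hxV⟩, hx _⟩) fun x => ?_
      rw [mrs_mrs, mrs_mrs, hres (h x), hres (h' x)])
  refine ⟨t, fun σ a => ?_⟩
  have h1 := hs σ a
  rw [← ht σ] at h1
  rw [derEval_id_mrs] at h1
  have h2 := congrArg (rs (show chartOpen k Δ σ ≤ chartOpen k Δ σ ⊓
    (𝟙 (Δ.toricVariety k)) ⁻¹ᵁ chartOpen k Δ σ from le_inf le_rfl le_rfl)) h1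
  rw [rs_rs, rs_rs, rs_refl] at h2
  exact h2

variable {Y : Scheme.{u}} {i : Y ⟶ Δ.toricVariety k}

/-- The vector field given by the weight of `Y` takes values in the ideal of `Y`. -/
theorem IsDivisorWeight.app_eulerMap {σ : Δ.Cone} {w : Module.Dual ℤ N →+ ℤ}
    (hw : IsDivisorWeight i σ w) (a : coordRing k σ.1) :
    i.app (chartOpen k Δ σ) (chartEquiv k Δ σ (eulerMap k (dualMonoid σ.1) w a)) = 0 := by
  induction a using AddMonoidAlgebra.induction_linear with
  | zero => simp
  | add x y hx hy => simp only [map_add, hx, hy, add_zero]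
  | single m c =>
    rw [eulerMap_single]
    rcases (hw.nonneg m.1 m.2).eq_or_lt with h | h
    · simp [← h]
    · have h1 : (.single m (c * w m.1) : coordRing k σ.1) =
          algebraMap k _ (c * w m.1) * .single m 1 := by
        rw [← Algebra.smul_def, AddMonoidAlgebra.smul_single, smul_eq_mul, mul_one]
      rw [h1, map_mul, map_mul, (hw.app_eq_zero_iff m).2 h, mul_zero]

/-- The vector field given by the weight of `Y` is an Euler field: locally, every function in the
ideal of `Y` is a multiple of an eigenvector of weight one in this ideal. -/
theorem isEulerField_fieldMap [IsIntegral Y] {w : Module.Dual ℤ N →+ ℤ}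
    (hw : ∀ σ : Δ.Cone, i (genericPoint Y) ∈ chartOpen k Δ σ → IsDivisorWeight i σ w)
    {t : Γ(tangentSheaf (Δ.structureMap k), ⊤)}
    (ht : ∀ (σ : Δ.Cone) (a : coordRing k σ.1), fieldMap t (chartOpen k Δ σ) (chartEquiv k Δ σ a) =
      chartEquiv k Δ σ (eulerMap k (dualMonoid σ.1) w a)) :
    IsEulerField i (Δ.structureMap k) (fieldMap t) := by
  have hgen : ∀ (σ : Δ.Cone) (y : Y), i y ∈ chartOpen k Δ σ →
      i (genericPoint Y) ∈ chartOpen k Δ σ := fun σ y hy =>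
    genericPoint_mem (V := i ⁻¹ᵁ chartOpen k Δ σ) hy
  have hchart : ∀ (σ : Δ.Cone) (y : Y), i y ∈ chartOpen k Δ σ →
      ∀ a : Γ(Δ.toricVariety k, chartOpen k Δ σ), i.app _ (fieldMap t _ a) = 0 := by
    intro σ y hy a
    obtain ⟨a, rfl⟩ := (chartEquiv k Δ σ).surjective a
    rw [ht]
    exact (hw σ (hgen σ y hy)).app_eulerMap a
  have hmem : ∀ (U : (Δ.toricVariety k).Opens) (x : Γ(Δ.toricVariety k, U)),
      fieldMap t U x ∈ idealSections i U := by
    intro U x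
    rw [mem_idealSections]
    refine rs_ext_of_mem fun y hy => ?_
    obtain ⟨σ, hσ⟩ := exists_mem_chartOpen k Δ (i y)
    obtain ⟨O, hOσ, hOU, a, b, hyO, hab, hb⟩ :=
      exists_fraction (isAffineOpen_chartOpen k Δ σ) x hσ hy
    refine ⟨i ⁻¹ᵁ O, i.preimage_mono hOU, hyO, ?_⟩
    have h1 := congrArg (fun z => i.app O (fieldMap t O z)) hab
    simp only [fieldMap_mul, fieldMap_rs, map_add, map_mul] at h1
    rw [app_rs i hOσ (fieldMap t _ a), app_rs i hOσ (fieldMap t _ b), hchart σ y hσ a,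
      hchart σ y hσ b, map_zero, mul_zero, add_zero] at h1
    rw [map_zero, ← app_rs i hOU]
    exact (hb.map (i.app O).hom).mul_right_eq_zero.1 h1
  refine ⟨fun U U' h x => fieldMap_rs t h x, fieldMap_add t, fieldMap_mul t, fieldMap_const t, hmem,
    fun V φ hφ U x => ?_⟩
  refine rs_ext_of_mem fun y hy => ?_
  obtain ⟨σ, hσ⟩ := exists_mem_chartOpen k Δ (i y)
  obtain ⟨O, hOσ, hOU, a, b, hyO, hab, hb⟩ :=
    exists_fraction (isAffineOpen_chartOpen k Δ σ) x.1 hσ hy.2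
  refine ⟨V ⊓ i ⁻¹ᵁ O, inf_le_inf_left V (i.preimage_mono hOU), ⟨hy.1, hyO⟩, ?_⟩
  obtain ⟨a, rfl⟩ := (chartEquiv k Δ σ).surjective a
  obtain ⟨m, hm1, hm⟩ := (hw σ (hgen σ y hσ)).exists_eq_one
  have ha : i.app _ (chartEquiv k Δ σ a) = 0 := by
    refine rs_injective (i.preimage_mono hOσ) (y := y) hyO ?_
    rw [← app_rs i hOσ, ← hab, map_mul, app_rs i hOU, mem_idealSections.1 x.2, map_zero, map_zero,
      mul_zero]
  obtain ⟨a', rfl⟩ := hm a ha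
  have hu₀ : i.app _ (chartEquiv k Δ σ (.single m 1)) = 0 :=
    ((hw σ (hgen σ y hσ)).app_eq_zero_iff m).2 (by rw [hm1]; exact one_pos)
  have hδu₀ : fieldMap t _ (chartEquiv k Δ σ (.single m 1)) = chartEquiv k Δ σ (.single m 1) := by
    rw [ht, eulerMap_single, hm1]; simp
  -- on `O`, the function `x` is `u * c / β` with `u` an equation of `Y` that is an eigenvector of
  -- the vector field
  generalize hu_def : chartEquiv k Δ σ (.single m 1) = u₀ at hu₀ hδu₀
  rw [map_mul, hu_def, map_mul] at hab
  have hu : rs hOσ u₀ ∈ idealSections i O := rs_mem_idealSections hOσ hu₀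
  have hδu : fieldMap t O (rs hOσ u₀) = rs hOσ u₀ := by rw [fieldMap_rs, hδu₀]
  have hξ : rs hOU x.1 ∈ idealSections i O := rs_mem_idealSections hOU x.2
  have e1 := hφ.map_res _ _ hOU x
  have e2 := hφ.map_res _ _ hOU ⟨fieldMap t U x.1, hmem U x.1⟩
  rw [← e1, ← e2]
  generalize rs hOσ u₀ = u at hu hδu hab
  generalize rs hOσ (chartEquiv k Δ σ a') = c at hab
  have e3 : (⟨rs hOU (fieldMap t U x.1), rs_mem_idealSections hOU (hmem U x.1)⟩ :
      idealSections i O) = ⟨fieldMap t O (rs hOU x.1), hmem _ _⟩ :=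
    Subtype.ext (fieldMap_rs t hOU x.1).symm
  rw [e3]
  generalize rs hOσ b = β at hab hb
  suffices H : ∀ (ξ : Γ(Δ.toricVariety k, O)) (hξ : ξ ∈ idealSections i O), β * ξ = u * c →
      φ O ⟨fieldMap t O ξ, hmem _ _⟩ = φ O ⟨ξ, hξ⟩ from H _ hξ hab
  clear hξ hab e1 e2 e3
  intro ξ hξ hab
  have hpull : ∀ z : Γ(Δ.toricVariety k, O), z ∈ idealSections i O → pullSection i V z = 0 :=
    fun z hz => by rw [pullSection, mem_idealSections.1 hz, map_zero]
  have e4 : β • (⟨fieldMap t O ξ, hmem _ _⟩ : idealSections i O) + fieldMap t O β • ⟨ξ, hξ⟩ =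
      fieldMap t O c • ⟨u, hu⟩ + β • ⟨ξ, hξ⟩ := by
    refine Subtype.ext ?_
    change β * fieldMap t O ξ + fieldMap t O β * ξ = fieldMap t O c * u + β * ξ
    have := congrArg (fieldMap t O) hab
    rw [fieldMap_mul, fieldMap_mul, hδu] at this
    linear_combination this - hab
  have e5 := congrArg (φ O) e4
  rw [hφ.map_add, hφ.map_add, hφ.map_smul, hφ.map_smul, hφ.map_smul, hφ.map_smul,
    hpull _ (hmem _ _), hpull _ (hmem _ _), zero_mul, zero_mul, add_zero, zero_add] at e5
  exact (hb.map (pullRes i (inf_le_right : V ⊓ i ⁻¹ᵁ O ≤ i ⁻¹ᵁ O))).mul_left_cancel e5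

end EulerField

end Toric

theorem proposition3p1 {k : Type u} [Field k] [IsAlgClosed k]
    {N : Type u} [AddCommGroup N] [Module.Free ℤ N] [Module.Finite ℤ N] (Δ : Toric.Fan N)
    (hsmooth : AlgebraicGeometry.Smooth (Δ.structureMap k))
    (hproj : Toric.IsProjectiveOver (Δ.structureMap k))
    {Y : Scheme.{u}} (i : Y ⟶ Δ.toricVariety k) (hY : Toric.IsPrimeDivisor i)
    (hinv : Toric.IsTorusInvariant Δ (Set.range i)) :
    ∃ _ : IsIso (Toric.restrictedTangentToDerivations i (Δ.structureMap k)),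
      Nonempty (Toric.normalSequence i (Δ.structureMap k)).Splitting := by
  have := hY.isClosedImmersion
  have := hY.isIntegral
  have : Infinite k := IsAlgClosed.instInfinite
  have hiso := Toric.isIso_restrictedTangentToDerivations i hsmooth
  obtain ⟨w, hw⟩ := Toric.exists_forall_isDivisorWeight fun σ hσ =>
    Toric.exists_isDivisorWeight hinv hY.codim_one hsmooth hσ
  obtain ⟨t, ht⟩ := Toric.exists_fieldMap_eq k Δ w
  obtain ⟨s, hs⟩ := (Toric.isEulerField_fieldMap hw ht).exists_section
  exact ⟨hiso, Toric.nonempty_splitting s hs⟩
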